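/- Let $I\subset\mathbb R$ be an interval with more than one point, let $S^2$ be the unit sphere with round metric $\sigma_{AB}$, area form $\epsilon_{AB}$ (outward orientation) and Levi-Civita connection $\nabla$, and let $\tilde X^1,\tilde X^2,\tilde X^3$ be the restrictions of the Cartesian coordinates; $\epsilon^{ijk}$ is the Levi-Civita symbol. Let $(m,N_A,C_{AB})$ be smooth null infinity data on $I\times S^2$ in Bondi–Sachs coordinates: a mass aspect function $m$, an angular momentum aspect one-form $N_A$, and a symmetric traceless shear tensor $C_{AB}$ with news $N_{AB}=\partial_uC_{AB}$, satisfying the vacuum Einstein equations at null infinity $$\partial_u m=-\tfrac18N_{AB}N^{AB}+\tfrac14\nabla^A\nabla^BN_{AB},$$ $$\partial_uN_A=\nabla_Am-\tfrac14\nabla^D(\nabla_D\nabla^EC_{EA}-\nabla_A\nabla^EC_{ED})+\tfrac14\nabla_A(C_{BE}N^{BE})-\tfrac14\nabla_B(C^{BD}N_{DA})+\tfrac12C_{AB}\nabla_DN^{DB}.$$ Suppose the potentials of the shear are $\ell=2$ harmonics: $C_{AB}=\nabla_A\nabla_Bc-\frac12\sigma_{AB}\Delta c+\frac12(\epsilon_A{}^E\nabla_E\nabla_B\underline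 c+\epsilon_B{}^E\nabla_E\nabla_A\underline c)$ with $c=\sum c_{ij}(u)\tilde X^i\tilde X^j$, $\underline c=\sum\underline c_{ij}(u)\tilde X^i\tilde X^j$, where $c_{ij},\underline c_{ij}$ are symmetric and traceless, and put $n_{ij}=\partial_uc_{ij}$, $\underline n_{ij}=\partial_u\underline c_{ij}$. Let $\hat m=m-\frac14\nabla^A\nabla^BC_{AB}$ and let $\sum\hat m_{kl}(u)\tilde X^k\tilde X^l$ ($\hat m_{kl}$ symmetric and traceless) be the $\ell=2$ mode of $\hat m$. Define $$E=\int_{S^2}2m,\qquad P^k=\int_{S^2}2m\tilde X^k,\qquad \tilde J^k=\int_{S^2}\epsilon^{AB}\nabla_B\tilde X^k\big[N_A-\tfrac14C_A{}^D\nabla^BC_{DB}\big],$$ $$\tilde C^k=\int_{S^2}\nabla^A\tilde X^k\big[N_A-u\nabla_Am-\tfrac14C_A{}^D\nabla^BC_{DB}-\tfrac1{16}\nabla_A(C_{DE}C^{DE})\big],$$ $$J^k=\tilde J^k-\int_{S^2}\epsilon^{AB}\nabla_B\tilde X^k\,c\,\nabla_Am,\qquad C^k=\tilde C^k-2\int_{S^2}\nabla^A\tilde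 X^k\,\underline c\,\epsilon_{AB}\nabla^Bm$$ ($J^k$ is the Chen–Wang–Yau angular momentum, $C^k$ the quadrupole form of the Chen–Wang–Yau center of mass). Then on $I$ (with one-sided derivatives at end points belonging to $I$), for $k,l=1,2,3$, $$\partial_uE=-\tfrac{8\pi}5\sum_{i,j}(n_{ij}^2+\underline n_{ij}^2),\qquad \partial_uP^k=-\tfrac{32\pi}{15}\sum_{i,j,p}n_{ij}\underline n_{jp}\epsilon^{ipk},$$ $$\partial_u\tilde J^k=\tfrac{16\pi}5\sum_{i,j,p}(c_{ij}n_{jp}+\underline c_{ij}\underline n_{jp})\epsilon^{ipk},\qquad \partial_u\tilde C^k=\tfrac{32u\pi}{15}\sum_{i,j,p}n_{ij}\underline n_{jp}\epsilon^{ipk},$$ $$\partial_u\hat m_{kl}=\tfrac67\Big[\sum_i(n_{ik}n_{il}+\underline n_{ik}\underline n_{il})-\tfrac13\delta_{kl}\sum_{i,j}(n_{ij}^2+\underline n_{ij}^2)\Big],$$ $$\partial_uJ^k=\tfrac{16\pi}{15}\sum_{i,j,p}\big(3c_{ij}n_{jp}+3\underline c_{ij}\underline n_{jp}-n_{ij}\hat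 m_{jp}-c_{ij}\,\partial_u\hat m_{jp}\big)\epsilon^{ipk},$$ $$\partial_uC^k=\tfrac{16\pi}{15}\sum_{i,j,p}\big(2\underline n_{ij}\hat m_{jp}+2\underline c_{ij}\,\partial_u\hat m_{jp}+6\underline n_{ij}c_{jp}+6\underline c_{ij}n_{jp}\big)\epsilon^{ipk}+\tfrac{32u\pi}{15}\sum_{i,j,p}n_{ij}\underline n_{jp}\epsilon^{ipk}.$$ Moreover, the Chen–Wang–Yau center of mass for general potentials, $$C^k_{\rm gen}=\tilde C^k+\int_{S^2}\nabla^A\tilde X^k\big(-c\nabla_Am+2\epsilon_{AB}(\nabla^B\underline c)m\big)+\int_{S^2}\big(3\tilde X^kcm-\tfrac14\tilde X^k\nabla_A\underline F^{AB}\nabla^D\underline F_{DB}\big),$$ where $\underline F_{AB}=\frac12(\epsilon_A{}^E\nabla_E\nabla_B\underline c+\epsilon_B{}^E\nabla_E\nabla_A\underline c)$, is related to $C^k$ by $C^k_{\rm gen}=C^k+\sum_jc_{kj}P^j-\int_{S^2}\tilde X^k\,c\,m$. -/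

import Mathlib

open MeasureTheory Set
open scoped ContDiff

noncomputable section

namespace NullInfinity

/-- Euclidean three-space. -/
abbrev E3 : Type := EuclideanSpace ℝ (Fin 3)

/-- The unit sphere `S²` in Euclidean three-space. -/
abbrev S2 : Type := Metric.sphere (0 : E3) 1

/-- The area measure of the round unit sphere (total mass `4π`). -/
def area : Measure S2 := (volume : Measure E3).toSphere

/-- The restriction to `S²` of the standard coordinate function `k`. -/
def X (k : Fin 3) (x : S2) : ℝ := (x : E3) k

/-- The Levi-Civita symbol in three dimensions. -/
def leviCivita (i j k : Fin 3) : ℝ :=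
  (((j : ℕ) : ℝ) - ((i : ℕ) : ℝ)) * (((k : ℕ) : ℝ) - ((i : ℕ) : ℝ)) *
    (((k : ℕ) : ℝ) - ((j : ℕ) : ℝ)) / 2

/-- The Kronecker symbol. -/
def delta (i j : Fin 3) : ℝ := if i = j then 1 else 0

/-!
### Tensor calculus on the round sphere

Tensor fields on `S²` are written in the ambient Cartesian frame: a one-form is a field of vectors
`w a` with `∑ a, w a * X a = 0`, and a covariant 2-tensor is a field of arrays `T a b` each of whose
slots is annihilated by the position vector.  Contraction with the round metric is then contraction
over the ambient indices, and indices need not be distinguished as upper or lower.  The Levi-Civita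
connection of the induced metric is the tangential projection of the ambient derivative, which is
computed on the extension that is constant along rays.
-/

theorem norm_normalize {y : E3} (h : y ≠ 0) : ‖y‖⁻¹ • y ∈ Metric.sphere (0 : E3) 1 := by
  simp [norm_smul, h]

open Classical in
/-- The extension of a field on `S²` to `ℝ³ ∖ {0}` which is constant along rays
(with junk value `0` at the origin). -/
def radialExt {V : Type} [Zero V] (f : S2 → V) (y : E3) : V :=
  if h : y = 0 then 0 else f ⟨‖y‖⁻¹ • y, norm_normalize h⟩

/-- The derivative at `x ∈ S²` in the ambient direction `a` of the radially constant extension: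
the `a`-th Cartesian component of the surface gradient of `f`. -/
def partialDeriv (a : Fin 3) (f : S2 → ℝ) (x : S2) : ℝ :=
  fderiv ℝ (radialExt f) (x : E3) (EuclideanSpace.single a 1)

/-- The round metric `σ`, which is also the orthogonal projection onto the tangent plane. -/
def sigma (x : S2) (a b : Fin 3) : ℝ := delta a b - X a x * X b x

/-- The area form `ε` (oriented by the outward normal). -/
def epsilon (x : S2) (a b : Fin 3) : ℝ := ∑ c, leviCivita a b c * X c x

/-- `∇_a f` for a function. -/
def grad (f : S2 → ℝ) (x : S2) (a : Fin 3) : ℝ := partialDeriv a f x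

/-- `∇_a w_b` for a one-form. -/
def covDeriv1 (w : S2 → Fin 3 → ℝ) (x : S2) (a b : Fin 3) : ℝ :=
  ∑ b', sigma x b b' * partialDeriv a (fun y => w y b') x

/-- `∇_a T_{bc}` for a 2-tensor. -/
def covDeriv2 (T : S2 → Fin 3 → Fin 3 → ℝ) (x : S2) (a b c : Fin 3) : ℝ :=
  ∑ b', ∑ c', sigma x b b' * sigma x c c' * partialDeriv a (fun y => T y b' c') x

/-- `∇_a ∇_b f`. -/
def hess (f : S2 → ℝ) : S2 → Fin 3 → Fin 3 → ℝ := covDeriv1 (grad f)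

/-- The Laplace-Beltrami operator. -/
def laplacian (f : S2 → ℝ) (x : S2) : ℝ := ∑ a, hess f x a a

/-- `∇^a w_a`. -/
def div1 (w : S2 → Fin 3 → ℝ) (x : S2) : ℝ := ∑ a, covDeriv1 w x a a

/-- `∇^a T_{ab}`. -/
def div2 (T : S2 → Fin 3 → Fin 3 → ℝ) (x : S2) (b : Fin 3) : ℝ := ∑ a, covDeriv2 T x a a b

/-- `S_{ab} T^{ab}`. -/
def inner2 (S T : Fin 3 → Fin 3 → ℝ) : ℝ := ∑ a, ∑ b, S a b * T a b

/-- `∇_a ∇_b c - ½ σ_{ab} Δ c`. -/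
def closedPart (c : S2 → ℝ) (x : S2) (a b : Fin 3) : ℝ :=
  hess c x a b - 1 / 2 * sigma x a b * laplacian c x

/-- `½ (ε_a^e ∇_e ∇_b c + ε_b^e ∇_e ∇_a c)`. -/
def coclosedPart (c : S2 → ℝ) (x : S2) (a b : Fin 3) : ℝ :=
  1 / 2 * ∑ e, (epsilon x a e * hess c x e b + epsilon x b e * hess c x e a)

/-- `f` is smooth on `S²`. -/
def SmoothOnSphere (f : S2 → ℝ) : Prop := ContDiffOn ℝ ∞ (radialExt f) {0}ᶜ

/-- A field depending on a parameter `u ∈ I` and a point of `S²` is jointly smooth. -/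
def JointlySmooth {V : Type} [NormedAddCommGroup V] [NormedSpace ℝ V]
    (I : Set ℝ) (f : ℝ → S2 → V) : Prop :=
  ContDiffOn ℝ ∞ (fun p : ℝ × E3 => radialExt (f p.1) p.2) (I ×ˢ ({0}ᶜ : Set E3))

/-- `f` is a spherical harmonic of mode `ℓ`: it is smooth and `Δ f = -ℓ (ℓ + 1) f`. -/
def IsHarmonicOfMode (l : ℕ) (f : S2 → ℝ) : Prop :=
  SmoothOnSphere f ∧ ∀ x, laplacian f x = -((l : ℝ) * ((l : ℝ) + 1)) * f x

/-- The function `∑ A_{ij} X^i X^j` on `S²`. -/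
def quadForm (A : Matrix (Fin 3) (Fin 3) ℝ) (x : S2) : ℝ := ∑ i, ∑ j, A i j * X i x * X j x

/-- The `ℓ = 2` mode of `f` is `∑ A_{ij} X^i X^j`, with `A` symmetric and traceless: the difference
of the two functions is `L²`-orthogonal to all spherical harmonics of mode `2`. -/
def IsModeTwoPart (f : S2 → ℝ) (A : Matrix (Fin 3) (Fin 3) ℝ) : Prop :=
  A.IsSymm ∧ A.trace = 0 ∧
    ∀ g : S2 → ℝ, IsHarmonicOfMode 2 g → ∫ x, (f x - quadForm A x) * g x ∂area = 0

/-- Null infinity data in Bondi-Sachs coordinates on `I × S²`: a smooth mass aspect `m`, a smooth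
angular momentum aspect one-form `N_A`, and a smooth symmetric traceless shear tensor `C_{AB}`,
with news `N_{AB} = ∂_u C_{AB}`, solving the vacuum Einstein equations at null infinity
(the evolution equations for `m` and `N_A`). -/
structure NullInfinityData (I : Set ℝ) where
  /-- mass aspect -/
  m : ℝ → S2 → ℝ
  /-- angular momentum aspect -/
  aspect : ℝ → S2 → Fin 3 → ℝ
  /-- shear tensor -/
  shear : ℝ → S2 → Fin 3 → Fin 3 → ℝ
  /-- news tensor -/
  news : ℝ → S2 → Fin 3 → Fin 3 → ℝ
  smooth_m : JointlySmooth I m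
  smooth_aspect : JointlySmooth I aspect
  smooth_shear : JointlySmooth I shear
  aspect_tangent : ∀ u ∈ I, ∀ x, ∑ a, aspect u x a * X a x = 0
  shear_tangent : ∀ u ∈ I, ∀ x a, ∑ b, shear u x a b * X b x = 0
  shear_symm : ∀ u ∈ I, ∀ x a b, shear u x a b = shear u x b a
  shear_traceless : ∀ u ∈ I, ∀ x, ∑ a, shear u x a a = 0
  news_eq : ∀ u ∈ I, ∀ x a b, HasDerivWithinAt (fun t => shear t x a b) (news u x a b) I u
  /-- `∂_u m = -⅛ N_{AB} N^{AB} + ¼ ∇^A ∇^B N_{AB}` -/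
  evol_m : ∀ u ∈ I, ∀ x, HasDerivWithinAt (fun t => m t x)
    (-(1 / 8) * inner2 (news u x) (news u x) + 1 / 4 * div1 (div2 (news u)) x) I u
  /-- `∂_u N_A = ∇_A m - ¼ ∇^D (∇_D ∇^E C_{EA} - ∇_A ∇^E C_{ED}) + ¼ ∇_A (C_{BE} N^{BE})
  - ¼ ∇_B (C^{BD} N_{DA}) + ½ C_{AB} ∇_D N^{DB}` -/
  evol_aspect : ∀ u ∈ I, ∀ x a, HasDerivWithinAt (fun t => aspect t x a)
    (grad (m u) x a
      - 1 / 4 * div2 (fun y d e => covDeriv1 (div2 (shear u)) y d e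
          - covDeriv1 (div2 (shear u)) y e d) x a
      + 1 / 4 * grad (fun y => inner2 (shear u y) (news u y)) x a
      - 1 / 4 * div2 (fun y b e => ∑ d, shear u y b d * news u y d e) x a
      + 1 / 2 * ∑ b, shear u x a b * div2 (news u) x b) I u

namespace NullInfinityData

variable {I : Set ℝ} (D : NullInfinityData I)

/-- Energy `E = ∫ 2 m`. -/
def energy (u : ℝ) : ℝ := ∫ x, 2 * D.m u x ∂area

/-- Linear momentum `P^k = ∫ 2 m X^k`. -/
def momentum (k : Fin 3) (u : ℝ) : ℝ := ∫ x, 2 * D.m u x * X k x ∂area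

/-- The rotation Killing field `ε^{AB} ∇_B X^k`. -/
def rotation (k : Fin 3) (x : S2) (a : Fin 3) : ℝ := ∑ b, epsilon x a b * grad (X k) x b

/-- `C_A^D ∇^B C_{DB}`. -/
def shearDiv (u : ℝ) (x : S2) (a : Fin 3) : ℝ := ∑ d, D.shear u x a d * div2 (D.shear u) x d

/-- The modified mass aspect `m - ¼ ∇^A ∇^B C_{AB}`. -/
def modifiedMass (u : ℝ) (x : S2) : ℝ := D.m u x - 1 / 4 * div1 (div2 (D.shear u)) x

/-- The classical angular momentum
`∫ ε^{AB} ∇_B X^k [N_A - ¼ C_A^D ∇^B C_{DB}]`. -/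
def classicalAngularMomentum (k : Fin 3) (u : ℝ) : ℝ :=
  ∫ x, ∑ a, rotation k x a * (D.aspect u x a - 1 / 4 * D.shearDiv u x a) ∂area

/-- The integrand (a one-form) of the classical center of mass:
`N_A - u ∇_A m - ¼ C_A^D ∇^B C_{DB} - (1/16) ∇_A (C_{DE} C^{DE})`. -/
def centerForm (u : ℝ) (x : S2) (a : Fin 3) : ℝ :=
  D.aspect u x a - u * grad (D.m u) x a - 1 / 4 * D.shearDiv u x a
    - 1 / 16 * grad (fun y => inner2 (D.shear u y) (D.shear u y)) x a

/-- The classical center of mass. -/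
def classicalCenterOfMass (k : Fin 3) (u : ℝ) : ℝ :=
  ∫ x, ∑ a, grad (X k) x a * D.centerForm u x a ∂area

/-- The Chen-Wang-Yau angular momentum
`∫ ε^{AB} ∇_B X^k [N_A - ¼ C_A^D ∇^B C_{DB} - c ∇_A m]`, where `c` is the closed potential of the
shear (supported in the modes `ℓ ≥ 2`). -/
def cwyAngularMomentum (c : ℝ → S2 → ℝ) (k : Fin 3) (u : ℝ) : ℝ :=
  ∫ x, ∑ a, rotation k x a *
    (D.aspect u x a - 1 / 4 * D.shearDiv u x a - c u x * grad (D.m u) x a) ∂area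

/-- The Chen-Wang-Yau center of mass in the form used for quadrupole moments:
`∫ ∇^A X^k [N_A - u ∇_A m - ¼ C_A^D ∇^B C_{DB} - (1/16) ∇_A |C|² - 2 c̲ ε_{AB} ∇^B m]`, where `c̲` is
the co-closed potential of the shear. -/
def cwyCenterOfMass (cb : ℝ → S2 → ℝ) (k : Fin 3) (u : ℝ) : ℝ :=
  ∫ x, ∑ a, grad (X k) x a *
    (D.centerForm u x a - 2 * cb u x * ∑ b, epsilon x a b * grad (D.m u) x b) ∂area

/-- The Chen-Wang-Yau center of mass for arbitrary potentials `c`, `c̲` of the shear (supported in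
the modes `ℓ ≥ 2`):
`∫ ∇^A X^k [N_A - u ∇_A m - ¼ C_A^D ∇^B C_{DB} - (1/16) ∇_A |C|² - c ∇_A m + 2 ε_{AB} (∇^B c̲) m]`
`+ ∫ (3 X^k c m - ¼ X^k ∇_A F̲^{AB} ∇^D F̲_{DB})`, where `F̲` is the co-closed part of the shear. -/
def cwyCenterOfMassGeneral (c cb : ℝ → S2 → ℝ) (k : Fin 3) (u : ℝ) : ℝ :=
  (∫ x, ∑ a, grad (X k) x a *
    (D.centerForm u x a - c u x * grad (D.m u) x a
      + 2 * (∑ b, epsilon x a b * grad (cb u) x b) * D.m u x) ∂area)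
  + ∫ x, (3 * X k x * c u x * D.m u x
      - 1 / 4 * X k x * ∑ b, div2 (coclosedPart (cb u)) x b * div2 (coclosedPart (cb u)) x b) ∂area

end NullInfinityData

/-- `∑_{i,j,p} A_{ij} B_{jp} ε^{ipk}`. -/
def epsContract (A B : Matrix (Fin 3) (Fin 3) ℝ) (k : Fin 3) : ℝ :=
  ∑ i, ∑ j, ∑ p, A i j * B j p * leviCivita i p k

/-- `∑_{i,j} A_{ij}²`. -/
def sqNorm (A : Matrix (Fin 3) (Fin 3) ℝ) : ℝ := ∑ i, ∑ j, A i j ^ 2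

/-- The matrix with entries
`(6/7) [∑_i (n_{ik} n_{il} + n̲_{ik} n̲_{il}) - (1/3) δ_{kl} ∑_{ij} (n_{ij}² + n̲_{ij}²)]`. -/
def massModeRate (n nb : Matrix (Fin 3) (Fin 3) ℝ) : Matrix (Fin 3) (Fin 3) ℝ := fun k l =>
  6 / 7 * (∑ i, (n i k * n i l + nb i k * nb i l) - 1 / 3 * delta k l * (sqNorm n + sqNorm nb))

end NullInfinity

end

noncomputable section

namespace NullInfinity

/-! ### Calculus of functions on the sphere -/

/-! With `ℓ = 2` potentials every field built from the shear is a polynomial in the coordinates `X`,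
with coefficients taken from the matrices `c`, `c̲`, `n`, `n̲`. The closed part of the shear is a
tensor `K_c` (`quadShear`) and the co-closed part is `ε K_c̲` (`dualShear`). Each rate of change
thus becomes a moment of `m` or an integral of a polynomial over the sphere.

All these integrals rest on one identity, `∫ ∂_a f = 2 ∫ X_a f` (`integral_partialDeriv`). Applied
to products of linear functions it determines their moments recursively. Summed against a tangential
field it is integration by parts. Half of the terms vanish by parity: under the antipodal map `K` is
even and `ε K` is odd. Energy and `m̂` therefore see only the products `n n` and `n̲ n̲`, while `P`
sees only the mixed product.

Mass aspect: `∇^A∇^B C_AB = 12 c` on `ℓ = 2`, so `∂_u m = -⅛|N|² + 3n` and `m̂ = m - 3c`. The three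
moments of `|N|²`, against `1`, `X^k` and a quadrupole, give the rates of `E`, `P` and `m̂`.

Angular momentum aspect: integrated against a tangential field `V`, all derivatives in `∂_u N_A`
other than the divergence in its last term pass to `V` (`integral_sum_mul_aspectRate`). The boost
`∇X^k` is conformal Killing, with derivative `-X^k σ`; the rotation is Killing, with derivative a
multiple of `X^k ε`. Only traces or antisymmetric parts survive. For the rotation this gives the
rate of `J̃` directly. For the boost, the mass term is `P`, which `∂_u(-uP)` cancels up to `-u ∂_u
P`, and the quadratic shear terms cancel exactly (`hasDerivWithinAt_classicalCenterOfMass`).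

Chen–Wang–Yau corrections: by parts they pair `m` with the derivative of `c` or `c̲` along a
rotation, which is again an `ℓ = 2` harmonic (`rotateQuad`). So they involve only the `ℓ = 2` mode
of `m`, namely `m̂ + 3c`, and are explicit `ε`-contractions that can be differentiated. -/

theorem norm_coe_S2 (x : S2) : ‖(x : E3)‖ = 1 := by simp

theorem coe_S2_ne_zero (x : S2) : (x : E3) ≠ 0 := by
  intro h; simpa [h] using norm_coe_S2 x

theorem coe_S2_mem (x : S2) : (x : E3) ∈ ({0}ᶜ : Set E3) := coe_S2_ne_zero x

theorem compl_zero_mem_nhds (x : S2) : ({0}ᶜ : Set E3) ∈ nhds (x : E3) :=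
  isOpen_compl_singleton.mem_nhds (coe_S2_mem x)

theorem radialExt_coe {V : Type} [Zero V] (f : S2 → V) (x : S2) : radialExt f (x : E3) = f x := by
  simp [radialExt, coe_S2_ne_zero]

theorem radialExt_smul {V : Type} [Zero V] (f : S2 → V) (x : S2) {r : ℝ} (hr : 0 < r) :
    radialExt f (r • (x : E3)) = f x := by
  have h : r • (x : E3) ≠ 0 := smul_ne_zero hr.ne' (coe_S2_ne_zero x)
  rw [radialExt, dif_neg h]
  congr 1
  ext1
  simp [norm_smul, abs_of_pos hr, smul_smul, hr.ne']

theorem radialExt_add (f g : S2 → ℝ) :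
    radialExt (fun x => f x + g x) = fun y => radialExt f y + radialExt g y := by
  ext y; by_cases h : y = 0 <;> simp [radialExt, h]

theorem radialExt_mul (f g : S2 → ℝ) :
    radialExt (fun x => f x * g x) = fun y => radialExt f y * radialExt g y := by
  ext y; by_cases h : y = 0 <;> simp [radialExt, h]

theorem radialExt_X (k : Fin 3) : radialExt (X k) = fun y : E3 => ‖y‖⁻¹ * y k := by
  ext y; by_cases h : y = 0 <;> simp [radialExt, h, X]

theorem sum_X_sq (x : S2) : X 0 x ^ 2 + X 1 x ^ 2 + X 2 x ^ 2 = 1 := by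
  have h := EuclideanSpace.norm_sq_eq (x : E3)
  rw [norm_coe_S2, Fin.sum_univ_three] at h
  simpa [X] using h.symm

theorem sum_X_mul_X (x : S2) : ∑ a, X a x * X a x = 1 := by
  rw [← sum_X_sq x, Fin.sum_univ_three]; ring

theorem continuous_X (k : Fin 3) : Continuous (X k) := by
  unfold X; fun_prop

theorem SmoothOnSphere.differentiableAt {f : S2 → ℝ} (hf : SmoothOnSphere f) (x : S2) :
    DifferentiableAt ℝ (radialExt f) (x : E3) :=
  (hf.contDiffAt (compl_zero_mem_nhds x)).differentiableAt (by simp)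

theorem SmoothOnSphere.continuous {f : S2 → ℝ} (hf : SmoothOnSphere f) : Continuous f := by
  have h := hf.continuousOn.comp_continuous continuous_subtype_val coe_S2_mem
  have h' : radialExt f ∘ Subtype.val = f := funext (radialExt_coe f)
  rwa [h'] at h

theorem SmoothOnSphere.continuous_partialDeriv {f : S2 → ℝ} (hf : SmoothOnSphere f) (a : Fin 3) :
    Continuous (partialDeriv a f) := by
  have h := (hf.continuousOn_fderiv_of_isOpen isOpen_compl_singleton (by simp)).comp_continuous
    continuous_subtype_val coe_S2_mem
  exact h.clm_apply continuous_const

/-- `f` is smooth on the sphere and its surface gradient is the field `g`. -/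
structure HasGrad (f : S2 → ℝ) (g : S2 → Fin 3 → ℝ) : Prop where
  smooth : SmoothOnSphere f
  eq : ∀ a x, partialDeriv a f x = g x a

namespace HasGrad

theorem of_smooth {f : S2 → ℝ} (hf : SmoothOnSphere f) : HasGrad f (grad f) :=
  ⟨hf, fun _ _ => rfl⟩

theorem congr {f : S2 → ℝ} {g g' : S2 → Fin 3 → ℝ} (h : HasGrad f g)
    (hg : ∀ x a, g x a = g' x a) : HasGrad f g' :=
  ⟨h.smooth, fun a x => (h.eq a x).trans (hg x a)⟩

theorem add {f f' : S2 → ℝ} {g g' : S2 → Fin 3 → ℝ} (h : HasGrad f g) (h' : HasGrad f' g') :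
    HasGrad (fun x => f x + f' x) (fun x a => g x a + g' x a) := by
  constructor
  · rw [SmoothOnSphere, radialExt_add]; exact h.smooth.add h'.smooth
  · intro a x
    rw [← h.eq, ← h'.eq, partialDeriv, radialExt_add,
      fderiv_fun_add (h.smooth.differentiableAt x) (h'.smooth.differentiableAt x)]
    rfl

theorem mul {f f' : S2 → ℝ} {g g' : S2 → Fin 3 → ℝ} (h : HasGrad f g) (h' : HasGrad f' g') :
    HasGrad (fun x => f x * f' x) (fun x a => f x * g' x a + f' x * g x a) := by
  constructor
  · rw [SmoothOnSphere, radialExt_mul]; exact h.smooth.mul h'.smooth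
  · intro a x
    rw [← h.eq, ← h'.eq, partialDeriv, radialExt_mul,
      fderiv_fun_mul (h.smooth.differentiableAt x) (h'.smooth.differentiableAt x)]
    simp [radialExt_coe, partialDeriv]

theorem const (r : ℝ) : HasGrad (fun _ => r) (fun _ _ => 0) := by
  have h : ∀ y ∈ ({0}ᶜ : Set E3), radialExt (fun _ : S2 => r) y = r := by
    intro y hy; exact dif_neg hy
  refine ⟨contDiffOn_const.congr h, fun a x => ?_⟩
  have h' : radialExt (fun _ : S2 => r) =ᶠ[nhds (x : E3)] fun _ => r :=
    Filter.eventually_of_mem (compl_zero_mem_nhds x) h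
  rw [partialDeriv, h'.fderiv_eq]
  simp

theorem coord (k : Fin 3) : HasGrad (X k) (fun x a => sigma x a k) := by
  constructor
  · rw [SmoothOnSphere, radialExt_X]
    refine ContDiffOn.mul ?_ (by fun_prop)
    exact (contDiffOn_id.norm ℝ fun y hy => hy).inv fun y hy => norm_ne_zero_iff.2 hy
  · intro a x
    have hx : ‖(x : E3)‖ = 1 := norm_coe_S2 x
    have h1 : HasFDerivAt (fun y : E3 => ‖y‖) (innerSL ℝ (x : E3)) (x : E3) := by
      have := ((hasStrictFDerivAt_norm_sq (x : E3)).hasFDerivAt).sqrt (by simp [hx])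
      simpa [hx, Real.sqrt_sq, smul_smul, ← ofNat_smul_eq_nsmul ℝ] using this
    have h2 : HasFDerivAt (fun y : E3 => y k) (EuclideanSpace.proj k : E3 →L[ℝ] ℝ) (x : E3) :=
      (EuclideanSpace.proj k : E3 →L[ℝ] ℝ).hasFDerivAt
    have h3 := ((hasDerivAt_inv (by simp [hx])).comp_hasFDerivAt _ h1).mul h2
    rw [partialDeriv, radialExt_X]
    erw [h3.fderiv]
    simp [hx, sigma, delta, X, EuclideanSpace.inner_single_right]
    by_cases h : k = a
    · subst h; simp; ring
    · simp [h, Ne.symm h]; ring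

theorem const_mul {f : S2 → ℝ} {g : S2 → Fin 3 → ℝ} (r : ℝ) (h : HasGrad f g) :
    HasGrad (fun x => r * f x) (fun x a => r * g x a) :=
  ((const r).mul h).congr fun x a => by ring

theorem mul_const {f : S2 → ℝ} {g : S2 → Fin 3 → ℝ} (h : HasGrad f g) (r : ℝ) :
    HasGrad (fun x => f x * r) (fun x a => g x a * r) :=
  (h.mul (const r)).congr fun x a => by ring

theorem neg {f : S2 → ℝ} {g : S2 → Fin 3 → ℝ} (h : HasGrad f g) :
    HasGrad (fun x => - f x) (fun x a => - g x a) := by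
  simpa using h.const_mul (-1)

theorem sub {f f' : S2 → ℝ} {g g' : S2 → Fin 3 → ℝ} (h : HasGrad f g) (h' : HasGrad f' g') :
    HasGrad (fun x => f x - f' x) (fun x a => g x a - g' x a) := by
  simpa only [sub_eq_add_neg] using h.add h'.neg

theorem sum {ι : Type*} (s : Finset ι) {f : ι → S2 → ℝ} {g : ι → S2 → Fin 3 → ℝ}
    (h : ∀ i ∈ s, HasGrad (f i) (g i)) :
    HasGrad (fun x => ∑ i ∈ s, f i x) (fun x a => ∑ i ∈ s, g i x a) := by
  classical
  induction s using Finset.induction_on with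
  | empty => simpa using const 0
  | insert i s hi ih =>
    simp only [Finset.sum_insert hi]
    exact (h i (by simp)).add (ih fun j hj => h j (by simp [hj]))

theorem grad_eq {f : S2 → ℝ} {g : S2 → Fin 3 → ℝ} (h : HasGrad f g) : grad f = g := by
  ext x a; exact h.eq a x

theorem continuous {f : S2 → ℝ} {g : S2 → Fin 3 → ℝ} (h : HasGrad f g) : Continuous f :=
  h.smooth.continuous

theorem continuous_grad {f : S2 → ℝ} {g : S2 → Fin 3 → ℝ} (h : HasGrad f g) (a : Fin 3) :
    Continuous fun x => g x a := by
  have : (fun x => g x a) = partialDeriv a f := by ext x; exact (h.eq a x).symm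
  rw [this]; exact h.smooth.continuous_partialDeriv a

end HasGrad

/-- The surface gradient is tangential. -/
theorem sum_X_mul_partialDeriv {f : S2 → ℝ} (hf : SmoothOnSphere f) (x : S2) :
    ∑ a, X a x * partialDeriv a f x = 0 := by
  have h1 : ∑ a, X a x * partialDeriv a f x = fderiv ℝ (radialExt f) (x : E3) (x : E3) := by
    have : (x : E3) = ∑ a, X a x • EuclideanSpace.single a (1 : ℝ) := by
      ext i; fin_cases i <;> simp [Fin.sum_univ_three, X]
    conv_rhs => rw [this]
    rw [map_sum]
    simp only [map_smul, smul_eq_mul, ← this]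
    rfl
  rw [h1]
  -- The extension is constant along the ray `t ↦ t x`, so its derivative at `t = 1` in the
  -- direction `x` vanishes.
  have h2 : HasDerivAt (fun t : ℝ => t • (x : E3)) (x : E3) 1 := by
    simpa using (hasDerivAt_id (1 : ℝ)).smul_const (x : E3)
  have h3 : HasFDerivAt (radialExt f) (fderiv ℝ (radialExt f) (x : E3)) ((1 : ℝ) • (x : E3)) := by
    rw [one_smul]; exact (hf.differentiableAt x).hasFDerivAt
  have h4 := h3.comp_hasDerivAt (1 : ℝ) h2
  have h5 : (radialExt f ∘ fun t : ℝ => t • (x : E3)) =ᶠ[nhds 1] fun _ => f x := by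
    filter_upwards [lt_mem_nhds (zero_lt_one' ℝ)] with t ht
    exact radialExt_smul f x ht
  exact (h4.unique ((hasDerivAt_const (1 : ℝ) (f x)).congr_of_eventuallyEq h5))

/-! ### Integration over the sphere -/

instance : IsFiniteMeasure area := inferInstanceAs (IsFiniteMeasure (volume : Measure E3).toSphere)

theorem area_real_univ : area.real univ = 4 * Real.pi := by
  rw [area, Measure.toSphere_real_apply_univ, measureReal_def, EuclideanSpace.volume_ball_fin_three]
  rw [ENNReal.toReal_mul, ENNReal.toReal_pow, ENNReal.toReal_ofReal zero_le_one,
    ENNReal.toReal_ofReal (by positivity)]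
  simp
  ring

theorem integral_const_area (r : ℝ) : ∫ _, r ∂area = 4 * Real.pi * r := by
  rw [integral_const, area_real_univ, smul_eq_mul]

theorem integrable_of_continuous {f : S2 → ℝ} (hf : Continuous f) : Integrable f area :=
  hf.integrable_of_hasCompactSupport (HasCompactSupport.of_compactSpace f)

/-- Lebesgue measure on `ℝ³ ∖ {0}` is the product of `r² dr` and the area measure. This is the
bridge that carries integration by parts from `ℝ³` to the sphere. -/
theorem integral_polar {h : E3 → ℝ} {p : ℝ → ℝ} {q : S2 → ℝ}
    (H : ∀ (x : S2) (r : ℝ), 0 < r → h (r • (x : E3)) = p r * q x) :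
    ∫ y, h y = (∫ r : Ioi (0 : ℝ), p r ∂Measure.volumeIoiPow 2) * ∫ x, q x ∂area := by
  have hmp := (volume : Measure E3).measurePreserving_homeomorphUnitSphereProd
  have h1 : ∫ y, h y = ∫ y : ({0}ᶜ : Set E3), h y ∂((volume : Measure E3).comap (↑)) := by
    rw [integral_subtype_comap (measurableSet_singleton _).compl, restrict_compl_singleton]
  have h2 := hmp.integral_comp (homeomorphUnitSphereProd E3).measurableEmbedding
    (fun z => p (z.2 : ℝ) * q z.1)
  have h3 : ∀ y : ({0}ᶜ : Set E3), h y = p ((homeomorphUnitSphereProd E3 y).2 : ℝ)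
      * q (homeomorphUnitSphereProd E3 y).1 := by
    intro y
    rw [← H _ _ (homeomorphUnitSphereProd E3 y).2.2]
    congr 1
    have : ‖(y : E3)‖ ≠ 0 := norm_ne_zero_iff.2 y.2
    simp [smul_smul, this]
  rw [h1, integral_congr_ae (Filter.Eventually.of_forall h3), h2]
  have hd : Module.finrank ℝ E3 - 1 = 2 := by simp
  rw [hd, mul_comm]
  simp only [mul_comm (p _)]
  exact integral_prod_mul q fun r : Ioi (0 : ℝ) => p r

/-- The area of a set is defined through the volume of the cone over it, and volume is invariant
under `y ↦ -y`; hence the antipodal map preserves area. -/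
theorem integral_eq_zero_of_odd {f : S2 → ℝ} (hf : ∀ x, f (-x) = - f x) :
    ∫ x, f x ∂area = 0 := by
  have hmp : MeasurePreserving (fun x : S2 => -x) area area := by
    refine ⟨continuous_neg.measurable, ?_⟩
    ext s hs
    rw [Measure.map_apply continuous_neg.measurable hs, area, Measure.toSphere_apply' _ hs,
      Measure.toSphere_apply' _ (continuous_neg.measurable hs)]
    congr 1
    rw [← Measure.measure_neg]
    congr 1
    ext y
    simp only [Set.mem_neg, Set.mem_smul, Set.mem_image, Set.mem_preimage]
    constructor
    · rintro ⟨r, hr, _, ⟨x, hx, rfl⟩, h⟩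
      exact ⟨r, hr, _, ⟨-x, hx, rfl⟩, by simp [h]⟩
    · rintro ⟨r, hr, _, ⟨x, hx, rfl⟩, h⟩
      exact ⟨r, hr, _, ⟨-x, by simpa using hx, rfl⟩, by simp [h]⟩
  have h := hmp.integral_comp (Homeomorph.neg S2).measurableEmbedding f
  simp only [hf, integral_neg] at h
  linarith

/-- A function homogeneous of degree `0` has partial derivatives homogeneous of degree `-1`. -/
theorem partialDeriv_radialExt_smul (f : S2 → ℝ) (a : Fin 3) (x : S2)
    {r : ℝ} (hr : 0 < r) :
    fderiv ℝ (radialExt f) (r • (x : E3)) (EuclideanSpace.single a 1)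
      = r⁻¹ * partialDeriv a f x := by
  have hne : r • (x : E3) ≠ 0 := smul_ne_zero hr.ne' (coe_S2_ne_zero x)
  have h1 : (fun y : E3 => radialExt f (r • y)) = radialExt f := by
    ext y
    by_cases hy : y = 0
    · simp [hy]
    · have : r • y ≠ 0 := smul_ne_zero hr.ne' hy
      rw [radialExt, radialExt, dif_neg this, dif_neg hy]
      congr 2
      rw [norm_smul, Real.norm_of_nonneg hr.le, smul_smul]
      field_simp
  have h2 := fderiv_comp_smul (𝕜 := ℝ) r (f := radialExt f) (x := (x : E3))
  rw [h1] at h2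
  rw [partialDeriv, h2]
  simp [hr.ne']

/-- A smooth radial function supported in a shell around the origin. -/
def shellBump (y : E3) : ℝ :=
  -- Centre `2` and outer radius `1` confine the support to `1 ≤ ‖y‖² ≤ 3`, away from the origin.
  -- Using `‖y‖²` rather than `‖y‖` makes smoothness immediate.
  (⟨1 / 2, 1, by norm_num, by norm_num⟩ : ContDiffBump (2 : ℝ)) (‖y‖ ^ 2)

theorem contDiff_shellBump : ContDiff ℝ ∞ shellBump :=
  (ContDiffBump.contDiff _).comp (contDiff_norm_sq ℝ)

theorem tsupport_shellBump_subset : tsupport shellBump ⊆ {y : E3 | 1 ≤ ‖y‖ ^ 2 ∧ ‖y‖ ^ 2 ≤ 3} := by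
  refine closure_minimal ?_ ?_
  · intro y hy
    have : ‖y‖ ^ 2 ∈ Function.support
        (⟨1 / 2, 1, by norm_num, by norm_num⟩ : ContDiffBump (2 : ℝ)) := hy
    rw [ContDiffBump.support_eq, Real.ball_eq_Ioo] at this
    constructor <;> norm_num at this ⊢ <;> linarith [this.1, this.2]
  · exact (isClosed_le continuous_const (continuous_norm.pow 2)).inter
      (isClosed_le (continuous_norm.pow 2) continuous_const)

theorem hasCompactSupport_shellBump : HasCompactSupport shellBump := by
  refine (isCompact_closedBall (0 : E3) 2).of_isClosed_subset (isClosed_tsupport _) ?_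
  intro y hy
  have := (tsupport_shellBump_subset hy).2
  rw [mem_closedBall_zero_iff]
  nlinarith [norm_nonneg y]

theorem tsupport_shellBump_subset_compl : tsupport shellBump ⊆ {0}ᶜ := by
  intro y hy h0
  have := (tsupport_shellBump_subset hy).1
  rw [mem_singleton_iff.1 h0] at this
  norm_num at this

theorem fderiv_shellBump (x : S2) (a : Fin 3) (r : ℝ) :
    fderiv ℝ shellBump (r • (x : E3)) (EuclideanSpace.single a 1)
      = (2 * r * deriv (⟨1 / 2, 1, by norm_num, by norm_num⟩ : ContDiffBump (2 : ℝ)) (r ^ 2))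
        * X a x := by
  have h1 : ‖r • (x : E3)‖ ^ 2 = r ^ 2 := by rw [norm_smul, norm_coe_S2]; simp
  have h2 : HasDerivAt (⟨1 / 2, 1, by norm_num, by norm_num⟩ : ContDiffBump (2 : ℝ))
      (deriv (⟨1 / 2, 1, by norm_num, by norm_num⟩ : ContDiffBump (2 : ℝ)) (r ^ 2))
      (‖r • (x : E3)‖ ^ 2) := by
    rw [h1]
    exact ((ContDiffBump.contDiff (n := 1) _).differentiable (by simp) _).hasDerivAt
  have h3 := h2.comp_hasFDerivAt (r • (x : E3))
    (hasStrictFDerivAt_norm_sq (r • (x : E3))).hasFDerivAt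
  have h4 : shellBump = (⟨1 / 2, 1, by norm_num, by norm_num⟩ : ContDiffBump (2 : ℝ)) ∘
    fun y : E3 => ‖y‖ ^ 2 := rfl
  rw [h4, h3.fderiv]
  simp [EuclideanSpace.inner_single_right, X]
  ring

/-- The cutoff vanishes near the origin, so the junk value and the singularity of a radial extension
there do no harm. -/
theorem continuous_mul_of_tsupport {g h : E3 → ℝ} (hg : Continuous g)
    (hs : tsupport g ⊆ {0}ᶜ) (hh : ContinuousOn h {0}ᶜ) : Continuous fun y => g y * h y := by
  rw [continuous_iff_continuousAt]
  intro y
  by_cases hy : y = 0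
  · have : (fun y => g y * h y) =ᶠ[nhds y] fun _ => 0 := by
      have h0 : y ∉ tsupport g := fun h => hs h hy
      filter_upwards [(isClosed_tsupport g).isOpen_compl.mem_nhds h0] with z hz
      rw [image_eq_zero_of_notMem_tsupport hz, zero_mul]
    exact continuousAt_const.congr this.symm
  · exact hg.continuousAt.mul (hh.continuousAt (isOpen_compl_singleton.mem_nhds hy))

/-- The divergence theorem on the sphere, one ambient component at a time. -/
theorem integral_partialDeriv {f : S2 → ℝ} (hf : SmoothOnSphere f) (a : Fin 3) :
    ∫ x, partialDeriv a f x ∂area = 2 * ∫ x, X a x * f x ∂area := by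
  set φ : ContDiffBump (2 : ℝ) := ⟨1 / 2, 1, by norm_num, by norm_num⟩ with hφ
  -- `α` and `β` are the radial factors that appear when `shellBump · radialExt g` is integrated by
  -- parts in `ℝ³` and written in polar coordinates. They do not depend on `g` or on the direction.
  set α := ∫ r : Ioi (0 : ℝ), φ ((r : ℝ) ^ 2) * (r : ℝ)⁻¹ ∂Measure.volumeIoiPow 2
  set β := - ∫ r : Ioi (0 : ℝ), 2 * (r : ℝ) * deriv φ ((r : ℝ) ^ 2) ∂Measure.volumeIoiPow 2
  have hbump : ∀ (x : S2) (r : ℝ), shellBump (r • (x : E3)) = φ (r ^ 2) := by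
    intro x r
    rw [shellBump, norm_smul, norm_coe_S2]; simp [hφ]
  have key : ∀ (b : Fin 3) {g : S2 → ℝ}, SmoothOnSphere g →
      α * ∫ x, partialDeriv b g x ∂area = β * ∫ x, X b x * g x ∂area := by
    intro b g hg
    have hcs := hasCompactSupport_shellBump
    have hdc : Continuous fun y => fderiv ℝ shellBump y (EuclideanSpace.single b (1 : ℝ)) :=
      (contDiff_shellBump.continuous_fderiv (by simp)).clm_apply continuous_const
    have hds : tsupport (fun y => fderiv ℝ shellBump y (EuclideanSpace.single b (1 : ℝ)))
        ⊆ tsupport shellBump := tsupport_fderiv_apply_subset ℝ _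
    have hdcs : HasCompactSupport
        fun y => fderiv ℝ shellBump y (EuclideanSpace.single b (1 : ℝ)) :=
      hcs.fderiv_apply (𝕜 := ℝ) _
    have hgd : ContinuousOn
        (fun y => fderiv ℝ (radialExt g) y (EuclideanSpace.single b (1 : ℝ))) {0}ᶜ :=
      (hg.continuousOn_fderiv_of_isOpen isOpen_compl_singleton (by simp)).clm_apply
        continuousOn_const
    have h := integral_mul_fderiv_eq_neg_fderiv_mul_of_integrable (𝕜 := ℝ)
      (μ := (volume : Measure E3)) (f := shellBump) (g := radialExt g)
      (v := EuclideanSpace.single b (1 : ℝ))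
      ((continuous_mul_of_tsupport hdc (hds.trans tsupport_shellBump_subset_compl)
        hg.continuousOn).integrable_of_hasCompactSupport hdcs.mul_right)
      ((continuous_mul_of_tsupport contDiff_shellBump.continuous tsupport_shellBump_subset_compl
        hgd).integrable_of_hasCompactSupport hcs.mul_right)
      ((continuous_mul_of_tsupport contDiff_shellBump.continuous tsupport_shellBump_subset_compl
        hg.continuousOn).integrable_of_hasCompactSupport hcs.mul_right)
      (fun y _ => contDiff_shellBump.differentiable (by simp) y)
      (fun y hy => (hg.contDiffAt (isOpen_compl_singleton.mem_nhds
        (tsupport_shellBump_subset_compl hy))).differentiableAt (by simp))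
    rw [integral_polar (p := fun r => φ (r ^ 2) * r⁻¹) (q := partialDeriv b g),
      integral_polar (p := fun r => 2 * r * deriv φ (r ^ 2)) (q := fun x => X b x * g x)] at h
    · rw [h]; simp only [β]; ring
    · intro x r hr
      rw [fderiv_shellBump, radialExt_smul g x hr]; ring
    · intro x r hr
      rw [partialDeriv_radialExt_smul g b x hr, hbump]; ring
  -- Up to the total area, `α` is the integral of the nonnegative function `shellBump y / ‖y‖`,
  -- which is positive at the point `(√2, 0, 0)`.
  have hα : α ≠ 0 := by
    have h1 : ∫ y : E3, shellBump y * ‖y‖⁻¹ = α * ∫ _ : S2, (1 : ℝ) ∂area := by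
      refine integral_polar (p := fun r => φ (r ^ 2) * r⁻¹) fun x r hr => ?_
      rw [hbump, norm_smul, norm_coe_S2, mul_one, mul_one, Real.norm_of_nonneg hr.le]
    have h2 : 0 < ∫ y : E3, shellBump y * ‖y‖⁻¹ := by
      have hc : Continuous fun y : E3 => shellBump y * ‖y‖⁻¹ :=
        continuous_mul_of_tsupport contDiff_shellBump.continuous tsupport_shellBump_subset_compl
          (continuous_norm.continuousOn.inv₀ fun y hy => norm_ne_zero_iff.2 hy)
      refine hc.integral_pos_of_hasCompactSupport_nonneg_nonzero
        hasCompactSupport_shellBump.mul_right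
        (fun y => mul_nonneg φ.nonneg (inv_nonneg.2 (norm_nonneg y)))
        (x := EuclideanSpace.single (0 : Fin 3) (Real.sqrt 2)) ?_
      have h3 : shellBump (EuclideanSpace.single (0 : Fin 3) (Real.sqrt 2)) = 1 := by
        rw [shellBump]
        refine ContDiffBump.one_of_mem_closedBall _ ?_
        simp
      rw [h3]
      simp
    intro h0
    rw [h1, h0, zero_mul] at h2
    exact lt_irrefl _ h2
  -- The ratio is calibrated on `g = X_b` instead of by a radial computation: `∂_b X_b = 1 - X_b²`,
  -- and summing over `b` gives `α (12π - 4π) = β · 4π`.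
  have hβ : β = 2 * α := by
    have h1 : ∀ b : Fin 3, ∫ x, partialDeriv b (X b) x ∂area
        = 4 * Real.pi - ∫ x, X b x * X b x ∂area := by
      intro b
      have hi : Integrable (fun x => X b x * X b x) area :=
        integrable_of_continuous ((continuous_X b).mul (continuous_X b))
      have h2 : ∀ x, partialDeriv b (X b) x = 1 - X b x * X b x := by
        intro x; rw [(HasGrad.coord b).eq]; simp [sigma, delta]
      simp only [h2]
      rw [integral_sub (integrable_const _) hi, integral_const_area, mul_one]
    have h3 : ∑ b : Fin 3, ∫ x, X b x * X b x ∂area = 4 * Real.pi := by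
      rw [← integral_finsetSum (f := fun b x => X b x * X b x) _
        fun b _ => integrable_of_continuous ((continuous_X b).mul (continuous_X b))]
      simp only [sum_X_mul_X, integral_const_area, mul_one]
    have h4 : ∀ b : Fin 3, α * (4 * Real.pi - ∫ x, X b x * X b x ∂area)
        = β * ∫ x, X b x * X b x ∂area := fun b => by
      rw [← h1]; exact key b (HasGrad.coord b).smooth
    have h5 := congrArg₂ (· + ·) (congrArg₂ (· + ·) (h4 0) (h4 1)) (h4 2)
    rw [Fin.sum_univ_three] at h3
    have hpi := Real.pi_ne_zero
    have h6 : α * (3 * (4 * Real.pi) - 4 * Real.pi) = β * (4 * Real.pi) := by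
      rw [← h3]
      linear_combination h5 + 3 * α * h3
    have h7 : (4 * Real.pi) * β = (4 * Real.pi) * (2 * α) := by linear_combination -h6
    exact mul_left_cancel₀ (by positivity) h7
  have h := key a hf
  rw [hβ] at h
  refine mul_left_cancel₀ hα ?_
  rw [h]; ring

/-! ### Integration by parts -/

theorem sum_sigma_mul_of_tangent {x : S2} {v : Fin 3 → ℝ} (hv : ∑ a, X a x * v a = 0)
    (b : Fin 3) : ∑ a, sigma x a b * v a = v b := by
  have : ∑ a, sigma x a b * v a = v b - (∑ a, X a x * v a) * X b x := by
    simp only [sigma, delta, sub_mul, Finset.sum_sub_distrib, Finset.sum_mul]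
    simp [mul_right_comm]
  rw [this, hv]; simp

theorem sigma_symm (x : S2) (a b : Fin 3) : sigma x a b = sigma x b a := by
  simp only [sigma, delta, mul_comm, eq_comm]

theorem HasGrad.tangent {f : S2 → ℝ} {g : S2 → Fin 3 → ℝ} (h : HasGrad f g) (x : S2) :
    ∑ a, X a x * g x a = 0 := by
  simpa only [h.eq] using sum_X_mul_partialDeriv h.smooth x

theorem HasGrad.integral_eq {f : S2 → ℝ} {g : S2 → Fin 3 → ℝ} (h : HasGrad f g) (a : Fin 3) :
    ∫ x, g x a ∂area = 2 * ∫ x, X a x * f x ∂area := by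
  simpa only [h.eq] using integral_partialDeriv h.smooth a

/-- Apply the componentwise identity to `V_a f` and sum over `a`: the normal term `2 ∫ f X·V`
vanishes because `V` is tangential. The sum of `V' a x a` is then the divergence of `V`. -/
theorem integral_sum_mul_grad {f : S2 → ℝ} {g : S2 → Fin 3 → ℝ} {V : S2 → Fin 3 → ℝ}
    {V' : Fin 3 → S2 → Fin 3 → ℝ} (hf : HasGrad f g) (hV : ∀ a, HasGrad (fun x => V x a) (V' a))
    (ht : ∀ x, ∑ a, X a x * V x a = 0) :
    ∫ x, ∑ a, V x a * g x a ∂area = - ∫ x, f x * ∑ a, V' a x a ∂area := by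
  have hc1 : ∀ a, Integrable (fun x => V x a * g x a + f x * V' a x a) area := fun a =>
    integrable_of_continuous (((hV a).mul hf).continuous_grad a)
  have hc2 : ∀ a, Integrable (fun x => X a x * (V x a * f x)) area := fun a =>
    integrable_of_continuous ((continuous_X a).mul ((hV a).mul hf).continuous)
  have h1 : ∀ a, ∫ x, (V x a * g x a + f x * V' a x a) ∂area
      = 2 * ∫ x, X a x * (V x a * f x) ∂area := fun a => ((hV a).mul hf).integral_eq a
  have h2 : ∫ x, ∑ a, (V x a * g x a + f x * V' a x a) ∂area = 0 := by
    rw [integral_finsetSum _ fun a _ => hc1 a]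
    simp only [h1]
    rw [← Finset.mul_sum, ← integral_finsetSum _ fun a _ => hc2 a]
    simp only [← mul_assoc, ← Finset.sum_mul, ht]
    simp
  have hi1 : Integrable (fun x => ∑ a, V x a * g x a) area :=
    integrable_of_continuous (continuous_finsetSum _ fun a _ =>
      (hV a).continuous.mul (hf.continuous_grad a))
  have hi2 : Integrable (fun x => f x * ∑ a, V' a x a) area :=
    integrable_of_continuous (hf.continuous.mul (continuous_finsetSum _ fun a _ =>
      (hV a).continuous_grad a))
  simp only [Finset.sum_add_distrib, ← Finset.mul_sum] at h2
  rw [integral_add hi1 hi2] at h2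
  linarith

/-- Surface gradients are tangential, so projecting the contracted slot changes nothing; only the
projection of the free slot remains. -/
theorem div2_eq {T : S2 → Fin 3 → Fin 3 → ℝ} {T' : Fin 3 → Fin 3 → S2 → Fin 3 → ℝ}
    (hT : ∀ a b, HasGrad (fun x => T x a b) (T' a b)) (x : S2) (b : Fin 3) :
    div2 T x b = ∑ c, sigma x b c * ∑ a, T' a c x a := by
  have h : ∀ c d, ∑ a, sigma x a c * T' c d x a = T' c d x c :=
    fun c d => sum_sigma_mul_of_tangent ((hT c d).tangent x) c
  simp only [div2, covDeriv2, (hT _ _).eq]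
  simp only [Fin.sum_univ_three] at h ⊢
  linear_combination sigma x b 0 * (h 0 0 + h 1 0 + h 2 0) + sigma x b 1 * (h 0 1 + h 1 1 + h 2 1)
    + sigma x b 2 * (h 0 2 + h 1 2 + h 2 2)

/-- The one-form `T_{ab} V_b` is tangential, so its divergence integrates to zero. This divergence
is the sum of the two integrands, the projection in `div2` being absorbed by the tangential `V`. -/
theorem integral_sum_mul_div2 {T : S2 → Fin 3 → Fin 3 → ℝ} {T' : Fin 3 → Fin 3 → S2 → Fin 3 → ℝ}
    {V : S2 → Fin 3 → ℝ} {V' : Fin 3 → S2 → Fin 3 → ℝ}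
    (hT : ∀ a b, HasGrad (fun x => T x a b) (T' a b)) (hV : ∀ a, HasGrad (fun x => V x a) (V' a))
    (htT : ∀ x b, ∑ a, X a x * T x a b = 0) (htV : ∀ x, ∑ a, X a x * V x a = 0) :
    ∫ x, ∑ b, V x b * div2 T x b ∂area = - ∫ x, ∑ b, ∑ a, V' b x a * T x a b ∂area := by
  have h0 : ∀ x, ∑ b, V x b * div2 T x b = ∑ b, V x b * ∑ a, T' a b x a := by
    intro x
    have h := sum_sigma_mul_of_tangent (htV x)
    simp only [div2_eq hT]
    simp only [Fin.sum_univ_three] at h ⊢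
    linear_combination (T' 0 0 x 0 + T' 1 0 x 1 + T' 2 0 x 2) * h 0
      + (T' 0 1 x 0 + T' 1 1 x 1 + T' 2 1 x 2) * h 1
      + (T' 0 2 x 0 + T' 1 2 x 1 + T' 2 2 x 2) * h 2
  have hW : ∀ a, HasGrad (fun x => ∑ b, T x a b * V x b) _ := fun a =>
    HasGrad.sum Finset.univ fun b _ => (hT a b).mul (hV b)
  have h1 := integral_sum_mul_grad (HasGrad.const 1) hW (by
    intro x
    simp only [Finset.mul_sum]
    rw [Finset.sum_comm]
    simp only [← mul_assoc, ← Finset.sum_mul, htT]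
    simp)
  have hi1 : Integrable (fun x => ∑ b, V x b * ∑ a, T' a b x a) area :=
    integrable_of_continuous (continuous_finsetSum _ fun b _ => (hV b).continuous.mul
      (continuous_finsetSum _ fun a _ => (hT a b).continuous_grad a))
  have hi2 : Integrable (fun x => ∑ b, ∑ a, V' b x a * T x a b) area :=
    integrable_of_continuous (continuous_finsetSum _ fun b _ => continuous_finsetSum _ fun a _ =>
      ((hV b).continuous_grad a).mul (hT a b).continuous)
  have h2 : ∫ x, ((∑ b, V x b * ∑ a, T' a b x a) + ∑ b, ∑ a, V' b x a * T x a b) ∂area = 0 := by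
    simp only [mul_zero, Finset.sum_const_zero, integral_zero, one_mul] at h1
    rw [← neg_eq_zero, h1]
    congr 2 with x
    simp only [Fin.sum_univ_three]
    ring
  rw [integral_add hi1 hi2] at h2
  simp only [h0]
  linarith

/-! ### Integrals of products of linear functions -/

/-- The restriction to the sphere of the linear function with coefficients `v`. -/
def lin (v : Fin 3 → ℝ) (x : S2) : ℝ := ∑ i, v i * X i x

theorem hasGrad_lin (v : Fin 3 → ℝ) :
    HasGrad (lin v) fun x a => v a - lin v x * X a x :=
  (HasGrad.sum Finset.univ fun i _ => (HasGrad.coord i).const_mul (v i)).congr fun x a => by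
    simp only [lin, sigma, delta, mul_sub, Finset.sum_sub_distrib, Finset.sum_mul]
    simp
    exact Finset.sum_congr rfl fun i _ => by ring

theorem continuous_lin (v : Fin 3 → ℝ) : Continuous (lin v) := (hasGrad_lin v).continuous

theorem integral_sum_mul_lin (v : Fin 3 → ℝ) {f : S2 → ℝ}
    (hf : Continuous f) : ∫ x, lin v x * f x ∂area = ∑ a, v a * ∫ x, X a x * f x ∂area := by
  simp only [lin, Finset.sum_mul, mul_assoc]
  rw [integral_finsetSum (f := fun a x => v a * (X a x * f x)) _ fun a _ =>
    integrable_of_continuous (continuous_const.mul ((continuous_X a).mul hf))]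
  simp only [integral_const_mul]

/-- Since `∂_a (w·X) = w_a - (w·X) X_a`, the moments `M_a = ∫ X_a (w·X)` satisfy `4π w_a - M_a = 2
M_a`. -/
theorem integral_lin_mul_lin (v w : Fin 3 → ℝ) :
    ∫ x, lin v x * lin w x ∂area = 4 * Real.pi / 3 * ∑ a, v a * w a := by
  have h : ∀ a, ∫ x, X a x * lin w x ∂area = 4 * Real.pi / 3 * w a := by
    intro a
    have := (hasGrad_lin w).integral_eq a
    have hi : Integrable (fun x => X a x * lin w x) area :=
      integrable_of_continuous ((continuous_X a).mul (continuous_lin w))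
    simp only [mul_comm (lin w _)] at this
    rw [integral_sub (integrable_const _) hi, integral_const_area] at this
    linarith
  rw [integral_sum_mul_lin v (continuous_lin w), Finset.mul_sum]
  exact Finset.sum_congr rfl fun a _ => by rw [h]; ring

/-- Same recursion one step up: differentiating a product of three linear functions gives quadratic
moments minus three copies of the unknown, which equals two copies. So the quadratic moments are
divided by five, one term for each pairing. -/
theorem integral_lin_mul_lin_mul_lin_mul_lin (t u v w : Fin 3 → ℝ) :
    ∫ x, lin t x * (lin u x * (lin v x * lin w x)) ∂area = 4 * Real.pi / 15 *
      ((∑ a, t a * u a) * (∑ a, v a * w a) + (∑ a, t a * v a) * (∑ a, u a * w a)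
        + (∑ a, t a * w a) * (∑ a, u a * v a)) := by
  have hg := (hasGrad_lin u).mul ((hasGrad_lin v).mul (hasGrad_lin w))
  have c := continuous_lin
  have h : ∀ a, ∫ x, X a x * (lin u x * (lin v x * lin w x)) ∂area = 4 * Real.pi / 15 *
      (u a * (∑ a, v a * w a) + v a * (∑ a, u a * w a) + w a * (∑ a, u a * v a)) := by
    intro a
    have h1 := hg.integral_eq a
    have h2 : ∀ x, lin u x * (lin v x * (w a - lin w x * X a x) + lin w x * (v a - lin v x * X a x))
        + lin v x * lin w x * (u a - lin u x * X a x)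
        = u a * (lin v x * lin w x) + v a * (lin u x * lin w x) + w a * (lin u x * lin v x)
          - 3 * (X a x * (lin u x * (lin v x * lin w x))) := fun x => by ring
    have cX := continuous_X a
    simp only [h2] at h1
    rw [integral_sub, integral_add, integral_add] at h1
    · simp only [integral_const_mul, integral_lin_mul_lin] at h1
      linarith
    all_goals
      exact integrable_of_continuous (by fun_prop)
  rw [integral_sum_mul_lin t hg.continuous, Finset.mul_sum]
  simp only [h, Fin.sum_univ_three]
  ring

section

/-! ### Quadrupole shear tensors -/

theorem quadForm_eq (A : Matrix (Fin 3) (Fin 3) ℝ) :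
    quadForm A = fun x => ∑ i, X i x * lin (A i) x := by
  ext x
  simp only [quadForm, lin, Finset.mul_sum]
  exact Finset.sum_congr rfl fun i _ => Finset.sum_congr rfl fun j _ => by ring

variable {A B : Matrix (Fin 3) (Fin 3) ℝ}

theorem hasGrad_quadForm (hA : A.IsSymm) : HasGrad (quadForm A)
    fun x a => 2 * (lin (A a) x - quadForm A x * X a x) := by
  have h := HasGrad.sum Finset.univ fun i _ => (HasGrad.coord i).mul (hasGrad_lin (A i))
  rw [quadForm_eq]
  refine h.congr fun x a => ?_
  simp only [sigma, delta, Finset.sum_add_distrib, mul_sub, Finset.sum_sub_distrib, Finset.sum_mul,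
    Finset.mul_sum]
  have h2 : lin (A a) x = ∑ i, X i x * A i a := by
    simp only [lin]
    exact Finset.sum_congr rfl fun i _ => by rw [hA.apply a i, mul_comm]
  simp [← h2]
  simp only [two_mul, Finset.sum_add_distrib]
  have h3 : ∀ i, lin (A i) x * (X a x * X i x) = X i x * (lin (A i) x * X a x) := fun i => by ring
  have h4 : ∀ i, X i x * lin (A i) x * X a x = X i x * (lin (A i) x * X a x) := fun i => by ring
  simp only [h3, h4]
  ring

theorem X_neg (k : Fin 3) (x : S2) : X k (-x) = - X k x := by simp [X]

theorem lin_neg (v : Fin 3 → ℝ) (x : S2) : lin v (-x) = - lin v x := by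
  simp [lin, X_neg]

theorem quadForm_neg (A : Matrix (Fin 3) (Fin 3) ℝ) (x : S2) : quadForm A (-x) = quadForm A x := by
  simp [quadForm, X_neg]

theorem epsilon_neg (x : S2) (a b : Fin 3) : epsilon (-x) a b = - epsilon x a b := by
  simp [epsilon, X_neg]

theorem hasGrad_epsilon (a b : Fin 3) :
    HasGrad (fun x => epsilon x a b) fun x d => leviCivita a b d - epsilon x a b * X d x :=
  hasGrad_lin (leviCivita a b)

/-- The closed part of the shear with potential `∑ A_{ij} X^i X^j`. -/
def quadShear (A : Matrix (Fin 3) (Fin 3) ℝ) (x : S2) (a b : Fin 3) : ℝ :=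
  2 * A a b - 2 * (X a x * lin (A b) x) - 2 * (lin (A a) x * X b x)
    + quadForm A x * delta a b + quadForm A x * (X a x * X b x)

theorem quadShear_neg (A : Matrix (Fin 3) (Fin 3) ℝ) (x : S2) :
    quadShear A (-x) = quadShear A x := by
  ext a b
  simp [quadShear, X_neg, lin_neg, quadForm_neg]

theorem sum_X_mul_lin (A : Matrix (Fin 3) (Fin 3) ℝ) (x : S2) :
    ∑ a, X a x * lin (A a) x = quadForm A x := by rw [quadForm_eq]

theorem sum_X_mul_delta (x : S2) (b : Fin 3) : ∑ a, X a x * delta a b = X b x := by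
  simp [delta]

theorem sum_X_mul_apply (hA : A.IsSymm) (x : S2) (b : Fin 3) :
    ∑ a, X a x * A a b = lin (A b) x := by
  simp only [lin]
  exact Finset.sum_congr rfl fun a _ => by rw [hA.apply b a, mul_comm]

theorem quadShear_symm (hA : A.IsSymm) (x : S2) (a b : Fin 3) :
    quadShear A x a b = quadShear A x b a := by
  have h : delta a b = delta b a := by simp only [delta, eq_comm]
  simp only [quadShear, h, hA.apply b a]
  ring

theorem sum_X_mul_quadShear (hA : A.IsSymm) (x : S2) (b : Fin 3) :
    ∑ a, X a x * quadShear A x a b = 0 := by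
  have h1 := sum_X_mul_lin A x
  have h2 := sum_X_mul_delta x b
  have h3 := sum_X_mul_apply hA x b
  have h4 := sum_X_mul_X x
  simp only [quadShear, Fin.sum_univ_three] at *
  linear_combination 2 * h3 - 2 * lin (A b) x * h4 - 2 * X b x * h1 + quadForm A x * h2
    + quadForm A x * X b x * h4

theorem trace_quadShear (hA : A.trace = 0) (x : S2) : ∑ a, quadShear A x a a = 0 := by
  have h1 := sum_X_mul_lin A x
  have h4 := sum_X_mul_X x
  simp only [Matrix.trace, Matrix.diag] at hA
  simp only [quadShear, Fin.sum_univ_three, delta, if_true] at *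
  linear_combination 2 * hA - 4 * h1 + quadForm A x * h4

/-- This splitting is the origin of `quadShear`: for traceless `A` the first term is trace free, so
the Laplacian `-6q` and the closed part of the shear are read off together. -/
theorem hess_quadForm (hA : A.IsSymm) (x : S2) (a b : Fin 3) :
    hess (quadForm A) x a b = quadShear A x a b - 3 * quadForm A x * sigma x a b := by
  have h0 : ∀ b, HasGrad (fun x => 2 * (lin (A b) x - quadForm A x * X b x)) _ := fun b =>
    ((hasGrad_lin (A b)).sub ((hasGrad_quadForm hA).mul (HasGrad.coord b))).const_mul 2
  simp only [hess, (hasGrad_quadForm hA).grad_eq, covDeriv1, (h0 _).eq]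
  have h1 := sum_X_mul_lin A x
  have h2 : ∑ c, sigma x b c * delta a c = sigma x b a := by simp [delta]
  have h3 := sum_X_mul_apply hA x a
  have h4 := sum_X_mul_X x
  have h5 := hA.apply a b
  have h6 : delta a b = delta b a := by simp only [delta, eq_comm]
  have h7 : ∀ v : Fin 3 → ℝ, ∑ c, sigma x b c * v c = v b - X b x * ∑ c, X c x * v c := by
    intro v
    simp only [sigma, delta, sub_mul, Finset.sum_sub_distrib, Finset.mul_sum]
    simp [mul_assoc]
  have h8 := sum_X_mul_delta x a
  have h9 : ∀ c, delta a c = delta c a := fun c => by simp only [delta, eq_comm]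
  rw [h7]
  simp only [quadShear, sigma, h9, Fin.sum_univ_three] at *
  rw [← h5]
  linear_combination (-2 * X b x) * h3 + 2 * X a x * X b x * h1 + 2 * quadForm A x * X b x * h8
    + 2 * X b x * (2 * lin (A a) x - 3 * quadForm A x * X a x) * h4

theorem sum_sigma_self (x : S2) : ∑ a, sigma x a a = 2 := by
  have h4 := sum_X_mul_X x
  simp only [sigma, delta, if_true, Fin.sum_univ_three] at *
  linear_combination -h4

theorem laplacian_quadForm (hA : A.IsSymm) (hA' : A.trace = 0) (x : S2) :
    laplacian (quadForm A) x = -6 * quadForm A x := by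
  simp only [laplacian, hess_quadForm hA, Finset.sum_sub_distrib, trace_quadShear hA',
    ← Finset.mul_sum, sum_sigma_self]
  ring

theorem isHarmonicOfMode_quadForm (hA : A.IsSymm) (hA' : A.trace = 0) :
    IsHarmonicOfMode 2 (quadForm A) := by
  refine ⟨(hasGrad_quadForm hA).smooth, fun x => ?_⟩
  rw [laplacian_quadForm hA hA']; norm_num

theorem closedPart_quadForm (hA : A.IsSymm) (hA' : A.trace = 0) :
    closedPart (quadForm A) = quadShear A := by
  ext x a b
  rw [closedPart, hess_quadForm hA, laplacian_quadForm hA hA']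
  ring

/-! ### Algebra of the area form and the co-closed shear -/

theorem sum_X_mul_epsilon (x : S2) (b : Fin 3) : ∑ a, X a x * epsilon x a b = 0 := by
  fin_cases b <;> simp [Fin.sum_univ_three, epsilon, leviCivita] <;> ring

theorem epsilon_antisymm (x : S2) (a b : Fin 3) : epsilon x a b = - epsilon x b a := by
  simp only [epsilon, ← Finset.sum_neg_distrib]
  exact Finset.sum_congr rfl fun c _ => by simp only [leviCivita]; ring

theorem sum_epsilon_mul_X (x : S2) (a : Fin 3) : ∑ b, epsilon x a b * X b x = 0 := by
  have h := sum_X_mul_epsilon x a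
  simp only [Fin.sum_univ_three, epsilon_antisymm x a] at h ⊢
  linear_combination -h

theorem sum_epsilon_mul_sigma (x : S2) (a b : Fin 3) :
    ∑ e, epsilon x a e * sigma x e b = epsilon x a b := by
  have h : ∑ e, epsilon x a e * sigma x e b
      = epsilon x a b - (∑ e, epsilon x a e * X e x) * X b x := by
    simp only [sigma, delta, mul_sub, Finset.sum_sub_distrib, Finset.sum_mul]
    simp [mul_assoc]
  rw [h, sum_epsilon_mul_X]; ring

/-- `ε ε = -σ`. -/
theorem sum_epsilon_mul_epsilon (x : S2) (a b : Fin 3) :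
    ∑ e, epsilon x a e * epsilon x e b = - sigma x a b := by
  have h := sum_X_mul_X x
  rw [Fin.sum_univ_three] at h
  fin_cases a <;> fin_cases b <;>
    simp [Fin.sum_univ_three, epsilon, leviCivita, sigma, delta] <;>
    first | ring1 | linear_combination -h

/-- Symmetric traceless tangential tensors stay symmetric when multiplied by `ε`. -/
theorem sum_epsilon_mul_symm {x : S2} {M : Fin 3 → Fin 3 → ℝ} (hs : ∀ a b, M a b = M b a)
    (ht : ∑ a, M a a = 0) (hx : ∀ b, ∑ a, X a x * M a b = 0) (a b : Fin 3) :
    ∑ e, epsilon x a e * M e b = ∑ e, epsilon x b e * M e a := by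
  have h0 := hx 0
  have h1 := hx 1
  have h2 := hx 2
  have h10 := hs 1 0
  have h20 := hs 2 0
  have h21 := hs 2 1
  rw [Fin.sum_univ_three] at h0 h1 h2 ht
  fin_cases a <;> fin_cases b <;>
    simp [Fin.sum_univ_three, epsilon, leviCivita] <;> grind

/-- The co-closed part of the shear with co-closed potential `∑ A_{ij} X^i X^j`. -/
def dualShear (A : Matrix (Fin 3) (Fin 3) ℝ) (x : S2) (a b : Fin 3) : ℝ :=
  ∑ e, epsilon x a e * quadShear A x e b

theorem dualShear_neg (A : Matrix (Fin 3) (Fin 3) ℝ) (x : S2) (a b : Fin 3) :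
    dualShear A (-x) a b = - dualShear A x a b := by
  simp [dualShear, epsilon_neg, quadShear_neg]

theorem dualShear_symm (hA : A.IsSymm) (hA' : A.trace = 0) (x : S2) (a b : Fin 3) :
    dualShear A x a b = dualShear A x b a :=
  sum_epsilon_mul_symm (quadShear_symm hA x) (trace_quadShear hA' x) (sum_X_mul_quadShear hA x) a b

theorem sum_X_mul_dualShear (x : S2) (b : Fin 3) :
    ∑ a, X a x * dualShear A x a b = 0 := by
  simp only [dualShear, Finset.mul_sum]
  rw [Finset.sum_comm]
  simp only [← mul_assoc, ← Finset.sum_mul, sum_X_mul_epsilon]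
  simp

/-- Applying `ε` to the Hessian gives `ε K - 3 q ε`. The second term is antisymmetric and drops out
of the symmetrisation; the first is already symmetric. -/
theorem coclosedPart_quadForm (hA : A.IsSymm) (hA' : A.trace = 0) :
    coclosedPart (quadForm A) = dualShear A := by
  ext x a b
  have h1 := sum_epsilon_mul_sigma x a b
  have h2 := sum_epsilon_mul_sigma x b a
  have h3 := epsilon_antisymm x a b
  have h4 := dualShear_symm hA hA' x a b
  simp only [coclosedPart, hess_quadForm hA]
  simp only [dualShear, Fin.sum_univ_three] at *
  linear_combination (-3 / 2 * quadForm A x) * (h1 + h2 + h3) - 1 / 2 * h4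

/-! ### Gradients and divergences of quadrupole shears -/

theorem hasGrad_quadShear (hA : A.IsSymm) (a b : Fin 3) :
    HasGrad (fun x => quadShear A x a b) fun x d =>
      - 2 * (X a x * (A b d - lin (A b) x * X d x) + lin (A b) x * sigma x d a)
      - 2 * (lin (A a) x * sigma x d b + X b x * (A a d - lin (A a) x * X d x))
      + 2 * (lin (A d) x - quadForm A x * X d x) * (delta a b + X a x * X b x)
      + quadForm A x * (X a x * sigma x d b + X b x * sigma x d a) := by
  have hq := hasGrad_quadForm hA
  have hX := HasGrad.coord
  refine (((((HasGrad.const (2 * A a b)).sub (((hX a).mul (hasGrad_lin (A b))).const_mul 2)).sub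
    (((hasGrad_lin (A a)).mul (hX b)).const_mul 2)).add (hq.mul_const (delta a b))).add
    (hq.mul ((hX a).mul (hX b)))).congr fun x d => ?_
  ring

theorem sum_X_mul_sigma (x : S2) (b : Fin 3) : ∑ a, X a x * sigma x a b = 0 :=
  (HasGrad.coord b).tangent x

/-- `∂^a K_{ab}` in the ambient frame, for the closed shear `K`. -/
theorem sum_grad_quadShear (hA' : A.trace = 0) (x : S2) (b : Fin 3) :
    ∑ a, (- 2 * (X a x * (A b a - lin (A b) x * X a x) + lin (A b) x * sigma x a a)
      - 2 * (lin (A a) x * sigma x a b + X b x * (A a a - lin (A a) x * X a x))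
      + 2 * (lin (A a) x - quadForm A x * X a x) * (delta a b + X a x * X b x)
      + quadForm A x * (X a x * sigma x a b + X b x * sigma x a a))
      = -4 * (lin (A b) x - quadForm A x * X b x) := by
  have h1 := sum_X_mul_lin A x
  have h2 := sum_X_mul_delta x b
  have h4 := sum_X_mul_X x
  have h5 : ∑ a, X a x * A b a = lin (A b) x := by simp only [lin, mul_comm]
  have h6 : ∑ a, lin (A a) x * delta a b = lin (A b) x := by simp [delta]
  have h7 : ∑ a, delta a a = 3 := by simp [delta]
  simp only [Matrix.trace, Matrix.diag] at hA'
  simp only [sigma, Fin.sum_univ_three] at *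
  linear_combination (-2) * h5 - 2 * X b x * hA' + 6 * X b x * h1 - quadForm A x * h2
    + (4 * lin (A b) x - 4 * quadForm A x * X b x) * h4
    + (quadForm A x * X b x - 2 * lin (A b) x) * h7

theorem hasGrad_dualShear (hA : A.IsSymm) (a b : Fin 3) :
    HasGrad (fun x => dualShear A x a b) fun x d => ∑ e, (epsilon x a e *
      (- 2 * (X e x * (A b d - lin (A b) x * X d x) + lin (A b) x * sigma x d e)
      - 2 * (lin (A e) x * sigma x d b + X b x * (A e d - lin (A e) x * X d x))
      + 2 * (lin (A d) x - quadForm A x * X d x) * (delta e b + X e x * X b x)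
      + quadForm A x * (X e x * sigma x d b + X b x * sigma x d e))
      + quadShear A x e b * (leviCivita a e d - epsilon x a e * X d x)) :=
  HasGrad.sum Finset.univ fun e _ => (hasGrad_epsilon a e).mul (hasGrad_quadShear hA e b)

theorem sum_sigma_mul (x : S2) (a : Fin 3) (v : Fin 3 → ℝ) :
    ∑ b, sigma x a b * v b = v a - X a x * ∑ b, X b x * v b := by
  simp only [sigma, delta, sub_mul, Finset.sum_sub_distrib, Finset.mul_sum]
  simp [mul_assoc]

/-- On the unit sphere the divergence of the closed part is `½ ∇(Δ + 2)q`, which is `-2 ∇q` for `ℓ =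
2`. -/
theorem div2_quadShear (hA : A.IsSymm) (hA' : A.trace = 0) (x : S2) (b : Fin 3) :
    div2 (quadShear A) x b = -4 * (lin (A b) x - quadForm A x * X b x) := by
  rw [div2_eq (hasGrad_quadShear hA)]
  simp only [sum_grad_quadShear hA']
  rw [sum_sigma_mul]
  have h1 := sum_X_mul_lin A x
  have h4 := sum_X_mul_X x
  simp only [Fin.sum_univ_three] at *
  linear_combination 4 * X b x * h1 - 4 * X b x * quadForm A x * h4

/-- For traceless `A` this is `ε` applied to `-2 ∇q`, because `ε` is parallel; the radial term in
the ambient form of `∇q` is annihilated by `ε`. -/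
theorem div2_dualShear (hA : A.IsSymm) (x : S2) (b : Fin 3) :
    div2 (dualShear A) x b = -4 * ∑ e, epsilon x b e * lin (A e) x := by
  rw [div2_eq (hasGrad_dualShear hA)]
  have h1 : ∀ c, (∑ a, ∑ e, (epsilon x a e *
      (- 2 * (X e x * (A c a - lin (A c) x * X a x) + lin (A c) x * sigma x a e)
      - 2 * (lin (A e) x * sigma x a c + X c x * (A e a - lin (A e) x * X a x))
      + 2 * (lin (A a) x - quadForm A x * X a x) * (delta e c + X e x * X c x)
      + quadForm A x * (X e x * sigma x a c + X c x * sigma x a e))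
      + quadShear A x e c * (leviCivita a e a - epsilon x a e * X a x)))
      = -4 * ∑ e, epsilon x c e * lin (A e) x := by
    intro c
    have h10 := hA.apply 0 1
    have h20 := hA.apply 0 2
    have h21 := hA.apply 1 2
    have hx := sum_X_sq x
    simp only [quadForm_eq, lin, epsilon, leviCivita, sigma, delta, quadShear, Fin.sum_univ_three]
    fin_cases c <;> simp [h10, h20, h21] <;> grind
  have h2 : ∑ c, X c x * ∑ e, epsilon x c e * lin (A e) x = 0 := by
    simp only [Finset.mul_sum]
    rw [Finset.sum_comm]
    simp only [← mul_assoc, ← Finset.sum_mul, sum_X_mul_epsilon]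
    simp
  simp only [h1]
  rw [sum_sigma_mul]
  simp only [mul_left_comm _ (-4 : ℝ), ← Finset.mul_sum, h2]
  ring

end

section

/-! ### Contractions of quadrupole shear tensors -/

variable {A B : Matrix (Fin 3) (Fin 3) ℝ}

/-- Apart from `2A`, every term of `quadShear` has a factor `X` in one slot or is a multiple of `δ`;
a tangential trace-free `M` kills them all. -/
theorem inner2_quadShear_of_tangent {x : S2} {M : Fin 3 → Fin 3 → ℝ} (hs : ∀ a b, M a b = M b a)
    (ht : ∑ a, M a a = 0) (hx : ∀ b, ∑ a, X a x * M a b = 0) :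
    inner2 (quadShear A x) M = 2 * ∑ a, ∑ b, A a b * M a b := by
  have h : ∀ a b, quadShear A x a b * M a b = 2 * (A a b * M a b)
      - 2 * lin (A b) x * (X a x * M a b)
      - 2 * lin (A a) x * (X b x * M b a) + quadForm A x * (delta a b * M a b)
      + quadForm A x * X b x * (X a x * M a b) := by
    intro a b
    rw [hs b a, quadShear]
    ring
  have h' : ∑ a, ∑ b, delta a b * M a b = 0 := by simp [delta, ht]
  have h0 := hx 0
  have h1 := hx 1
  have h2 := hx 2
  simp only [inner2, h]
  simp only [Fin.sum_univ_three] at *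
  linear_combination (-4 * lin (A 0) x + quadForm A x * X 0 x) * h0
    + (-4 * lin (A 1) x + quadForm A x * X 1 x) * h1
    + (-4 * lin (A 2) x + quadForm A x * X 2 x) * h2 + quadForm A x * h'

theorem trace_dualShear (hB : B.IsSymm) (x : S2) : ∑ a, dualShear B x a a = 0 := by
  have h := quadShear_symm hB x
  simp only [dualShear, epsilon, leviCivita, Fin.sum_univ_three, h 1 0, h 2 0, h 2 1]
  simp
  ring

theorem inner2_quadShear (hA : A.IsSymm) (hA' : A.trace = 0) (hB : B.IsSymm) (hB' : B.trace = 0)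
    (x : S2) :
    inner2 (quadShear A x) (quadShear B x) = 4 * (∑ a, ∑ b, A a b * B a b)
      - 8 * ∑ a, lin (A a) x * lin (B a) x + 2 * (quadForm A x * quadForm B x) := by
  rw [inner2_quadShear_of_tangent (quadShear_symm hB x) (trace_quadShear hB' x)
    (sum_X_mul_quadShear hB x)]
  have h10 := hA.apply 0 1
  have h20 := hA.apply 0 2
  have h21 := hA.apply 1 2
  rw [Matrix.trace, Fin.sum_univ_three] at hA'
  simp only [Matrix.diag] at hA'
  simp only [quadShear, quadForm_eq A, lin, Fin.sum_univ_three, delta, h10, h20, h21]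
  simp
  linear_combination 2 * quadForm B x * hA'

theorem inner2_quadShear_dualShear (hA : A.IsSymm) (hB : B.IsSymm) (hB' : B.trace = 0) (x : S2) :
    inner2 (quadShear A x) (dualShear B x) = 4 * ∑ a, ∑ e, epsilon x a e *
      ((∑ b, A a b * B e b) - lin (A a) x * lin (B e) x) := by
  rw [inner2_quadShear_of_tangent (dualShear_symm hB hB' x) (trace_dualShear hB x)
    (sum_X_mul_dualShear x)]
  have h10 := hA.apply 0 1
  have h20 := hA.apply 0 2
  have h21 := hA.apply 1 2
  simp only [dualShear, quadShear, epsilon, leviCivita, lin, Fin.sum_univ_three, delta, h10, h20,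
    h21]
  simp
  ring

theorem inner2_comm (S T : Fin 3 → Fin 3 → ℝ) : inner2 S T = inner2 T S := by
  simp only [inner2, mul_comm]

/-- Multiplication by `ε` is an isometry of the tangent plane. -/
theorem sum_epsilon_mul_mul_sum {x : S2} (v : Fin 3 → ℝ) {w : Fin 3 → ℝ}
    (hw : ∑ a, X a x * w a = 0) :
    ∑ a, (∑ e, epsilon x a e * v e) * (∑ e, epsilon x a e * w e) = ∑ a, v a * w a := by
  have h := sum_X_mul_X x
  simp only [epsilon, leviCivita, Fin.sum_univ_three] at *
  simp
  linear_combination (v 0 * w 0 + v 1 * w 1 + v 2 * w 2) * h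
    - (X 0 x * v 0 + X 1 x * v 1 + X 2 x * v 2) * hw

theorem inner2_dualShear (hB : B.IsSymm) (x : S2) :
    inner2 (dualShear A x) (dualShear B x) = inner2 (quadShear A x) (quadShear B x) := by
  simp only [inner2]
  rw [Finset.sum_comm]
  conv_rhs => rw [Finset.sum_comm]
  exact Finset.sum_congr rfl fun b _ => sum_epsilon_mul_mul_sum _ (sum_X_mul_quadShear hB x b)

/-- The shear tensor with potentials `∑ A_{ij} X^i X^j` and `∑ B_{ij} X^i X^j`. -/
def shearField (A B : Matrix (Fin 3) (Fin 3) ℝ) (x : S2) (a b : Fin 3) : ℝ :=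
  quadShear A x a b + dualShear B x a b

/-- The divergence of `shearField A B`. -/
def shearFieldDiv (A B : Matrix (Fin 3) (Fin 3) ℝ) (x : S2) (b : Fin 3) : ℝ :=
  -2 * (2 * (lin (A b) x - quadForm A x * X b x)) - 4 * ∑ e, epsilon x b e * lin (B e) x

theorem div2_add {S T : S2 → Fin 3 → Fin 3 → ℝ} {S' T' : Fin 3 → Fin 3 → S2 → Fin 3 → ℝ}
    (hS : ∀ a b, HasGrad (fun x => S x a b) (S' a b))
    (hT : ∀ a b, HasGrad (fun x => T x a b) (T' a b)) (x : S2) (b : Fin 3) :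
    div2 (fun x a b => S x a b + T x a b) x b = div2 S x b + div2 T x b := by
  rw [div2_eq fun a b => (hS a b).add (hT a b), div2_eq hS, div2_eq hT]
  simp only [Finset.sum_add_distrib, mul_add]

theorem div2_shearField (hA : A.IsSymm) (hA' : A.trace = 0) (hB : B.IsSymm) :
    div2 (shearField A B) = shearFieldDiv A B := by
  ext x b
  have h : div2 (shearField A B) x b = div2 (quadShear A) x b + div2 (dualShear B) x b :=
    div2_add (hasGrad_quadShear hA) (hasGrad_dualShear hB) x b
  rw [h, div2_quadShear hA hA', div2_dualShear hB, shearFieldDiv]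
  ring

theorem hasGrad_curl (b : Fin 3) :
    HasGrad (fun x => ∑ e, epsilon x b e * lin (B e) x) fun x d =>
      ∑ e, (epsilon x b e * (B e d - lin (B e) x * X d x)
        + lin (B e) x * (leviCivita b e d - epsilon x b e * X d x)) :=
  HasGrad.sum Finset.univ fun e _ => (hasGrad_epsilon b e).mul (hasGrad_lin (B e))

theorem hasGrad_shearFieldDiv (hA : A.IsSymm) (b : Fin 3) :
    HasGrad (fun x => shearFieldDiv A B x b) fun x d =>
      -2 * (2 * (A b d - lin (A b) x * X d x - (quadForm A x * sigma x d b
          + X b x * (2 * (lin (A d) x - quadForm A x * X d x)))))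
      - 4 * ∑ e, (epsilon x b e * (B e d - lin (B e) x * X d x)
        + lin (B e) x * (leviCivita b e d - epsilon x b e * X d x)) :=
  ((((hasGrad_lin (A b)).sub ((hasGrad_quadForm hA).mul (HasGrad.coord b))).const_mul 2).const_mul
    (-2)).sub ((hasGrad_curl b).const_mul 4)

/-- The field is half of `ε ∇q`. As `ε` is parallel, its derivative is half of `ε` applied to the
Hessian `K - 3qσ`. -/
theorem covDeriv1_curl (hB : B.IsSymm) (x : S2) (a b : Fin 3) :
    covDeriv1 (fun x b => ∑ e, epsilon x b e * lin (B e) x) x a b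
      = 1 / 2 * dualShear B x b a + 3 / 2 * quadForm B x * epsilon x a b := by
  simp only [covDeriv1, (hasGrad_curl _).eq]
  have h10 := hB.apply 0 1
  have h20 := hB.apply 0 2
  have h21 := hB.apply 1 2
  have hx := sum_X_sq x
  simp only [quadForm_eq, lin, epsilon, leviCivita, sigma, delta, dualShear, quadShear,
    Fin.sum_univ_three]
  fin_cases a <;> fin_cases b <;> simp [h10, h20, h21] <;> grind

theorem covDeriv1_shearFieldDiv (hA : A.IsSymm) (hB : B.IsSymm) (x : S2) (a b : Fin 3) :
    covDeriv1 (shearFieldDiv A B) x a b = -2 * (quadShear A x a b - 3 * quadForm A x * sigma x a b)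
      - 2 * dualShear B x b a - 6 * quadForm B x * epsilon x a b := by
  have h1 := hess_quadForm hA x a b
  have h2 := covDeriv1_curl hB x a b
  have h0 : ∀ b, HasGrad (fun x => 2 * (lin (A b) x - quadForm A x * X b x)) _ := fun b =>
    ((hasGrad_lin (A b)).sub ((hasGrad_quadForm hA).mul (HasGrad.coord b))).const_mul 2
  simp only [hess, (hasGrad_quadForm hA).grad_eq] at h1
  simp only [covDeriv1, (h0 _).eq] at h1
  simp only [covDeriv1, (hasGrad_curl _).eq] at h2
  simp only [covDeriv1, (hasGrad_shearFieldDiv hA _).eq]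
  simp only [Finset.sum_sub_distrib, mul_sub (sigma x b _)] at h1 ⊢
  simp only [mul_left_comm (sigma x b _), ← Finset.mul_sum] at h1 h2 ⊢
  rw [h2]
  linear_combination -2 * h1

/-- The double divergence of the closed part is `½ Δ(Δ + 2)`, with value `½ · 6 · 4` on `ℓ = 2`; the
co-closed part contributes nothing. This yields the linear term `3n` in `∂_u m`. -/
theorem div1_shearFieldDiv (hA : A.IsSymm) (hA' : A.trace = 0) (hB : B.IsSymm) (x : S2) :
    div1 (shearFieldDiv A B) x = 12 * quadForm A x := by
  have h2 : ∀ a, epsilon x a a = 0 := fun a => by linarith [epsilon_antisymm x a a]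
  simp only [div1, covDeriv1_shearFieldDiv hA hB, h2, mul_zero, sub_zero, Finset.sum_sub_distrib,
    ← Finset.mul_sum, trace_quadShear hA', sum_sigma_self, trace_dualShear hB]
  ring

theorem sum_quadShear_mul_epsilon (hA : A.IsSymm) (hA' : A.trace = 0) (x : S2) (a e : Fin 3) :
    ∑ b, quadShear A x a b * epsilon x b e = - dualShear A x a e := by
  rw [dualShear_symm hA hA', dualShear, ← Finset.sum_neg_distrib]
  refine Finset.sum_congr rfl fun b _ => ?_
  rw [quadShear_symm hA, epsilon_antisymm]
  ring

theorem sum_dualShear_mul_epsilon (hA : A.IsSymm) (hA' : A.trace = 0) (x : S2) (a e : Fin 3) :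
    ∑ b, dualShear A x a b * epsilon x b e = quadShear A x a e := by
  have h1 : ∀ b, dualShear A x a b * epsilon x b e
      = ∑ f, -(epsilon x e b * epsilon x b f * quadShear A x f a) := by
    intro b
    rw [dualShear_symm hA hA', dualShear, Finset.sum_mul]
    refine Finset.sum_congr rfl fun f _ => ?_
    rw [epsilon_antisymm x b e]
    ring
  simp only [h1]
  rw [Finset.sum_comm]
  simp only [Finset.sum_neg_distrib, ← Finset.sum_mul, sum_epsilon_mul_epsilon, neg_mul, neg_neg]
  rw [sum_sigma_mul, sum_X_mul_quadShear hA, quadShear_symm hA]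
  ring

/-- The radial part of the divergence is lost against the tangential shear, and the `ε` of the
divergence is moved onto the shear, where it exchanges `K` and `ε K` up to sign. Only linear
functions are left beside the shear. -/
theorem sum_shearField_mul_div (hA : A.IsSymm) (hA' : A.trace = 0) (hB : B.IsSymm)
    (hB' : B.trace = 0) (A' B' : Matrix (Fin 3) (Fin 3) ℝ) (x : S2) (a : Fin 3) :
    ∑ b, shearField A B x a b * shearFieldDiv A' B' x b
      = -4 * ∑ b, (quadShear A x a b * lin (A' b) x + dualShear B x a b * lin (A' b) x
        - dualShear A x a b * lin (B' b) x + quadShear B x a b * lin (B' b) x) := by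
  have h1 := sum_quadShear_mul_epsilon hA hA' x a
  have h2 := sum_dualShear_mul_epsilon hB hB' x a
  have h3 := sum_X_mul_quadShear hA x a
  have h4 := sum_X_mul_dualShear (A := B) x a
  simp only [quadShear_symm hA x _ a] at h3
  simp only [dualShear_symm hB hB' x _ a] at h4
  simp only [shearField, shearFieldDiv, Fin.sum_univ_three] at *
  linear_combination (4 * quadForm A' x) * (h3 + h4) - 4 * lin (B' 0) x * (h1 0 + h2 0)
    - 4 * lin (B' 1) x * (h1 1 + h2 1) - 4 * lin (B' 2) x * (h1 2 + h2 2)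

end

section

/-! ### Integrals of quadrupole expressions -/

variable {A B : Matrix (Fin 3) (Fin 3) ℝ}

theorem X_eq_lin (k : Fin 3) : X k = lin (Pi.single k 1) := by
  ext x; simp [lin, Pi.single_apply]

theorem continuous_quadForm (A : Matrix (Fin 3) (Fin 3) ℝ) : Continuous (quadForm A) := by
  rw [quadForm_eq]
  exact continuous_finsetSum _ fun i _ => (continuous_X i).mul (continuous_lin _)

theorem integral_X_mul_lin (k : Fin 3) (v : Fin 3 → ℝ) :
    ∫ x, X k x * lin v x ∂area = 4 * Real.pi / 3 * v k := by
  rw [X_eq_lin, integral_lin_mul_lin]; simp [Pi.single_apply]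

theorem integral_X_mul_lin_mul_lin_mul_lin (k : Fin 3) (u v w : Fin 3 → ℝ) :
    ∫ x, X k x * (lin u x * (lin v x * lin w x)) ∂area = 4 * Real.pi / 15 *
      (u k * (∑ a, v a * w a) + v k * (∑ a, u a * w a) + w k * (∑ a, u a * v a)) := by
  rw [X_eq_lin, integral_lin_mul_lin_mul_lin_mul_lin]; simp [Pi.single_apply]

/-- Of the three pairings in the quartic moment, the one joining the two slots of `A` is the trace
and vanishes; the other two agree by symmetry. -/
theorem integral_X_mul_lin_mul_quadForm (hA : A.IsSymm) (hA' : A.trace = 0) (k : Fin 3)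
    (v : Fin 3 → ℝ) :
    ∫ x, X k x * (lin v x * quadForm A x) ∂area = 8 * Real.pi / 15 * ∑ a, A k a * v a := by
  have cl := continuous_lin
  have h : ∀ x, X k x * (lin v x * quadForm A x)
      = ∑ i, X k x * (lin v x * (lin (Pi.single i 1) x * lin (A i) x)) := by
    intro x; simp only [quadForm_eq, Finset.mul_sum, ← X_eq_lin]
  have cX := continuous_X k
  simp only [h]
  rw [integral_finsetSum _ fun i _ => integrable_of_continuous (by fun_prop)]
  simp only [integral_X_mul_lin_mul_lin_mul_lin]
  have h10 := hA.apply 0 1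
  have h20 := hA.apply 0 2
  have h21 := hA.apply 1 2
  rw [Matrix.trace, Fin.sum_univ_three] at hA'
  simp only [Matrix.diag] at hA'
  simp only [Fin.sum_univ_three, Pi.single_apply]
  fin_cases k <;> simp [h10, h20, h21]
  · linear_combination 4 * Real.pi / 15 * v 0 * hA'
  · linear_combination 4 * Real.pi / 15 * v 1 * hA'
  · linear_combination 4 * Real.pi / 15 * v 2 * hA'

theorem integral_lin_mul_lin_mul_quadForm (hA : A.IsSymm) (hA' : A.trace = 0)
    (v w : Fin 3 → ℝ) :
    ∫ x, lin v x * (lin w x * quadForm A x) ∂area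
      = 8 * Real.pi / 15 * ∑ a, ∑ b, A a b * v a * w b := by
  rw [integral_sum_mul_lin (f := fun x => lin w x * quadForm A x) v
    ((continuous_lin w).mul (continuous_quadForm A))]
  simp only [integral_X_mul_lin_mul_quadForm hA hA', Fin.sum_univ_three]
  ring

theorem integral_quadForm_mul_quadForm (hB : B.IsSymm) (hB' : B.trace = 0) :
    ∫ x, quadForm A x * quadForm B x ∂area = 8 * Real.pi / 15 * ∑ a, ∑ b, A a b * B a b := by
  have h : ∀ x, quadForm A x * quadForm B x
      = ∑ i, X i x * (lin (A i) x * quadForm B x) := by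
    intro x; simp only [quadForm_eq A, Finset.sum_mul, mul_assoc]
  have cl := continuous_lin
  have cX := continuous_X
  have cq := continuous_quadForm
  simp only [h]
  rw [integral_finsetSum _ fun i _ => integrable_of_continuous (by fun_prop)]
  simp only [integral_X_mul_lin_mul_quadForm hB hB', Finset.mul_sum]
  exact Finset.sum_congr rfl fun i _ => Finset.sum_congr rfl fun j _ => by ring

/-- Integrals of products of three quadrupoles, two of which agree. -/
theorem integral_quadForm_sq_mul_quadForm (hA : A.IsSymm) (hA' : A.trace = 0) (hB : B.IsSymm)
    (hB' : B.trace = 0) :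
    ∫ x, quadForm A x * quadForm A x * quadForm B x ∂area
      = 32 * Real.pi / 105 * ∑ a, ∑ b, (∑ i, A i a * A i b) * B a b := by
  have cl := continuous_lin
  have cX := continuous_X
  have cq := continuous_quadForm
  have hg := fun a => (hasGrad_lin (A a)).mul ((hasGrad_quadForm hA).mul (hasGrad_quadForm hB))
  -- The divergence identity for `(AX)_a q_A q_B`, summed over `a`. Since `X·AX = q_A`, the unknown
  -- integral appears as `-5` copies on the left and `2` on the right, so the remaining moments are
  -- divided by seven.
  have h1 : ∫ x, ∑ a, ((A a a - lin (A a) x * X a x) * (quadForm A x * quadForm B x)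
      + lin (A a) x * (quadForm A x * (2 * (lin (B a) x - quadForm B x * X a x))
        + quadForm B x * (2 * (lin (A a) x - quadForm A x * X a x)))) ∂area
      = 2 * ∫ x, ∑ a, X a x * (lin (A a) x * (quadForm A x * quadForm B x)) ∂area := by
    rw [integral_finsetSum _ fun a _ => integrable_of_continuous (by fun_prop),
      integral_finsetSum _ fun a _ => integrable_of_continuous (by fun_prop), Finset.mul_sum]
    refine Finset.sum_congr rfl fun a _ => ?_
    rw [← (hg a).integral_eq]
    congr 1 with x
    ring
  have h2 : ∀ x, ∑ a, ((A a a - lin (A a) x * X a x) * (quadForm A x * quadForm B x)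
      + lin (A a) x * (quadForm A x * (2 * (lin (B a) x - quadForm B x * X a x))
        + quadForm B x * (2 * (lin (A a) x - quadForm A x * X a x))))
      = 2 * (∑ a, lin (A a) x * (lin (B a) x * quadForm A x))
        + 2 * (∑ a, lin (A a) x * (lin (A a) x * quadForm B x))
        - 5 * (quadForm A x * quadForm A x * quadForm B x) := by
    intro x
    have h := sum_X_mul_lin A x
    rw [Matrix.trace, Fin.sum_univ_three] at hA'
    simp only [Matrix.diag] at hA'
    simp only [Fin.sum_univ_three] at *
    linear_combination quadForm A x * quadForm B x * hA' - 5 * quadForm A x * quadForm B x * h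
  have h3 : ∀ x, ∑ a, X a x * (lin (A a) x * (quadForm A x * quadForm B x))
      = quadForm A x * quadForm A x * quadForm B x := by
    intro x
    simp only [← mul_assoc, ← Finset.sum_mul, sum_X_mul_lin]
  simp only [h2, h3] at h1
  rw [integral_sub (integrable_of_continuous (by fun_prop))
    (integrable_of_continuous (by fun_prop)), integral_add (integrable_of_continuous (by fun_prop))
    (integrable_of_continuous (by fun_prop)), integral_const_mul, integral_const_mul,
    integral_const_mul, integral_finsetSum _ fun a _ => integrable_of_continuous (by fun_prop),
    integral_finsetSum _ fun a _ => integrable_of_continuous (by fun_prop)] at h1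
  simp only [integral_lin_mul_lin_mul_quadForm hA hA', integral_lin_mul_lin_mul_quadForm hB hB']
    at h1
  have h4 : ∑ a, ∑ b, ∑ c, A b c * A a b * B a c = ∑ a, ∑ b, (∑ i, A i a * A i b) * B a b := by
    have h10 := hA.apply 0 1
    have h20 := hA.apply 0 2
    have h21 := hA.apply 1 2
    simp only [Fin.sum_univ_three, h10, h20, h21]
    ring
  have h5 : ∑ a, ∑ b, ∑ c, B b c * A a b * A a c = ∑ a, ∑ b, (∑ i, A i a * A i b) * B a b := by
    simp only [Fin.sum_univ_three]
    ring
  simp only [← Finset.mul_sum, h4, h5] at h1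
  linarith

theorem continuous_quadShear (A : Matrix (Fin 3) (Fin 3) ℝ) (a b : Fin 3) :
    Continuous fun x => quadShear A x a b := by
  have cl := continuous_lin
  have cX := continuous_X
  have cq := continuous_quadForm
  unfold quadShear
  fun_prop

theorem continuous_epsilon (a b : Fin 3) : Continuous fun x => epsilon x a b :=
  (hasGrad_epsilon a b).continuous

theorem continuous_dualShear (A : Matrix (Fin 3) (Fin 3) ℝ) (a b : Fin 3) :
    Continuous fun x => dualShear A x a b :=
  continuous_finsetSum _ fun e _ => (continuous_epsilon a e).mul (continuous_quadShear A e b)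

theorem integral_sum_lin_mul_lin (A B : Matrix (Fin 3) (Fin 3) ℝ) :
    ∫ x, ∑ a, lin (A a) x * lin (B a) x ∂area = 4 * Real.pi / 3 * ∑ a, ∑ b, A a b * B a b := by
  have cl := continuous_lin
  rw [integral_finsetSum _ fun a _ => integrable_of_continuous (by fun_prop), Finset.mul_sum]
  simp only [integral_lin_mul_lin]

theorem integral_quadForm (hA' : A.trace = 0) : ∫ x, quadForm A x ∂area = 0 := by
  have cl := continuous_lin
  have cX := continuous_X
  rw [quadForm_eq, integral_finsetSum _ fun a _ => integrable_of_continuous (by fun_prop)]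
  simp only [integral_X_mul_lin, ← Finset.mul_sum]
  exact mul_eq_zero_of_right _ hA'

theorem integral_inner2_quadShear (hA : A.IsSymm) (hA' : A.trace = 0) (hB : B.IsSymm)
    (hB' : B.trace = 0) :
    ∫ x, inner2 (quadShear A x) (quadShear B x) ∂area
      = 32 * Real.pi / 5 * ∑ a, ∑ b, A a b * B a b := by
  have cl := continuous_lin
  have cq := continuous_quadForm
  simp only [inner2_quadShear hA hA' hB hB']
  rw [integral_add (integrable_of_continuous (by fun_prop))
    (integrable_of_continuous (by fun_prop)), integral_sub (integrable_const _)
    (integrable_of_continuous (by fun_prop)), integral_const_area, integral_const_mul,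
    integral_const_mul, integral_sum_lin_mul_lin, integral_quadForm_mul_quadForm hB hB']
  ring

theorem integral_inner2_quadShear_mul_quadForm (hA : A.IsSymm) (hA' : A.trace = 0) (hB : B.IsSymm)
    (hB' : B.trace = 0) :
    ∫ x, inner2 (quadShear A x) (quadShear A x) * quadForm B x ∂area
      = -(128 * Real.pi / 35) * ∑ a, ∑ b, (∑ i, A i a * A i b) * B a b := by
  have cl := continuous_lin
  have cq := continuous_quadForm
  have h : ∀ x, inner2 (quadShear A x) (quadShear A x) * quadForm B x
      = 4 * (∑ a, ∑ b, A a b * A a b) * quadForm B x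
        - 8 * (∑ a, lin (A a) x * (lin (A a) x * quadForm B x))
        + 2 * (quadForm A x * quadForm A x * quadForm B x) := by
    intro x
    simp only [inner2_quadShear hA hA' hA hA', ← mul_assoc, ← Finset.sum_mul]
    ring
  simp only [h]
  rw [integral_add (integrable_of_continuous (by fun_prop))
    (integrable_of_continuous (by fun_prop)), integral_sub (integrable_of_continuous (by fun_prop))
    (integrable_of_continuous (by fun_prop)), integral_const_mul, integral_const_mul,
    integral_const_mul, integral_quadForm hB', integral_quadForm_sq_mul_quadForm hA hA' hB hB',
    integral_finsetSum _ fun a _ => integrable_of_continuous (by fun_prop)]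
  simp only [integral_lin_mul_lin_mul_quadForm hB hB', ← Finset.mul_sum]
  have h5 : ∑ a, ∑ b, ∑ c, B b c * A a b * A a c = ∑ a, ∑ b, (∑ i, A i a * A i b) * B a b := by
    simp only [Fin.sum_univ_three]
    ring
  rw [h5]
  ring

theorem integral_X_mul_inner2 (hA : A.IsSymm) (hB : B.IsSymm) (hB' : B.trace = 0) (k : Fin 3) :
    ∫ x, X k x * inner2 (quadShear A x) (dualShear B x) ∂area
      = 64 * Real.pi / 15 * epsContract A B k := by
  have cl := continuous_lin
  have cX := continuous_X
  have h : ∀ x, X k x * inner2 (quadShear A x) (dualShear B x)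
      = ∑ a, ∑ e, (4 * (∑ b, A a b * B e b) * (X k x * lin (leviCivita a e) x)
        - 4 * (X k x * (lin (leviCivita a e) x * (lin (A a) x * lin (B e) x)))) := by
    intro x
    rw [inner2_quadShear_dualShear hA hB hB', ← mul_assoc, Finset.mul_sum]
    refine Finset.sum_congr rfl fun a _ => ?_
    rw [Finset.mul_sum]
    refine Finset.sum_congr rfl fun e _ => ?_
    rw [show epsilon x a e = lin (leviCivita a e) x from rfl]
    ring
  have h1 : ∀ a e, ∫ x, (4 * (∑ b, A a b * B e b) * (X k x * lin (leviCivita a e) x)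
        - 4 * (X k x * (lin (leviCivita a e) x * (lin (A a) x * lin (B e) x)))) ∂area
      = 4 * (∑ b, A a b * B e b) * (4 * Real.pi / 3 * leviCivita a e k)
        - 4 * (4 * Real.pi / 15 * (leviCivita a e k * (∑ b, A a b * B e b)
          + A a k * (∑ b, leviCivita a e b * B e b) +
            B e k * (∑ b, leviCivita a e b * A a b))) := by
    intro a e
    rw [integral_sub (integrable_of_continuous (by fun_prop))
      (integrable_of_continuous (by fun_prop)), integral_const_mul, integral_const_mul,
      integral_X_mul_lin, integral_X_mul_lin_mul_lin_mul_lin]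
  simp only [h]
  rw [integral_finsetSum _ fun a _ => integrable_of_continuous (by fun_prop)]
  have h2 : ∀ a, ∫ x, ∑ e, (4 * (∑ b, A a b * B e b) * (X k x * lin (leviCivita a e) x)
        - 4 * (X k x * (lin (leviCivita a e) x * (lin (A a) x * lin (B e) x)))) ∂area = _ :=
    fun a => integral_finsetSum _ fun e _ => integrable_of_continuous (by fun_prop)
  simp only [h2, h1]
  have h10 := hA.apply 0 1
  have h20 := hA.apply 0 2
  have h21 := hA.apply 1 2
  have k10 := hB.apply 0 1
  have k20 := hB.apply 0 2
  have k21 := hB.apply 1 2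
  fin_cases k <;>
    simp [epsContract, leviCivita, Fin.sum_univ_three, h10, h20, h21, k10, k20, k21] <;> ring

/-- `ε` annihilates the terms of `quadShear` with `X` in the first slot, and `X·BX = q_B` in the
second; what remains has known moments. -/
theorem sum_dualShear_mul_lin (A B : Matrix (Fin 3) (Fin 3) ℝ) (x : S2) (k : Fin 3) :
    ∑ b, dualShear A x k b * lin (B b) x = ∑ a, (2 * (lin (leviCivita k a) x
        * lin (fun c => ∑ b, A a b * B b c) x)
      - 2 * (lin (leviCivita k a) x * (lin (A a) x * quadForm B x))
      + lin (leviCivita k a) x * (lin (B a) x * quadForm A x)) := by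
  fin_cases k <;>
    simp [dualShear, quadShear, epsilon, lin, leviCivita, Fin.sum_univ_three, delta,
      quadForm_eq B] <;> ring

theorem integral_dualShear_mul_lin (hA : A.IsSymm) (hA' : A.trace = 0) (hB : B.IsSymm)
    (hB' : B.trace = 0) (k : Fin 3) :
    ∫ x, ∑ b, dualShear A x k b * lin (B b) x ∂area = 16 * Real.pi / 15 * epsContract A B k := by
  have cl := continuous_lin
  have cq := continuous_quadForm
  simp only [sum_dualShear_mul_lin]
  rw [integral_finsetSum _ fun a _ => integrable_of_continuous (by fun_prop)]
  have h1 : ∀ a, ∫ x, (2 * (lin (leviCivita k a) x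
        * lin (fun c => ∑ b, A a b * B b c) x)
      - 2 * (lin (leviCivita k a) x * (lin (A a) x * quadForm B x))
      + lin (leviCivita k a) x * (lin (B a) x * quadForm A x)) ∂area
      = 2 * (4 * Real.pi / 3 * ∑ c, leviCivita k a c * ∑ b, A a b * B b c)
        - 2 * (8 * Real.pi / 15 * ∑ c, ∑ b, B c b * leviCivita k a c * A a b)
        + 8 * Real.pi / 15 * ∑ c, ∑ b, A c b * leviCivita k a c * B a b := by
    intro a
    rw [integral_add (integrable_of_continuous (by fun_prop))
      (integrable_of_continuous (by fun_prop)), integral_sub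
      (integrable_of_continuous (by fun_prop)) (integrable_of_continuous (by fun_prop)),
      integral_const_mul, integral_const_mul, integral_lin_mul_lin,
      integral_lin_mul_lin_mul_quadForm hB hB', integral_lin_mul_lin_mul_quadForm hA hA']
  simp only [h1]
  have h10 := hA.apply 0 1
  have h20 := hA.apply 0 2
  have h21 := hA.apply 1 2
  have k10 := hB.apply 0 1
  have k20 := hB.apply 0 2
  have k21 := hB.apply 1 2
  fin_cases k <;>
    simp [epsContract, leviCivita, Fin.sum_univ_three, h10, h20, h21, k10, k20, k21] <;> ring

/-- Transposing `AB` gives `BA` for symmetric matrices, and `ε^{ipk}` changes sign under the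
exchange of `i` and `p`. -/
theorem epsContract_swap (hA : A.IsSymm) (hB : B.IsSymm) (k : Fin 3) :
    epsContract A B k = - epsContract B A k := by
  have h10 := hA.apply 0 1
  have h20 := hA.apply 0 2
  have h21 := hA.apply 1 2
  have k10 := hB.apply 0 1
  have k20 := hB.apply 0 2
  have k21 := hB.apply 1 2
  simp only [epsContract, leviCivita, Fin.sum_univ_three, h10, h20, h21, k10, k20, k21]
  ring

end

section

/-! ### Differentiation under the integral sign -/

variable {I : Set ℝ}

theorem JointlySmooth.smooth {f : ℝ → S2 → ℝ} (hf : JointlySmooth I f) {u : ℝ} (hu : u ∈ I) :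
    SmoothOnSphere (f u) := by
  have h : ContDiffOn ℝ ∞ (fun y : E3 => ((u, y) : ℝ × E3)) {0}ᶜ := by fun_prop
  exact ContDiffOn.comp (g := fun p : ℝ × E3 => radialExt (f p.1) p.2) hf h fun y hy => ⟨hu, hy⟩

theorem JointlySmooth.apply {f : ℝ → S2 → Fin 3 → ℝ} (hf : JointlySmooth I f) (a : Fin 3) :
    JointlySmooth I fun t x => f t x a := by
  have h := contDiffOn_pi.1 hf a
  have h' : (fun p : ℝ × E3 => radialExt (fun x => f p.1 x a) p.2)
      = fun p => radialExt (f p.1) p.2 a := by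
    ext p
    by_cases hp : p.2 = 0 <;> simp [radialExt, hp]
  rw [JointlySmooth, h']
  exact h

theorem uniqueDiffOn_of_ordConnected (hI : I.OrdConnected) (hI' : I.Nontrivial) :
    UniqueDiffOn ℝ I := by
  refine uniqueDiffOn_convex hI.convex ?_
  -- The midpoint of two points of `I` is interior, and a convex set with nonempty interior has
  -- unique derivatives, end points included.
  obtain ⟨a, ha, b, hb, hab⟩ := hI'.exists_lt
  exact ⟨(a + b) / 2, mem_interior_iff_mem_nhds.2 (Filter.mem_of_superset
    (Icc_mem_nhds (by linarith) (by linarith)) (hI.out ha hb))⟩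

/-- Joint continuity of `∂_u f` is what the domination below needs. Taking the derivative within `I
× (ℝ³ ∖ {0})` covers end points of `I`. -/
theorem JointlySmooth.exists_continuous_deriv (hI : I.OrdConnected) (hI' : I.Nontrivial)
    {f : ℝ → S2 → ℝ} (hf : JointlySmooth I f) :
    ∃ g : ℝ → S2 → ℝ, Continuous (fun p : I × S2 => g p.1 p.2) ∧
      ∀ t ∈ I, ∀ x, HasDerivWithinAt (fun t => f t x) (g t x) I t := by
  have hu : UniqueDiffOn ℝ (I ×ˢ ({0}ᶜ : Set E3)) :=
    (uniqueDiffOn_of_ordConnected hI hI').prod isOpen_compl_singleton.uniqueDiffOn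
  refine ⟨fun t x => fderivWithin ℝ (fun p : ℝ × E3 => radialExt (f p.1) p.2)
    (I ×ˢ ({0}ᶜ : Set E3)) (t, (x : E3)) (1, 0), ?_, fun t ht x => ?_⟩
  · have h := (hf.continuousOn_fderivWithin hu (by simp)).comp_continuous
      (f := fun p : I × S2 => ((p.1 : ℝ), (p.2 : E3))) (by fun_prop)
      (fun p => mk_mem_prod p.1.2 (coe_S2_mem p.2))
    exact h.clm_apply continuous_const
  · have h1 := ((hf.differentiableOn (by simp)) (t, (x : E3)) ⟨ht, coe_S2_mem x⟩).hasFDerivWithinAt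
    have h2 : HasDerivWithinAt (fun t : ℝ => (t, (x : E3))) (1, 0) I t :=
      (hasDerivWithinAt_id t I).prodMk (hasDerivWithinAt_const t I (x : E3))
    have h3 := h1.comp_hasDerivWithinAt t h2 (fun s hs => mk_mem_prod hs (coe_S2_mem x))
    have h4 : ((fun p : ℝ × E3 => radialExt (f p.1) p.2) ∘ fun t : ℝ => (t, (x : E3)))
        = fun t => f t x := by
      ext s; exact radialExt_coe (f s) x
    rwa [h4] at h3

/-- Dominated convergence for difference quotients within `I`. The dominating constant comes from
compactness of the sphere and the mean value inequality. -/
theorem hasDerivWithinAt_integral (hI : I.OrdConnected) (hI' : I.Nontrivial) {f : ℝ → S2 → ℝ}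
    (hf : JointlySmooth I f) {φ : S2 → ℝ} (hφ : Continuous φ) {u : ℝ} (hu : u ∈ I) {f' : S2 → ℝ}
    (hd : ∀ x, HasDerivWithinAt (fun t => f t x) (f' x) I u) :
    HasDerivWithinAt (fun t => ∫ x, φ x * f t x ∂area) (∫ x, φ x * f' x ∂area) I u := by
  obtain ⟨g, hgc, hgd⟩ := hf.exists_continuous_deriv hI hI'
  have hc : ∀ t ∈ I, Continuous (f t) := fun t ht => (hf.smooth ht).continuous
  have hgu : Continuous (g u) := hgc.comp (f := fun x : S2 => ((⟨u, hu⟩ : I), x)) (by fun_prop)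
  obtain ⟨M, hM⟩ := isCompact_univ.exists_bound_of_continuousOn hgu.continuousOn
  -- A bound `M` at time `u` persists as `M + 1`, uniformly on the compact sphere, for nearby times
  -- in `I`.
  have hev : ∀ᶠ t : I in nhds ⟨u, hu⟩, ∀ x ∈ (univ : Set S2), ‖g t x‖ < M + 1 := by
    refine isCompact_univ.eventually_forall_of_forall_eventually fun x hx => ?_
    have : ‖g ((⟨u, hu⟩ : I), x).1 x‖ < M + 1 := lt_of_le_of_lt (hM x hx) (lt_add_one M)
    exact hgc.norm.continuousAt.eventually (gt_mem_nhds this)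
  rw [nhds_subtype_eq_comap, Filter.eventually_comap] at hev
  obtain ⟨ε, hε, hball⟩ := Metric.eventually_nhds_iff_ball.1 hev
  have hconv : Convex ℝ (I ∩ Metric.ball u ε) := hI.convex.inter (convex_ball u ε)
  have hlip : ∀ t ∈ I ∩ Metric.ball u ε, ∀ x, ‖f t x - f u x‖ ≤ (M + 1) * ‖t - u‖ := by
    intro t ht x
    refine hconv.norm_image_sub_le_of_norm_hasDerivWithin_le (f := fun t => f t x)
      (f' := fun t => g t x)
      (fun s hs => (hgd s hs.1 x).mono inter_subset_left) (fun s hs => ?_)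
      ⟨hu, Metric.mem_ball_self hε⟩ ht
    exact (hball s hs.2 ⟨s, hs.1⟩ rfl x (mem_univ x)).le
  rw [hasDerivWithinAt_iff_tendsto_slope]
  have hmem : I ∩ Metric.ball u ε ∈ nhdsWithin u (I \ {u}) :=
    Filter.inter_mem (Filter.mem_of_superset self_mem_nhdsWithin sdiff_subset)
      (mem_nhdsWithin_of_mem_nhds (Metric.ball_mem_nhds u hε))
  have hne : ∀ᶠ t in nhdsWithin u (I \ {u}), t ≠ u := by
    filter_upwards [self_mem_nhdsWithin] with t ht using ht.2
  have hslope : ∀ᶠ t in nhdsWithin u (I \ {u}),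
      ∫ x, φ x * slope (fun t => f t x) u t ∂area
        = slope (fun t => ∫ x, φ x * f t x ∂area) u t := by
    filter_upwards [hmem] with t ht
    simp only [slope, vsub_eq_sub, smul_eq_mul]
    have i1 : Integrable (fun x => φ x * f t x) area :=
      integrable_of_continuous (hφ.mul (hc t ht.1))
    have i2 : Integrable (fun x => φ x * f u x) area := integrable_of_continuous (hφ.mul (hc u hu))
    rw [← integral_sub i1 i2, ← integral_const_mul]
    congr 1 with x
    ring
  refine Filter.Tendsto.congr' hslope ?_
  refine tendsto_integral_filter_of_dominated_convergence (fun x => ‖φ x‖ * (M + 1)) ?_ ?_ ?_ ?_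
  · filter_upwards [hmem] with t ht
    have : Continuous fun x => φ x * slope (fun t => f t x) u t := by
      simp only [slope, vsub_eq_sub, smul_eq_mul]
      have := hc t ht.1
      have := hc u hu
      fun_prop
    exact this.aestronglyMeasurable
  · filter_upwards [hmem, hne] with t ht htu
    refine Filter.Eventually.of_forall fun x => ?_
    rw [norm_mul]
    refine mul_le_mul_of_nonneg_left ?_ (norm_nonneg _)
    simp only [slope, vsub_eq_sub, smul_eq_mul, norm_mul, norm_inv]
    rw [inv_mul_le_iff₀ (norm_pos_iff.2 (sub_ne_zero.2 htu)), mul_comm]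
    exact hlip t ht x
  · exact integrable_of_continuous (hφ.norm.mul continuous_const)
  · exact Filter.Eventually.of_forall fun x =>
      (hasDerivWithinAt_iff_tendsto_slope.1 (hd x)).const_mul (φ x)

end

section

/-! ### Moments of quadrupole shear tensors -/

/-- The parity device used throughout: `f - g` is odd. In practice `g` retains the terms with an
even number of odd factors among `X`, `ε`, linear functions and `ε K`. -/
theorem integral_eq_of_even_part {f g : S2 → ℝ} (hf : Continuous f)
    (h : ∀ x, f x + f (-x) = 2 * g x) : ∫ x, f x ∂area = ∫ x, g x ∂area := by
  have hg : g = fun x => (f x + f (-x)) / 2 := by ext x; rw [h]; ring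
  have hgc : Continuous g := by
    rw [hg]
    exact (hf.add (hf.comp continuous_neg)).div_const 2
  have h1 : ∫ x, (f x - g x) ∂area = 0 := by
    refine integral_eq_zero_of_odd fun x => ?_
    have h2 := h (-x)
    rw [neg_neg] at h2
    linarith [h x]
  rw [integral_sub (integrable_of_continuous hf) (integrable_of_continuous hgc)] at h1
  linarith

variable {A B A' B' : Matrix (Fin 3) (Fin 3) ℝ}

theorem continuous_inner2 {S T : S2 → Fin 3 → Fin 3 → ℝ} (hS : ∀ a b, Continuous fun x => S x a b)
    (hT : ∀ a b, Continuous fun x => T x a b) : Continuous fun x => inner2 (S x) (T x) :=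
  continuous_finsetSum _ fun a _ => continuous_finsetSum _ fun b _ => (hS a b).mul (hT a b)

theorem continuous_shearField (A B : Matrix (Fin 3) (Fin 3) ℝ) (a b : Fin 3) :
    Continuous fun x => shearField A B x a b :=
  (continuous_quadShear A a b).add (continuous_dualShear B a b)

theorem shearField_symm (hA : A.IsSymm) (hB : B.IsSymm) (hB0 : B.trace = 0) (x : S2)
    (a b : Fin 3) : shearField A B x a b = shearField A B x b a := by
  rw [shearField, shearField, quadShear_symm hA, dualShear_symm hB hB0]

theorem sum_X_mul_shearField (hA : A.IsSymm) (x : S2) (b : Fin 3) :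
    ∑ a, X a x * shearField A B x a b = 0 := by
  simp only [shearField, mul_add, Finset.sum_add_distrib, sum_X_mul_quadShear hA,
    sum_X_mul_dualShear, add_zero]

theorem inner2_shearField (hB' : B'.IsSymm) (x : S2) :
    inner2 (shearField A B x) (shearField A' B' x) = inner2 (quadShear A x) (quadShear A' x)
      + inner2 (quadShear B x) (quadShear B' x)
      + (inner2 (quadShear A x) (dualShear B' x) + inner2 (quadShear A' x) (dualShear B x)) := by
  rw [← inner2_dualShear hB', inner2_comm (quadShear A' x)]
  simp only [inner2, shearField, ← Finset.sum_add_distrib]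
  exact Finset.sum_congr rfl fun a _ => Finset.sum_congr rfl fun b _ => by ring

theorem inner2_dualShear_neg (S : Fin 3 → Fin 3 → ℝ) (B : Matrix (Fin 3) (Fin 3) ℝ) (x : S2) :
    inner2 S (dualShear B (-x)) = - inner2 S (dualShear B x) := by
  simp only [inner2, dualShear_neg, mul_neg, Finset.sum_neg_distrib]

theorem sqNorm_eq (A : Matrix (Fin 3) (Fin 3) ℝ) : sqNorm A = ∑ a, ∑ b, A a b * A a b := by
  simp only [sqNorm, sq]

theorem integral_inner2_shearField (hA : A.IsSymm) (hA0 : A.trace = 0) (hB : B.IsSymm)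
    (hB0 : B.trace = 0) :
    ∫ x, inner2 (shearField A B x) (shearField A B x) ∂area
      = 32 * Real.pi / 5 * (sqNorm A + sqNorm B) := by
  have cK : ∀ A : Matrix (Fin 3) (Fin 3) ℝ,
      Continuous fun x => inner2 (quadShear A x) (quadShear A x) := fun A =>
    continuous_inner2 (continuous_quadShear A) (continuous_quadShear A)
  rw [integral_eq_of_even_part (g := fun x => inner2 (quadShear A x) (quadShear A x)
      + inner2 (quadShear B x) (quadShear B x))
    (continuous_inner2 (continuous_shearField A B) (continuous_shearField A B)) (fun x => by
      simp only [inner2_shearField hB, inner2_dualShear_neg, quadShear_neg]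
      ring), integral_add (integrable_of_continuous (cK A)) (integrable_of_continuous (cK B)),
    integral_inner2_quadShear hA hA0 hA hA0, integral_inner2_quadShear hB hB0 hB hB0,
    sqNorm_eq, sqNorm_eq]
  ring

theorem integral_inner2_shearField_mul_quadForm (hA : A.IsSymm) (hA0 : A.trace = 0)
    (hB : B.IsSymm) (hB0 : B.trace = 0) (hB' : B'.IsSymm) (hB0' : B'.trace = 0) :
    ∫ x, inner2 (shearField A B x) (shearField A B x) * quadForm B' x ∂area
      = -(128 * Real.pi / 35) *
        ∑ a, ∑ b, (∑ i, (A i a * A i b + B i a * B i b)) * B' a b := by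
  have cq := continuous_quadForm B'
  have cK : ∀ A : Matrix (Fin 3) (Fin 3) ℝ,
      Continuous fun x => inner2 (quadShear A x) (quadShear A x) * quadForm B' x := fun A =>
    (continuous_inner2 (continuous_quadShear A) (continuous_quadShear A)).mul cq
  have cf : Continuous fun x =>
      inner2 (shearField A B x) (shearField A B x) * quadForm B' x :=
    (continuous_inner2 (continuous_shearField A B) (continuous_shearField A B)).mul cq
  rw [integral_eq_of_even_part (g := fun x => inner2 (quadShear A x) (quadShear A x) * quadForm B' x
      + inner2 (quadShear B x) (quadShear B x) * quadForm B' x)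
    cf (fun x => by
      simp only [inner2_shearField hB, inner2_dualShear_neg, quadShear_neg, quadForm_neg]
      ring), integral_add (integrable_of_continuous (cK A)) (integrable_of_continuous (cK B)),
    integral_inner2_quadShear_mul_quadForm hA hA0 hB' hB0',
    integral_inner2_quadShear_mul_quadForm hB hB0 hB' hB0', ← mul_add, ← Finset.sum_add_distrib]
  simp only [← Finset.sum_add_distrib, ← add_mul]

theorem integral_X_mul_inner2_shearField (hA : A.IsSymm) (hB : B.IsSymm)
    (hB0 : B.trace = 0) (hA' : A'.IsSymm) (hB' : B'.IsSymm)
    (hB0' : B'.trace = 0) (k : Fin 3) :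
    ∫ x, X k x * inner2 (shearField A B x) (shearField A' B' x) ∂area
      = 64 * Real.pi / 15 * (epsContract A B' k + epsContract A' B k) := by
  have cX := continuous_X k
  have cK : ∀ A B : Matrix (Fin 3) (Fin 3) ℝ,
      Continuous fun x => X k x * inner2 (quadShear A x) (dualShear B x) := fun A B =>
    cX.mul (continuous_inner2 (continuous_quadShear A) (continuous_dualShear B))
  have cf : Continuous fun x =>
      X k x * inner2 (shearField A B x) (shearField A' B' x) :=
    cX.mul (continuous_inner2 (continuous_shearField A B) (continuous_shearField A' B'))
  rw [integral_eq_of_even_part (g := fun x => X k x * inner2 (quadShear A x) (dualShear B' x)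
      + X k x * inner2 (quadShear A' x) (dualShear B x))
    cf (fun x => by
      simp only [inner2_shearField hB', inner2_dualShear_neg, quadShear_neg, X_neg]
      ring), integral_add (integrable_of_continuous (cK A B')) (integrable_of_continuous (cK A' B)),
    integral_X_mul_inner2 hA hB' hB0', integral_X_mul_inner2 hA' hB hB0]
  ring

theorem continuous_dualShear_mul_lin (A B : Matrix (Fin 3) (Fin 3) ℝ) (k : Fin 3) :
    Continuous fun x => ∑ b, dualShear A x k b * lin (B b) x :=
  continuous_finsetSum _ fun b _ => (continuous_dualShear A k b).mul (continuous_lin _)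

theorem continuous_shearFieldDiv (A B : Matrix (Fin 3) (Fin 3) ℝ) (b : Fin 3) :
    Continuous fun x => shearFieldDiv A B x b := by
  have cl := continuous_lin
  have cX := continuous_X
  have cq := continuous_quadForm
  have ce := continuous_epsilon
  unfold shearFieldDiv
  fun_prop

theorem continuous_shearField_mul_div (A B A' B' : Matrix (Fin 3) (Fin 3) ℝ) (a : Fin 3) :
    Continuous fun x => ∑ b, shearField A B x a b * shearFieldDiv A' B' x b :=
  continuous_finsetSum _ fun b _ => (continuous_shearField A B a b).mul
    (continuous_shearFieldDiv A' B' b)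

theorem continuous_sigma (a b : Fin 3) : Continuous fun x => sigma x a b := by
  have cX := continuous_X
  unfold sigma
  fun_prop

theorem sum_X_mul_sum_shearField_mul_div (hA : A.IsSymm) (x : S2) :
    ∑ a, X a x * ∑ b, shearField A B x a b * shearFieldDiv A' B' x b = 0 := by
  simp only [Finset.mul_sum]
  rw [Finset.sum_comm]
  simp only [← mul_assoc, ← Finset.sum_mul, sum_X_mul_shearField hA, zero_mul,
    Finset.sum_const_zero]

theorem integral_boost_shear_div (hA : A.IsSymm) (hA0 : A.trace = 0) (hB : B.IsSymm)
    (hB0 : B.trace = 0) (hA' : A'.IsSymm) (hA0' : A'.trace = 0) (hB' : B'.IsSymm)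
    (hB0' : B'.trace = 0) (k : Fin 3) :
    ∫ x, ∑ a, sigma x a k * ∑ b, shearField A B x a b * shearFieldDiv A' B' x b ∂area
      = 64 * Real.pi / 15 * (epsContract A B' k - epsContract B A' k) := by
  have h1 : ∀ x, ∑ a, sigma x a k * ∑ b, shearField A B x a b * shearFieldDiv A' B' x b
      = ∑ b, shearField A B x k b * shearFieldDiv A' B' x b := fun x =>
    sum_sigma_mul_of_tangent (sum_X_mul_sum_shearField_mul_div hA x) k
  simp only [h1]
  rw [integral_eq_of_even_part (g := fun x => 4 * (∑ b, dualShear A x k b * lin (B' b) x)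
      - 4 * ∑ b, dualShear B x k b * lin (A' b) x) (continuous_shearField_mul_div A B A' B' k)
    (fun x => by
      simp only [sum_shearField_mul_div hA hA0 hB hB0, dualShear_neg, quadShear_neg, lin_neg,
        Fin.sum_univ_three]
      ring), integral_sub
      (integrable_of_continuous ((continuous_dualShear_mul_lin A B' k).const_mul 4))
      (integrable_of_continuous ((continuous_dualShear_mul_lin B A' k).const_mul 4)),
    integral_const_mul, integral_const_mul, integral_dualShear_mul_lin hA hA0 hB' hB0',
    integral_dualShear_mul_lin hB hB0 hA' hA0']
  ring

theorem integral_rotation_shear_div (hA : A.IsSymm) (hA0 : A.trace = 0) (hB : B.IsSymm)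
    (hB0 : B.trace = 0) (hA' : A'.IsSymm) (hA0' : A'.trace = 0) (hB' : B'.IsSymm)
    (hB0' : B'.trace = 0) (k : Fin 3) :
    ∫ x, ∑ a, epsilon x a k * ∑ b, shearField A B x a b * shearFieldDiv A' B' x b ∂area
      = 64 * Real.pi / 15 * (epsContract A A' k + epsContract B B' k) := by
  have hd : ∀ (B : Matrix (Fin 3) (Fin 3) ℝ) (x : S2) (b : Fin 3),
      ∑ a, epsilon x a k * quadShear B x a b = - dualShear B x k b := by
    intro B x b
    rw [dualShear, ← Finset.sum_neg_distrib]
    refine Finset.sum_congr rfl fun a _ => ?_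
    rw [epsilon_antisymm]; ring
  have hc : Continuous fun x =>
      ∑ a, epsilon x a k * ∑ b, shearField A B x a b * shearFieldDiv A' B' x b :=
    continuous_finsetSum _ fun a _ => (continuous_epsilon a k).mul
      (continuous_shearField_mul_div A B A' B' a)
  rw [integral_eq_of_even_part (g := fun x => 4 * (∑ b, dualShear A x k b * lin (A' b) x)
      + 4 * ∑ b, dualShear B x k b * lin (B' b) x) hc
    (fun x => by
      have h1 := hd A x
      have h2 := hd B x
      simp only [sum_shearField_mul_div hA hA0 hB hB0, dualShear_neg, quadShear_neg, lin_neg,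
        epsilon_neg, Fin.sum_univ_three] at h1 h2 ⊢
      linear_combination -8 * (lin (A' 0) x * h1 0 + lin (A' 1) x * h1 1 + lin (A' 2) x * h1 2)
        - 8 * (lin (B' 0) x * h2 0 + lin (B' 1) x * h2 1 + lin (B' 2) x * h2 2)), integral_add
      (integrable_of_continuous ((continuous_dualShear_mul_lin A A' k).const_mul 4))
      (integrable_of_continuous ((continuous_dualShear_mul_lin B B' k).const_mul 4)),
    integral_const_mul, integral_const_mul, integral_dualShear_mul_lin hA hA0 hA' hA0',
    integral_dualShear_mul_lin hB hB0 hB' hB0']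
  ring

end

section

/-! ### The evolution of the angular momentum aspect -/

variable {A B A' B' : Matrix (Fin 3) (Fin 3) ℝ}

/-- The right-hand side of the evolution equation of the angular momentum aspect, for the mass
aspect `m`, the shear `shearField A B` and the news `shearField A' B'`. -/
def aspectRate (m : S2 → ℝ) (A B A' B' : Matrix (Fin 3) (Fin 3) ℝ) (x : S2) (a : Fin 3) : ℝ :=
  grad m x a
    - 1 / 4 * div2 (fun y d e => covDeriv1 (shearFieldDiv A B) y d e
        - covDeriv1 (shearFieldDiv A B) y e d) x a
    + 1 / 4 * grad (fun y => inner2 (shearField A B y) (shearField A' B' y)) x a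
    - 1 / 4 * div2 (fun y b e => ∑ d, shearField A B y b d * shearField A' B' y d e) x a
    + 1 / 2 * ∑ b, shearField A B x a b * shearFieldDiv A' B' x b

theorem exists_hasGrad_shearField (hA : A.IsSymm) (hB : B.IsSymm) :
    ∃ T' : Fin 3 → Fin 3 → S2 → Fin 3 → ℝ,
      ∀ a b, HasGrad (fun x => shearField A B x a b) (T' a b) :=
  ⟨_, fun a b => (hasGrad_quadShear hA a b).add (hasGrad_dualShear hB a b)⟩

theorem continuous_div2 {T : S2 → Fin 3 → Fin 3 → ℝ} {T' : Fin 3 → Fin 3 → S2 → Fin 3 → ℝ}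
    (hT : ∀ a b, HasGrad (fun x => T x a b) (T' a b)) (b : Fin 3) :
    Continuous fun x => div2 T x b := by
  simp only [div2_eq hT]
  exact continuous_finsetSum _ fun c _ => (continuous_sigma b c).mul
    (continuous_finsetSum _ fun a _ => (hT a c).continuous_grad a)

/-- The closed potential contributes a Hessian, which is symmetric; only the co-closed potential has
a curl. -/
theorem covDeriv1_shearFieldDiv_sub (hA : A.IsSymm) (hB : B.IsSymm) (hB0 : B.trace = 0) (x : S2)
    (a b : Fin 3) :
    covDeriv1 (shearFieldDiv A B) x a b - covDeriv1 (shearFieldDiv A B) x b a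
      = -12 * (quadForm B x * epsilon x a b) := by
  rw [covDeriv1_shearFieldDiv hA hB, covDeriv1_shearFieldDiv hA hB, quadShear_symm hA x a b,
    dualShear_symm hB hB0 x a b, sigma_symm x a b, epsilon_antisymm x b a]
  ring

theorem integral_five {f₁ f₂ f₃ f₄ f₅ : S2 → ℝ} (h₁ : Continuous f₁) (h₂ : Continuous f₂)
    (h₃ : Continuous f₃) (h₄ : Continuous f₄) (h₅ : Continuous f₅) :
    ∫ x, (f₁ x - 1 / 4 * f₂ x + 1 / 4 * f₃ x - 1 / 4 * f₄ x + 1 / 2 * f₅ x) ∂area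
      = (∫ x, f₁ x ∂area) - 1 / 4 * (∫ x, f₂ x ∂area) + 1 / 4 * (∫ x, f₃ x ∂area)
        - 1 / 4 * (∫ x, f₄ x ∂area) + 1 / 2 * ∫ x, f₅ x ∂area := by
  rw [integral_add (integrable_of_continuous (by fun_prop))
    (integrable_of_continuous (by fun_prop)), integral_sub (integrable_of_continuous (by fun_prop))
    (integrable_of_continuous (by fun_prop)), integral_add (integrable_of_continuous (by fun_prop))
    (integrable_of_continuous (by fun_prop)), integral_sub (integrable_of_continuous (by fun_prop))
    (integrable_of_continuous (by fun_prop)), integral_const_mul, integral_const_mul,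
    integral_const_mul, integral_const_mul]

/-- Moments of `aspectRate` against a tangential vector field. -/
theorem integral_sum_mul_aspectRate {m : S2 → ℝ} (hm : SmoothOnSphere m) (hA : A.IsSymm)
    (hB : B.IsSymm) (hB0 : B.trace = 0) (hA' : A'.IsSymm) (hB' : B'.IsSymm)
    {V : S2 → Fin 3 → ℝ} {V' : Fin 3 → S2 → Fin 3 → ℝ} (hV : ∀ a, HasGrad (fun x => V x a) (V' a))
    (ht : ∀ x, ∑ a, X a x * V x a = 0) :
    ∫ x, ∑ a, V x a * aspectRate m A B A' B' x a ∂area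
      = - (∫ x, m x * ∑ a, V' a x a ∂area)
        - 3 * (∫ x, ∑ b, ∑ a, V' b x a * (quadForm B x * epsilon x a b) ∂area)
        - 1 / 4 * (∫ x, inner2 (shearField A B x) (shearField A' B' x) * ∑ a, V' a x a ∂area)
        + 1 / 4 * (∫ x, ∑ b, ∑ a, V' b x a *
            ∑ d, shearField A B x a d * shearField A' B' x d b ∂area)
        + 1 / 2 * ∫ x, ∑ a, V x a * ∑ b, shearField A B x a b * shearFieldDiv A' B' x b ∂area := by
  obtain ⟨S, hS⟩ := exists_hasGrad_shearField hA hB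
  obtain ⟨S', hS'⟩ := exists_hasGrad_shearField hA' hB'
  have hmg := HasGrad.of_smooth hm
  have hW : ∀ a b, HasGrad (fun x => -12 * (quadForm B x * epsilon x a b)) _ := fun a b =>
    ((hasGrad_quadForm hB).mul (hasGrad_epsilon a b)).const_mul (-12)
  have hI : HasGrad (fun x => inner2 (shearField A B x) (shearField A' B' x)) _ :=
    HasGrad.sum Finset.univ fun a _ => HasGrad.sum Finset.univ fun b _ => (hS a b).mul (hS' a b)
  have hT : ∀ a b, HasGrad (fun x => ∑ d, shearField A B x a d * shearField A' B' x d b) _ :=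
    fun a b => HasGrad.sum Finset.univ fun d _ => (hS a d).mul (hS' d b)
  -- Each derivative term of the rate is moved onto `V`. The curl term gets its coefficient from `-¼
  -- · 12 = -3`.
  have h1 := integral_sum_mul_grad hmg hV ht
  have h2 := integral_sum_mul_div2 (T := fun x a b => -12 * (quadForm B x * epsilon x a b)) hW hV
    (fun x b => by
      simp only [mul_left_comm (X _ x), ← Finset.mul_sum, sum_X_mul_epsilon, mul_zero]) ht
  have h3 := integral_sum_mul_grad (HasGrad.of_smooth hI.smooth) hV ht
  have h4 := integral_sum_mul_div2
    (T := fun x a b => ∑ d, shearField A B x a d * shearField A' B' x d b) hT hV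
    (fun x b => by
      simp only [Finset.mul_sum]
      rw [Finset.sum_comm]
      simp only [← mul_assoc, ← Finset.sum_mul, sum_X_mul_shearField hA, zero_mul,
        Finset.sum_const_zero]) ht
  have hV0 := fun a => (hV a).continuous
  have hsplit : ∀ x, ∑ a, V x a * aspectRate m A B A' B' x a = ∑ a, V x a * grad m x a
      - 1 / 4 * (∑ a, V x a * div2 (fun x a b => -12 * (quadForm B x * epsilon x a b)) x a)
      + 1 / 4 * (∑ a, V x a * grad (fun y => inner2 (shearField A B y) (shearField A' B' y)) x a)
      - 1 / 4 * (∑ a, V x a *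
          div2 (fun x a b => ∑ d, shearField A B x a d * shearField A' B' x d b) x a)
      + 1 / 2 * ∑ a, V x a * ∑ b, shearField A B x a b * shearFieldDiv A' B' x b := by
    intro x
    simp only [aspectRate, covDeriv1_shearFieldDiv_sub hA hB hB0, Finset.mul_sum,
      ← Finset.sum_sub_distrib, ← Finset.sum_add_distrib]
    refine Finset.sum_congr rfl fun a _ => ?_
    simp only [← Finset.mul_sum]
    ring
  have c1 : Continuous fun x => ∑ a, V x a * grad m x a :=
    continuous_finsetSum _ fun a _ => (hV0 a).mul (hmg.continuous_grad a)
  have c2 : Continuous fun x =>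
      ∑ a, V x a * div2 (fun x a b => -12 * (quadForm B x * epsilon x a b)) x a :=
    continuous_finsetSum _ fun a _ => (hV0 a).mul (continuous_div2 hW a)
  have c3 : Continuous fun x =>
      ∑ a, V x a * grad (fun y => inner2 (shearField A B y) (shearField A' B' y)) x a :=
    continuous_finsetSum _ fun a _ => (hV0 a).mul ((HasGrad.of_smooth hI.smooth).continuous_grad a)
  have c4 : Continuous fun x => ∑ a, V x a *
      div2 (fun x a b => ∑ d, shearField A B x a d * shearField A' B' x d b) x a :=
    continuous_finsetSum _ fun a _ => (hV0 a).mul (continuous_div2 hT a)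
  have c5 : Continuous fun x =>
      ∑ a, V x a * ∑ b, shearField A B x a b * shearFieldDiv A' B' x b :=
    continuous_finsetSum _ fun a _ => (hV0 a).mul (continuous_shearField_mul_div A B A' B' a)
  simp only [hsplit]
  rw [integral_five c1 c2 c3 c4 c5, h1, h2, h3, h4]
  have h5 : ∫ x, ∑ b, ∑ a, V' b x a * (-12 * (quadForm B x * epsilon x a b)) ∂area
      = -12 * ∫ x, ∑ b, ∑ a, V' b x a * (quadForm B x * epsilon x a b) ∂area := by
    rw [← integral_const_mul]
    simp only [Finset.mul_sum, mul_left_comm (-12 : ℝ)]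
  rw [h5]
  ring

/-! ### Moments against the boost and rotation fields -/

theorem grad_X (k : Fin 3) : grad (X k) = fun x a => sigma x a k := (HasGrad.coord k).grad_eq

theorem rotation_eq (k : Fin 3) (x : S2) (a : Fin 3) :
    NullInfinityData.rotation k x a = epsilon x a k := by
  simp only [NullInfinityData.rotation, grad_X, sum_epsilon_mul_sigma]

theorem hasGrad_sigma (k a : Fin 3) :
    HasGrad (fun x => sigma x a k) fun x d => -(X a x * sigma x d k + X k x * sigma x d a) :=
  ((HasGrad.const (delta a k)).sub ((HasGrad.coord a).mul (HasGrad.coord k))).congr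
    fun x d => by ring

theorem sum_hasGrad_sigma (k : Fin 3) (x : S2) :
    ∑ a, -(X a x * sigma x a k + X k x * sigma x a a) = -2 * X k x := by
  simp only [Finset.sum_neg_distrib, Finset.sum_add_distrib, ← Finset.mul_sum, sum_X_mul_sigma,
    sum_sigma_self]
  ring

theorem sum_hasGrad_epsilon (k : Fin 3) (x : S2) :
    ∑ a, (leviCivita a k a - epsilon x a k * X a x) = 0 := by
  have h := sum_X_mul_epsilon x k
  simp only [mul_comm (X _ x)] at h
  rw [Finset.sum_sub_distrib, h]
  simp [leviCivita]

/-- The boost field is conformal Killing: the tangential part of its derivative is `-X^k σ`, so a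
tangential tensor is seen only through its trace. -/
theorem sum_hasGrad_sigma_mul {x : S2} {T : Fin 3 → Fin 3 → ℝ} (k : Fin 3)
    (h1 : ∀ b, ∑ a, X a x * T a b = 0) (h2 : ∀ a, ∑ b, X b x * T a b = 0) :
    ∑ b, ∑ a, -(X b x * sigma x a k + X k x * sigma x a b) * T a b = - X k x * ∑ a, T a a := by
  have h3 : ∀ b, ∑ a, sigma x a b * T a b = T b b := fun b => sum_sigma_mul_of_tangent (h1 b) b
  simp only [Fin.sum_univ_three] at *
  linear_combination -(sigma x 0 k * h2 0 + sigma x 1 k * h2 1 + sigma x 2 k * h2 2)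
    - X k x * (h3 0 + h3 1 + h3 2)

/-- The volume form of `ℝ³` is the outward conormal `X` wedged with the area form. -/
theorem leviCivita_eq (x : S2) (a b k : Fin 3) :
    leviCivita b k a = X k x * epsilon x a b + X a x * epsilon x b k + X b x * epsilon x k a := by
  have h := sum_X_sq x
  fin_cases a <;> fin_cases b <;> fin_cases k <;>
    simp [epsilon, leviCivita, Fin.sum_univ_three] <;>
    first | ring1 | linear_combination h | linear_combination -h

/-- The rotation field is Killing: the tangential part of its derivative is antisymmetric, hence a
multiple of `X^k ε`. -/
theorem sum_hasGrad_epsilon_mul {x : S2} {T : Fin 3 → Fin 3 → ℝ} (k : Fin 3)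
    (h2 : ∀ a, ∑ b, X b x * T a b = 0) :
    ∑ b, ∑ a, (leviCivita b k a - epsilon x b k * X a x) * T a b
      = X k x * ∑ a, ∑ b, epsilon x a b * T a b := by
  simp only [leviCivita_eq x, Fin.sum_univ_three] at *
  linear_combination epsilon x k 0 * h2 0 + epsilon x k 1 * h2 1 + epsilon x k 2 * h2 2

theorem sum_epsilon_mul_mul (hA' : A'.IsSymm) (x : S2) :
    ∑ a, ∑ b, epsilon x a b * ∑ d, quadShear A x a d * quadShear A' x d b
      = - inner2 (quadShear A' x) (dualShear A x) := by
  have h1 := fun a b => quadShear_symm hA' x a b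
  have h2 := fun a => (by linarith [epsilon_antisymm x a a] : epsilon x a a = 0)
  simp only [inner2, dualShear, Fin.sum_univ_three, h2, h1 1 0, h1 2 0, h1 2 1,
    epsilon_antisymm x 1 0, epsilon_antisymm x 2 0, epsilon_antisymm x 2 1]
  ring

theorem sum_X_mul_mul_shearField (hA : A.IsSymm) (x : S2) (b : Fin 3) :
    ∑ a, X a x * ∑ d, shearField A B x a d * shearField A' B' x d b = 0 := by
  simp only [Finset.mul_sum]
  rw [Finset.sum_comm]
  simp only [← mul_assoc, ← Finset.sum_mul, sum_X_mul_shearField hA, zero_mul,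
    Finset.sum_const_zero]

theorem sum_X_mul_shearField' (hA : A.IsSymm) (hB : B.IsSymm) (hB0 : B.trace = 0) (x : S2)
    (a : Fin 3) : ∑ b, X b x * shearField A B x a b = 0 := by
  rw [← sum_X_mul_shearField (B := B) hA x a]
  exact Finset.sum_congr rfl fun b _ => by rw [shearField_symm hA hB hB0]

theorem sum_X_mul_mul_shearField' (hA' : A'.IsSymm) (hB' : B'.IsSymm) (hB0' : B'.trace = 0)
    (x : S2) (a : Fin 3) :
    ∑ b, X b x * ∑ d, shearField A B x a d * shearField A' B' x d b = 0 := by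
  simp only [Finset.mul_sum]
  rw [Finset.sum_comm]
  simp only [mul_left_comm (X _ x), ← Finset.mul_sum, sum_X_mul_shearField' hA' hB' hB0' x,
    mul_zero, Finset.sum_const_zero]

theorem sum_dualShear_mul_dualShear (hA : A.IsSymm) (hA0 : A.trace = 0) (x : S2) (a b : Fin 3) :
    ∑ d, dualShear A x a d * dualShear A' x d b = ∑ d, quadShear A x a d * quadShear A' x d b := by
  simp only [dualShear.eq_def A', Finset.mul_sum]
  rw [Finset.sum_comm]
  simp only [← mul_assoc, ← Finset.sum_mul, sum_dualShear_mul_epsilon hA hA0]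

/-- The curl term is antisymmetric and has no trace. The gradient of `C·N` and the divergence of
`CN` combine to `¼ ∫ X^k C·N`, and the term `C div N` supplies the rest. -/
theorem integral_boost_aspectRate {m : S2 → ℝ} (hm : SmoothOnSphere m) (hA : A.IsSymm)
    (hA0 : A.trace = 0) (hB : B.IsSymm) (hB0 : B.trace = 0) (hA' : A'.IsSymm)
    (hA0' : A'.trace = 0) (hB' : B'.IsSymm) (hB0' : B'.trace = 0) (k : Fin 3) :
    ∫ x, ∑ a, sigma x a k * aspectRate m A B A' B' x a ∂area
      = 2 * (∫ x, X k x * m x ∂area) + 16 * Real.pi / 15 *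
        (3 * epsContract A B' k + epsContract A' B k - 2 * epsContract B A' k) := by
  rw [integral_sum_mul_aspectRate hm hA hB hB0 hA' hB' (hasGrad_sigma k)
    fun x => sum_X_mul_sigma x k]
  have h1 : ∀ x, ∑ b, ∑ a, -(X b x * sigma x a k + X k x * sigma x a b) *
      (quadForm B x * epsilon x a b) = 0 := by
    intro x
    rw [sum_hasGrad_sigma_mul]
    · have h2 := fun a => (by linarith [epsilon_antisymm x a a] : epsilon x a a = 0)
      simp [h2]
    · intro b
      simp only [mul_left_comm (X _ x), ← Finset.mul_sum, sum_X_mul_epsilon, mul_zero]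
    · intro a
      simp only [mul_comm (X _ x), mul_assoc, ← Finset.mul_sum, sum_epsilon_mul_X, mul_zero]
  have h2 : ∀ x, ∑ b, ∑ a, -(X b x * sigma x a k + X k x * sigma x a b) *
      ∑ d, shearField A B x a d * shearField A' B' x d b
      = -(X k x * inner2 (shearField A B x) (shearField A' B' x)) := by
    intro x
    rw [sum_hasGrad_sigma_mul k (sum_X_mul_mul_shearField hA x)
      (sum_X_mul_mul_shearField' hA' hB' hB0' x), inner2, neg_mul]
    simp only [shearField_symm hA' hB' hB0' x]
  have h3 : ∀ f : S2 → ℝ, ∫ x, f x * (-2 * X k x) ∂area = -2 * ∫ x, X k x * f x ∂area := by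
    intro f
    rw [← integral_const_mul]
    congr 1 with x
    ring
  simp only [h1, h2, h3, sum_hasGrad_sigma, integral_zero, integral_neg,
    integral_boost_shear_div hA hA0 hB hB0 hA' hA0' hB' hB0',
    integral_X_mul_inner2_shearField hA hB hB0 hA' hB' hB0']
  ring

/-- A Killing field is divergence free, so both gradient terms drop; the curl term is odd. The two
remaining terms are in ratio `1 : 2`, which produces the factor three over `16π/15`. -/
theorem integral_rotation_aspectRate {m : S2 → ℝ} (hm : SmoothOnSphere m) (hA : A.IsSymm)
    (hA0 : A.trace = 0) (hB : B.IsSymm) (hB0 : B.trace = 0) (hA' : A'.IsSymm)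
    (hA0' : A'.trace = 0) (hB' : B'.IsSymm) (hB0' : B'.trace = 0) (k : Fin 3) :
    ∫ x, ∑ a, epsilon x a k * aspectRate m A B A' B' x a ∂area
      = 16 * Real.pi / 5 * (epsContract A A' k + epsContract B B' k) := by
  rw [integral_sum_mul_aspectRate hm hA hB hB0 hA' hB' (fun a => hasGrad_epsilon a k)
    fun x => sum_X_mul_epsilon x k]
  have h1 : ∫ x, ∑ b, ∑ a, (leviCivita b k a - epsilon x b k * X a x) *
      (quadForm B x * epsilon x a b) ∂area = 0 := by
    refine integral_eq_zero_of_odd fun x => ?_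
    simp only [epsilon_neg, X_neg, quadForm_neg, Fin.sum_univ_three]
    ring
  have h2 : ∫ x, ∑ b, ∑ a, (leviCivita b k a - epsilon x b k * X a x) *
      ∑ d, shearField A B x a d * shearField A' B' x d b ∂area
      = - (64 * Real.pi / 15 * (epsContract A' A k + epsContract B' B k)) := by
    simp only [sum_hasGrad_epsilon_mul k (sum_X_mul_mul_shearField' hA' hB' hB0' _)]
    have cf : Continuous fun x => X k x * ∑ a, ∑ b, epsilon x a b *
        ∑ d, shearField A B x a d * shearField A' B' x d b := by
      have cX := continuous_X
      have cS := continuous_shearField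
      have ce := continuous_epsilon
      fun_prop
    have ck : ∀ A B : Matrix (Fin 3) (Fin 3) ℝ,
        Continuous fun x => X k x * inner2 (quadShear A x) (dualShear B x) := fun A B =>
      (continuous_X k).mul (continuous_inner2 (continuous_quadShear A) (continuous_dualShear B))
    -- `X^k ε` is even, so only `K K'` and `(ε K)(ε K')` survive, and the latter product equals the
    -- former with the co-closed matrices.
    rw [integral_eq_of_even_part (g := fun x => -(X k x * inner2 (quadShear A' x) (dualShear A x)
      + X k x * inner2 (quadShear B' x) (dualShear B x))) cf (fun x => by
        have p1 := sum_epsilon_mul_mul (A := A) hA' x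
        have p2 := sum_epsilon_mul_mul (A := B) hB' x
        have p3 := sum_dualShear_mul_dualShear (A' := B') hB hB0 x
        simp only [shearField, epsilon_neg, X_neg, quadShear_neg, dualShear_neg,
          Fin.sum_univ_three] at *
        linear_combination 2 * X k x * (p1 + p2 + epsilon x 0 0 * p3 0 0 + epsilon x 0 1 * p3 0 1
          + epsilon x 0 2 * p3 0 2 + epsilon x 1 0 * p3 1 0 + epsilon x 1 1 * p3 1 1
          + epsilon x 1 2 * p3 1 2 + epsilon x 2 0 * p3 2 0 + epsilon x 2 1 * p3 2 1
          + epsilon x 2 2 * p3 2 2)), integral_neg,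
      integral_add (integrable_of_continuous (ck A' A)) (integrable_of_continuous (ck B' B)),
      integral_X_mul_inner2 hA' hA hA0, integral_X_mul_inner2 hB' hB hB0]
    ring
  simp only [h1, h2, sum_hasGrad_epsilon, mul_zero, integral_zero,
    integral_rotation_shear_div hA hA0 hB hB0 hA' hA0' hB' hB0']
  rw [epsContract_swap hA' hA, epsContract_swap hB' hB]
  ring

end

section

/-! ### Rotating and differentiating quadrupoles -/

/-- The symmetric matrix of the derivative of `∑ A_{ij} X^i X^j` along the rotation field `k`. -/
def rotateQuad (k : Fin 3) (A : Matrix (Fin 3) (Fin 3) ℝ) : Matrix (Fin 3) (Fin 3) ℝ :=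
  Matrix.of fun i j => ∑ a, (leviCivita a k i * A a j + leviCivita a k j * A a i)

theorem rotateQuad_isSymm (k : Fin 3) (A : Matrix (Fin 3) (Fin 3) ℝ) :
    (rotateQuad k A).IsSymm := by
  ext i j
  simp only [rotateQuad, Matrix.transpose_apply, Matrix.of_apply, add_comm]

theorem rotateQuad_trace {A : Matrix (Fin 3) (Fin 3) ℝ} (hA : A.IsSymm) (k : Fin 3) :
    (rotateQuad k A).trace = 0 := by
  have h10 := hA.apply 0 1
  have h20 := hA.apply 0 2
  have h21 := hA.apply 1 2
  simp only [Matrix.trace, Matrix.diag, rotateQuad, Matrix.of_apply, leviCivita, Fin.sum_univ_three,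
    h10, h20, h21]
  ring

theorem quadForm_rotateQuad (k : Fin 3) (A : Matrix (Fin 3) (Fin 3) ℝ) (x : S2) :
    quadForm (rotateQuad k A) x = 2 * ∑ a, epsilon x a k * lin (A a) x := by
  simp only [quadForm, rotateQuad, Matrix.of_apply, epsilon, lin, Fin.sum_univ_three]
  ring

theorem sum_mul_rotateQuad {A B : Matrix (Fin 3) (Fin 3) ℝ} (hA : A.IsSymm) (hB : B.IsSymm)
    (k : Fin 3) : ∑ i, ∑ j, A i j * rotateQuad k B i j = -2 * epsContract B A k := by
  have h10 := hA.apply 0 1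
  have h20 := hA.apply 0 2
  have h21 := hA.apply 1 2
  have k10 := hB.apply 0 1
  have k20 := hB.apply 0 2
  have k21 := hB.apply 1 2
  simp only [epsContract, rotateQuad, Matrix.of_apply, leviCivita, Fin.sum_univ_three, h10, h20,
    h21, k10, k20, k21]
  ring

theorem epsContract_self {A : Matrix (Fin 3) (Fin 3) ℝ} (hA : A.IsSymm) (k : Fin 3) :
    epsContract A A k = 0 := by linarith [epsContract_swap hA hA k]

/-! ### Derivatives of quadrupole expressions in `u` -/

section deriv

variable {I : Set ℝ} {u : ℝ} {c cb : ℝ → Matrix (Fin 3) (Fin 3) ℝ}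
  {n nb : Matrix (Fin 3) (Fin 3) ℝ}

theorem hasDerivWithinAt_epsContract
    (hn : ∀ i j, HasDerivWithinAt (fun t => c t i j) (n i j) I u)
    (hnb : ∀ i j, HasDerivWithinAt (fun t => cb t i j) (nb i j) I u) (k : Fin 3) :
    HasDerivWithinAt (fun t => epsContract (c t) (cb t) k)
      (epsContract n (cb u) k + epsContract (c u) nb k) I u := by
  have h : HasDerivWithinAt (fun t => epsContract (c t) (cb t) k) _ I u :=
    HasDerivWithinAt.fun_sum fun i _ => HasDerivWithinAt.fun_sum fun j _ =>
      HasDerivWithinAt.fun_sum fun p _ => ((hn i j).mul (hnb j p)).mul_const (leviCivita i p k)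
  convert h using 1
  simp only [epsContract, ← Finset.sum_add_distrib, add_mul]

theorem hasDerivWithinAt_lin
    (hn : ∀ i j, HasDerivWithinAt (fun t => c t i j) (n i j) I u) (x : S2) (a : Fin 3) :
    HasDerivWithinAt (fun t => lin (c t a) x) (lin (n a) x) I u :=
  HasDerivWithinAt.fun_sum fun i _ => (hn a i).mul_const _

theorem hasDerivWithinAt_quadForm
    (hn : ∀ i j, HasDerivWithinAt (fun t => c t i j) (n i j) I u) (x : S2) :
    HasDerivWithinAt (fun t => quadForm (c t) x) (quadForm n x) I u :=
  HasDerivWithinAt.fun_sum fun i _ => HasDerivWithinAt.fun_sum fun j _ =>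
    ((hn i j).mul_const _).mul_const _

theorem hasDerivWithinAt_quadShear
    (hn : ∀ i j, HasDerivWithinAt (fun t => c t i j) (n i j) I u) (x : S2) (a b : Fin 3) :
    HasDerivWithinAt (fun t => quadShear (c t) x a b) (quadShear n x a b) I u :=
  (((((hn a b).const_mul 2).sub (((hasDerivWithinAt_lin hn x b).const_mul _).const_mul 2)).sub
    (((hasDerivWithinAt_lin hn x a).mul_const _).const_mul 2)).add
    ((hasDerivWithinAt_quadForm hn x).mul_const _)).add
    ((hasDerivWithinAt_quadForm hn x).mul_const _)

theorem hasDerivWithinAt_shearField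
    (hn : ∀ i j, HasDerivWithinAt (fun t => c t i j) (n i j) I u)
    (hnb : ∀ i j, HasDerivWithinAt (fun t => cb t i j) (nb i j) I u) (x : S2) (a b : Fin 3) :
    HasDerivWithinAt (fun t => shearField (c t) (cb t) x a b) (shearField n nb x a b) I u :=
  (hasDerivWithinAt_quadShear hn x a b).add
    (HasDerivWithinAt.fun_sum fun e _ => (hasDerivWithinAt_quadShear hnb x e b).const_mul _)

theorem isSymm_trace_of_hasDerivWithinAt (hI : UniqueDiffWithinAt ℝ I u) (hu : u ∈ I)
    (hc : ∀ t ∈ I, (c t).IsSymm ∧ (c t).trace = 0)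
    (hn : ∀ i j, HasDerivWithinAt (fun t => c t i j) (n i j) I u) : n.IsSymm ∧ n.trace = 0 := by
  constructor
  · ext i j
    exact hI.eq_deriv I (hn j i) ((hn i j).congr (fun t ht => (hc t ht).1.apply i j)
      ((hc u hu).1.apply i j))
  · have h1 : HasDerivWithinAt (fun t => (c t).trace) n.trace I u :=
      HasDerivWithinAt.fun_sum fun i _ => hn i i
    exact hI.eq_deriv I h1 ((hasDerivWithinAt_const u I (0 : ℝ)).congr (fun t ht => (hc t ht).2)
      (hc u hu).2)

end deriv

/-- The traceless symmetric matrix with `∑ A_{ij} B_{ij} = A_{kl}` for all such `A`. -/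
def traceFreeUnit (k l : Fin 3) : Matrix (Fin 3) (Fin 3) ℝ := Matrix.of fun i j =>
  1 / 2 * (delta i k * delta j l + delta i l * delta j k) - 1 / 3 * delta k l * delta i j

theorem traceFreeUnit_isSymm (k l : Fin 3) : (traceFreeUnit k l).IsSymm := by
  ext i j
  have : delta i j = delta j i := by simp only [delta, eq_comm]
  simp only [traceFreeUnit, Matrix.transpose_apply, Matrix.of_apply, this]
  ring

theorem traceFreeUnit_trace (k l : Fin 3) : (traceFreeUnit k l).trace = 0 := by
  fin_cases k <;> fin_cases l <;>
    simp [traceFreeUnit, Matrix.trace, Fin.sum_univ_three, delta] <;> norm_num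

theorem sum_mul_traceFreeUnit {A : Matrix (Fin 3) (Fin 3) ℝ} (hA : A.IsSymm) (k l : Fin 3) :
    ∑ i, ∑ j, A i j * traceFreeUnit k l i j = A k l - 1 / 3 * delta k l * A.trace := by
  have h10 := hA.apply 0 1
  have h20 := hA.apply 0 2
  have h21 := hA.apply 1 2
  fin_cases k <;> fin_cases l <;>
    simp [traceFreeUnit, Matrix.trace, Fin.sum_univ_three, delta, h10, h20, h21] <;> ring

/-! ### Integrals against a smooth mass aspect -/

variable {A : Matrix (Fin 3) (Fin 3) ℝ} {m : S2 → ℝ}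

theorem integral_boost_grad (hm : SmoothOnSphere m) (k : Fin 3) :
    ∫ x, ∑ a, sigma x a k * grad m x a ∂area = 2 * ∫ x, X k x * m x ∂area := by
  rw [integral_sum_mul_grad (HasGrad.of_smooth hm) (hasGrad_sigma k) fun x => sum_X_mul_sigma x k,
    ← integral_neg, ← integral_const_mul]
  congr 1 with x
  rw [sum_hasGrad_sigma]
  ring

/-- The rotation is divergence free, so by parts the derivative falls on the quadrupole alone and
rotates it. -/
theorem integral_rotation_quadForm_grad (hm : SmoothOnSphere m) (hA : A.IsSymm) (k : Fin 3) :
    ∫ x, ∑ a, epsilon x a k * (quadForm A x * grad m x a) ∂area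
      = - ∫ x, quadForm (rotateQuad k A) x * m x ∂area := by
  have h := integral_sum_mul_grad (HasGrad.of_smooth hm)
    (fun a => (hasGrad_epsilon a k).mul (hasGrad_quadForm hA))
    fun x => by simp only [← mul_assoc, ← Finset.sum_mul, sum_X_mul_epsilon, zero_mul]
  simp only [← mul_assoc]
  rw [h]
  congr 2 with x
  have h1 := sum_hasGrad_epsilon k x
  have h2 := sum_X_mul_epsilon x k
  rw [quadForm_rotateQuad]
  simp only [Fin.sum_univ_three] at *
  linear_combination m x * quadForm A x * h1 - 2 * m x * quadForm A x * h2

theorem integral_boost_quadForm_grad (hm : SmoothOnSphere m) (hA : A.IsSymm) (k : Fin 3) :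
    ∫ x, ∑ a, sigma x a k * (quadForm A x * grad m x a) ∂area
      = - ∫ x, m x * (2 * lin (A k) x - 4 * (X k x * quadForm A x)) ∂area := by
  have h := integral_sum_mul_grad (HasGrad.of_smooth hm)
    (fun a => (hasGrad_sigma k a).mul (hasGrad_quadForm hA))
    fun x => by simp only [← mul_assoc, ← Finset.sum_mul, sum_X_mul_sigma, zero_mul]
  simp only [← mul_assoc]
  rw [h]
  congr 2 with x
  have h1 := sum_hasGrad_sigma k x
  have h2 := sum_sigma_mul_of_tangent ((hasGrad_quadForm hA).tangent x) k
  simp only [Fin.sum_univ_three] at *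
  linear_combination m x * quadForm A x * h1 + m x * h2

end

section

/-! ### Null infinity data with quadrupole shear -/

theorem continuous_aspectRate {m : S2 → ℝ} {A B A' B' : Matrix (Fin 3) (Fin 3) ℝ}
    (hm : SmoothOnSphere m) (hA : A.IsSymm) (hB : B.IsSymm) (hB0 : B.trace = 0) (hA' : A'.IsSymm)
    (hB' : B'.IsSymm) (a : Fin 3) : Continuous fun x => aspectRate m A B A' B' x a := by
  obtain ⟨S, hS⟩ := exists_hasGrad_shearField hA hB
  obtain ⟨S', hS'⟩ := exists_hasGrad_shearField hA' hB'
  have hW : ∀ a b, HasGrad (fun x => -12 * (quadForm B x * epsilon x a b)) _ := fun a b =>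
    ((hasGrad_quadForm hB).mul (hasGrad_epsilon a b)).const_mul (-12)
  have hI : HasGrad (fun x => inner2 (shearField A B x) (shearField A' B' x)) _ :=
    HasGrad.sum Finset.univ fun a _ => HasGrad.sum Finset.univ fun b _ => (hS a b).mul (hS' a b)
  have hT : ∀ a b, HasGrad (fun x => ∑ d, shearField A B x a d * shearField A' B' x d b) _ :=
    fun a b => HasGrad.sum Finset.univ fun d _ => (hS a d).mul (hS' d b)
  simp only [aspectRate, covDeriv1_shearFieldDiv_sub hA hB hB0]
  exact (((((HasGrad.of_smooth hm).continuous_grad a).sub ((continuous_div2 hW a).const_mul _)).add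
    (((HasGrad.of_smooth hI.smooth).continuous_grad a).const_mul _)).sub
    ((continuous_div2 hT a).const_mul _)).add
    ((continuous_shearField_mul_div A B A' B' a).const_mul _)

/-- Null infinity data on an interval whose shear has the `ℓ = 2` potentials `∑ c_{ij} X^i X^j` and
`∑ c̲_{ij} X^i X^j`, with `∂_u c = n` and `∂_u c̲ = n̲`. -/
structure HasQuadrupoleShear {I : Set ℝ} (D : NullInfinityData I)
    (c cb n nb : ℝ → Matrix (Fin 3) (Fin 3) ℝ) : Prop where
  ordConnected : I.OrdConnected
  nontrivial : I.Nontrivial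
  symm_c : ∀ u ∈ I, (c u).IsSymm
  trace_c : ∀ u ∈ I, (c u).trace = 0
  symm_cb : ∀ u ∈ I, (cb u).IsSymm
  trace_cb : ∀ u ∈ I, (cb u).trace = 0
  symm_n : ∀ u ∈ I, (n u).IsSymm
  trace_n : ∀ u ∈ I, (n u).trace = 0
  symm_nb : ∀ u ∈ I, (nb u).IsSymm
  trace_nb : ∀ u ∈ I, (nb u).trace = 0
  deriv_c : ∀ u ∈ I, ∀ i j, HasDerivWithinAt (fun t => c t i j) (n u i j) I u
  deriv_cb : ∀ u ∈ I, ∀ i j, HasDerivWithinAt (fun t => cb t i j) (nb u i j) I u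
  shear : ∀ u ∈ I, D.shear u = shearField (c u) (cb u)
  news : ∀ u ∈ I, D.news u = shearField (n u) (nb u)

namespace HasQuadrupoleShear

variable {I : Set ℝ} {D : NullInfinityData I} {c cb n nb : ℝ → Matrix (Fin 3) (Fin 3) ℝ}

/-- Uniqueness of derivatives within `I` passes symmetry and tracelessness on to `n` and `n̲`, and
identifies the news with the shear built from them. -/
theorem mk_of_potentials (hI : I.OrdConnected) (hI' : I.Nontrivial)
    (hc : ∀ u ∈ I, (c u).IsSymm ∧ (c u).trace = 0)
    (hcb : ∀ u ∈ I, (cb u).IsSymm ∧ (cb u).trace = 0)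
    (hC : ∀ u ∈ I, ∀ x a b, D.shear u x a b =
      closedPart (quadForm (c u)) x a b + coclosedPart (quadForm (cb u)) x a b)
    (hn : ∀ u ∈ I, ∀ i j, HasDerivWithinAt (fun t => c t i j) (n u i j) I u)
    (hnb : ∀ u ∈ I, ∀ i j, HasDerivWithinAt (fun t => cb t i j) (nb u i j) I u) :
    HasQuadrupoleShear D c cb n nb := by
  have hu := uniqueDiffOn_of_ordConnected hI hI'
  have h1 := fun u hu' => isSymm_trace_of_hasDerivWithinAt (hu u hu') hu' hc (hn u hu')
  have h2 := fun u hu' => isSymm_trace_of_hasDerivWithinAt (hu u hu') hu' hcb (hnb u hu')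
  have h3 : ∀ u ∈ I, D.shear u = shearField (c u) (cb u) := by
    intro u hu'
    ext x a b
    rw [hC u hu', closedPart_quadForm (hc u hu').1 (hc u hu').2,
      coclosedPart_quadForm (hcb u hu').1 (hcb u hu').2, shearField]
  refine ⟨hI, hI', fun u h => (hc u h).1, fun u h => (hc u h).2, fun u h => (hcb u h).1,
    fun u h => (hcb u h).2, fun u h => (h1 u h).1, fun u h => (h1 u h).2, fun u h => (h2 u h).1,
    fun u h => (h2 u h).2, hn, hnb, h3, fun u h => ?_⟩
  ext x a b
  exact (hu u h).eq_deriv I (D.news_eq u h x a b)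
    ((hasDerivWithinAt_shearField (hn u h) (hnb u h) x a b).congr
      (fun t ht => by rw [h3 t ht]) (by rw [h3 u h]))

theorem smooth_m (D : NullInfinityData I) {u : ℝ} (hu : u ∈ I) : SmoothOnSphere (D.m u) :=
  D.smooth_m.smooth hu

theorem continuous_aspect (D : NullInfinityData I) {u : ℝ} (hu : u ∈ I) (a : Fin 3) :
    Continuous fun x => D.aspect u x a :=
  ((D.smooth_aspect.apply a).smooth hu).continuous

variable (h : HasQuadrupoleShear D c cb n nb)
include h

theorem hasDerivWithinAt_m {u : ℝ} (hu : u ∈ I) (x : S2) : HasDerivWithinAt (fun t => D.m t x)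
    (-(1 / 8) * inner2 (shearField (n u) (nb u) x) (shearField (n u) (nb u) x)
      + 3 * quadForm (n u) x) I u := by
  convert D.evol_m u hu x using 1
  rw [h.news u hu, div2_shearField (h.symm_n u hu) (h.trace_n u hu) (h.symm_nb u hu),
    div1_shearFieldDiv (h.symm_n u hu) (h.trace_n u hu) (h.symm_nb u hu)]
  ring

theorem hasDerivWithinAt_aspect {u : ℝ} (hu : u ∈ I) (x : S2) (a : Fin 3) :
    HasDerivWithinAt (fun t => D.aspect t x a)
      (aspectRate (D.m u) (c u) (cb u) (n u) (nb u) x a) I u := by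
  convert D.evol_aspect u hu x a using 1
  rw [h.news u hu, h.shear u hu,
    div2_shearField (h.symm_n u hu) (h.trace_n u hu) (h.symm_nb u hu),
    div2_shearField (h.symm_c u hu) (h.trace_c u hu) (h.symm_cb u hu), aspectRate]

theorem shearDiv_eq {u : ℝ} (hu : u ∈ I) (x : S2) (a : Fin 3) : D.shearDiv u x a
    = ∑ b, shearField (c u) (cb u) x a b * shearFieldDiv (c u) (cb u) x b := by
  rw [NullInfinityData.shearDiv, h.shear u hu,
    div2_shearField (h.symm_c u hu) (h.trace_c u hu) (h.symm_cb u hu)]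

theorem modifiedMass_eq {u : ℝ} (hu : u ∈ I) (x : S2) :
    D.modifiedMass u x = D.m u x - 3 * quadForm (c u) x := by
  rw [NullInfinityData.modifiedMass, h.shear u hu,
    div2_shearField (h.symm_c u hu) (h.trace_c u hu) (h.symm_cb u hu),
    div1_shearFieldDiv (h.symm_c u hu) (h.trace_c u hu) (h.symm_cb u hu)]
  ring

theorem hasDerivWithinAt_integral_m {u : ℝ} (hu : u ∈ I) {φ : S2 → ℝ} (hφ : Continuous φ) :
    HasDerivWithinAt (fun t => ∫ x, φ x * D.m t x ∂area)
      (-(1 / 8) * (∫ x, inner2 (shearField (n u) (nb u) x) (shearField (n u) (nb u) x) * φ x ∂area)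
        + 3 * ∫ x, quadForm (n u) x * φ x ∂area) I u := by
  have cS : Continuous fun x =>
      inner2 (shearField (n u) (nb u) x) (shearField (n u) (nb u) x) :=
    continuous_inner2 (continuous_shearField _ _) (continuous_shearField _ _)
  have cq := continuous_quadForm (n u)
  convert hasDerivWithinAt_integral h.ordConnected h.nontrivial D.smooth_m hφ hu
    (h.hasDerivWithinAt_m hu) using 1
  rw [← integral_const_mul, ← integral_const_mul, ← integral_add
    (integrable_of_continuous (by fun_prop)) (integrable_of_continuous (by fun_prop))]
  congr 1 with x
  ring

theorem hasDerivWithinAt_integral_aspect {u : ℝ} (hu : u ∈ I) {V : S2 → Fin 3 → ℝ}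
    (hV : ∀ a, Continuous fun x => V x a) :
    HasDerivWithinAt (fun t => ∫ x, ∑ a, V x a * D.aspect t x a ∂area)
      (∫ x, ∑ a, V x a * aspectRate (D.m u) (c u) (cb u) (n u) (nb u) x a ∂area) I u := by
  have cN : ∀ t ∈ I, ∀ a, Continuous fun x => V x a * D.aspect t x a :=
    fun t ht a => (hV a).mul (continuous_aspect D ht a)
  have cR : ∀ a, Continuous fun x =>
      V x a * aspectRate (D.m u) (c u) (cb u) (n u) (nb u) x a :=
    fun a => (hV a).mul (continuous_aspectRate (smooth_m D hu) (h.symm_c u hu)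
    (h.symm_cb u hu) (h.trace_cb u hu) (h.symm_n u hu) (h.symm_nb u hu) a)
  have h1 := HasDerivWithinAt.fun_sum (u := Finset.univ) fun a _ => hasDerivWithinAt_integral
    h.ordConnected h.nontrivial (D.smooth_aspect.apply a) (hV a) hu
    (fun x => h.hasDerivWithinAt_aspect hu x a)
  rw [integral_finsetSum _ fun a _ => integrable_of_continuous (cR a)]
  exact h1.congr_of_mem (fun t ht => integral_finsetSum _ fun a _ =>
    integrable_of_continuous (cN t ht a)) hu

theorem hasDerivWithinAt_energy {u : ℝ} (hu : u ∈ I) : HasDerivWithinAt D.energy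
    (-(8 * Real.pi / 5) * (sqNorm (n u) + sqNorm (nb u))) I u := by
  have h1 : D.energy = fun t => ∫ x, 2 * D.m t x ∂area := rfl
  rw [h1]
  convert h.hasDerivWithinAt_integral_m hu (φ := fun _ => 2) continuous_const using 1
  rw [integral_mul_const, integral_mul_const,
    integral_inner2_shearField (h.symm_n u hu) (h.trace_n u hu) (h.symm_nb u hu)
    (h.trace_nb u hu), integral_quadForm (h.trace_n u hu)]
  ring

theorem hasDerivWithinAt_momentum {u : ℝ} (hu : u ∈ I) (k : Fin 3) :
    HasDerivWithinAt (D.momentum k) (-(32 * Real.pi / 15) * epsContract (n u) (nb u) k) I u := by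
  have h1 : D.momentum k = fun t => ∫ x, (2 * X k x) * D.m t x ∂area := by
    ext t
    rw [NullInfinityData.momentum]
    congr 1 with x
    ring
  have h2 : ∫ x, quadForm (n u) x * (2 * X k x) ∂area = 0 :=
    integral_eq_zero_of_odd fun x => by rw [quadForm_neg, X_neg]; ring
  have h3 : ∫ x, inner2 (shearField (n u) (nb u) x) (shearField (n u) (nb u) x) * (2 * X k x) ∂area
      = 2 * ∫ x, X k x * inner2 (shearField (n u) (nb u) x) (shearField (n u) (nb u) x) ∂area := by
    rw [← integral_const_mul]
    congr 1 with x
    ring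
  rw [h1]
  convert h.hasDerivWithinAt_integral_m hu (φ := fun x => 2 * X k x)
    ((continuous_X k).const_mul 2) using 1
  rw [h2, h3, integral_X_mul_inner2_shearField (h.symm_n u hu) (h.symm_nb u hu) (h.trace_nb u hu)
    (h.symm_n u hu) (h.symm_nb u hu) (h.trace_nb u hu)]
  ring

/-- A quadrupole sees only the `ℓ = 2` mode of `m = m̂ + 3c`; the orthogonality in `IsModeTwoPart`
is tested on `q_B` itself. -/
theorem integral_quadForm_mul_m {mh : ℝ → Matrix (Fin 3) (Fin 3) ℝ}
    (hmh : ∀ u ∈ I, IsModeTwoPart (D.modifiedMass u) (mh u)) {u : ℝ} (hu : u ∈ I)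
    {B : Matrix (Fin 3) (Fin 3) ℝ} (hB : B.IsSymm) (hB0 : B.trace = 0) :
    ∫ x, quadForm B x * D.m u x ∂area = 8 * Real.pi / 15 *
      ((∑ i, ∑ j, mh u i j * B i j) + 3 * ∑ i, ∑ j, c u i j * B i j) := by
  have cq := continuous_quadForm
  have cm := (smooth_m D hu).continuous
  have h1 := (hmh u hu).2.2 _ (isHarmonicOfMode_quadForm hB hB0)
  have h2 : ∀ x, (D.modifiedMass u x - quadForm (mh u) x) * quadForm B x
      = quadForm B x * D.m u x - 3 * (quadForm (c u) x * quadForm B x)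
        - quadForm (mh u) x * quadForm B x := fun x => by rw [h.modifiedMass_eq hu]; ring
  simp only [h2] at h1
  rw [integral_sub (integrable_of_continuous (by fun_prop))
    (integrable_of_continuous (by fun_prop)), integral_sub (integrable_of_continuous (by fun_prop))
    (integrable_of_continuous (by fun_prop)), integral_const_mul,
    integral_quadForm_mul_quadForm hB hB0, integral_quadForm_mul_quadForm hB hB0] at h1
  linarith

theorem hasDerivWithinAt_modeTwo {mh : ℝ → Matrix (Fin 3) (Fin 3) ℝ}
    (hmh : ∀ u ∈ I, IsModeTwoPart (D.modifiedMass u) (mh u)) {u : ℝ} (hu : u ∈ I) (k l : Fin 3) :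
    HasDerivWithinAt (fun t => mh t k l) (massModeRate (n u) (nb u) k l) I u := by
  have hpi := Real.pi_ne_zero
  have hS := traceFreeUnit_isSymm k l
  have hT := traceFreeUnit_trace k l
  -- No regularity of `m̂_{kl}` in `u` is assumed. It is recovered from a moment of `m`, with
  -- `15/(8π)` inverting the normalisation of quadrupole products, and then differentiated; the
  -- linear terms in `n` cancel.
  have h1 : ∀ t ∈ I, mh t k l = 15 / (8 * Real.pi) *
      (∫ x, quadForm (traceFreeUnit k l) x * D.m t x ∂area) - 3 * c t k l := by
    intro t ht
    rw [h.integral_quadForm_mul_m hmh ht hS hT, sum_mul_traceFreeUnit (hmh t ht).1,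
      sum_mul_traceFreeUnit (h.symm_c t ht), (hmh t ht).2.1, h.trace_c t ht]
    field_simp
    ring
  have h2 := ((h.hasDerivWithinAt_integral_m hu (φ := quadForm (traceFreeUnit k l))
    (continuous_quadForm _)).const_mul (15 / (8 * Real.pi))).sub
    ((h.deriv_c u hu k l).const_mul 3)
  refine (h2.congr_of_mem h1 hu).congr_deriv ?_
  rw [integral_inner2_shearField_mul_quadForm (h.symm_n u hu) (h.trace_n u hu) (h.symm_nb u hu)
    (h.trace_nb u hu) hS hT, integral_quadForm_mul_quadForm hS hT,
    sum_mul_traceFreeUnit (h.symm_n u hu), h.trace_n u hu]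
  -- The quadratic matrix in the news is not traceless; its trace is the source of the `⅓ δ_{kl}`
  -- term.
  have h3 := sum_mul_traceFreeUnit (A := Matrix.of fun a b =>
    ∑ i, (n u i a * n u i b + nb u i a * nb u i b)) (by
      ext a b
      simp only [Matrix.transpose_apply, Matrix.of_apply, mul_comm]) k l
  simp only [Matrix.of_apply] at h3
  rw [h3]
  have h4 : (Matrix.of fun a b => ∑ i, (n u i a * n u i b + nb u i a * nb u i b)).trace
      = sqNorm (n u) + sqNorm (nb u) := by
    simp only [Matrix.trace, Matrix.diag, Matrix.of_apply, sqNorm, Fin.sum_univ_three]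
    ring
  rw [h4, massModeRate]
  field_simp
  ring

end HasQuadrupoleShear

end

section

/-! ### Conserved charges of data with quadrupole shear -/

theorem integral_sum_mul_sub {V F G : S2 → Fin 3 → ℝ} (hV : ∀ a, Continuous fun x => V x a)
    (hF : ∀ a, Continuous fun x => F x a) (hG : ∀ a, Continuous fun x => G x a) :
    ∫ x, ∑ a, V x a * (F x a - G x a) ∂area
      = (∫ x, ∑ a, V x a * F x a ∂area) - ∫ x, ∑ a, V x a * G x a ∂area := by
  rw [← integral_sub (integrable_of_continuous (by fun_prop))
    (integrable_of_continuous (by fun_prop))]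
  simp only [← Finset.sum_sub_distrib, mul_sub]

theorem integral_sum_mul_const (V F : S2 → Fin 3 → ℝ) (r : ℝ) :
    ∫ x, ∑ a, V x a * (r * F x a) ∂area = r * ∫ x, ∑ a, V x a * F x a ∂area := by
  rw [← integral_const_mul]
  simp only [Finset.mul_sum, mul_left_comm r]

theorem sum_sigma_mul_epsilon (x : S2) (k b : Fin 3) :
    ∑ a, sigma x a k * epsilon x a b = - epsilon x b k := by
  have h := sum_epsilon_mul_sigma x b k
  simp only [Fin.sum_univ_three, epsilon_antisymm x _ b] at *
  linarith

namespace HasQuadrupoleShear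

variable {I : Set ℝ} {D : NullInfinityData I} {c cb n nb mh : ℝ → Matrix (Fin 3) (Fin 3) ℝ} {u : ℝ}

theorem continuous_grad_m (D : NullInfinityData I) (hu : u ∈ I) (a : Fin 3) :
    Continuous fun x => grad (D.m u) x a :=
  (HasGrad.of_smooth (smooth_m D hu)).continuous_grad a

variable (h : HasQuadrupoleShear D c cb n nb)
include h

theorem continuous_shearDiv (hu : u ∈ I) (a : Fin 3) : Continuous fun x => D.shearDiv u x a := by
  simp only [h.shearDiv_eq hu]
  exact continuous_shearField_mul_div _ _ _ _ a

theorem smooth_inner2_shear (hu : u ∈ I) :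
    SmoothOnSphere fun y => inner2 (D.shear u y) (D.shear u y) := by
  obtain ⟨S, hS⟩ := exists_hasGrad_shearField (h.symm_c u hu) (h.symm_cb u hu)
  rw [h.shear u hu]
  exact (HasGrad.sum Finset.univ fun a _ =>
    HasGrad.sum Finset.univ fun b _ => (hS a b).mul (hS a b)).smooth

theorem continuous_centerForm (hu : u ∈ I) (a : Fin 3) :
    Continuous fun x => D.centerForm u x a :=
  (((continuous_aspect D hu a).sub ((continuous_grad_m D hu a).const_mul u)).sub
    ((h.continuous_shearDiv hu a).const_mul _)).sub
    (((HasGrad.of_smooth (h.smooth_inner2_shear hu)).continuous_grad a).const_mul _)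

/-- The quadratic shear term integrates to `ε`-contractions of `c` with `c` and of `c̲` with `c̲`,
which vanish. -/
theorem classicalAngularMomentum_eq (hu : u ∈ I) (k : Fin 3) :
    D.classicalAngularMomentum k u = ∫ x, ∑ a, epsilon x a k * D.aspect u x a ∂area := by
  simp only [NullInfinityData.classicalAngularMomentum, rotation_eq]
  rw [integral_sum_mul_sub (fun a => continuous_epsilon a k) (continuous_aspect D hu)
    (fun a => (h.continuous_shearDiv hu a).const_mul _), integral_sum_mul_const]
  simp only [h.shearDiv_eq hu]
  rw [integral_rotation_shear_div (h.symm_c u hu) (h.trace_c u hu) (h.symm_cb u hu)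
    (h.trace_cb u hu) (h.symm_c u hu) (h.trace_c u hu) (h.symm_cb u hu) (h.trace_cb u hu),
    epsContract_self (h.symm_c u hu), epsContract_self (h.symm_cb u hu)]
  ring

/-- The term `C div C` contributes `32π/15` and the gradient of `|C|²` contributes `16π/15` to the
last coefficient. -/
theorem classicalCenterOfMass_eq (hu : u ∈ I) (k : Fin 3) :
    D.classicalCenterOfMass k u = (∫ x, ∑ a, sigma x a k * D.aspect u x a ∂area)
      - u * D.momentum k u - 16 * Real.pi / 5 * epsContract (c u) (cb u) k := by
  have cs := fun a => continuous_sigma a k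
  have cN := continuous_aspect D hu
  have cm := continuous_grad_m D hu
  have cd := h.continuous_shearDiv hu
  have ci := (HasGrad.of_smooth (h.smooth_inner2_shear hu)).continuous_grad
  have hP : D.momentum k u = 2 * ∫ x, X k x * D.m u x ∂area := by
    rw [NullInfinityData.momentum, ← integral_const_mul]
    congr 1 with x
    ring
  simp only [NullInfinityData.classicalCenterOfMass, grad_X, NullInfinityData.centerForm]
  rw [integral_sum_mul_sub cs (fun a => by fun_prop) (fun a => by fun_prop),
    integral_sum_mul_sub cs (fun a => by fun_prop) (fun a => by fun_prop),
    integral_sum_mul_sub cs (fun a => by fun_prop) (fun a => by fun_prop),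
    integral_sum_mul_const, integral_sum_mul_const, integral_sum_mul_const,
    integral_boost_grad (smooth_m D hu), integral_boost_grad (h.smooth_inner2_shear hu)]
  simp only [h.shearDiv_eq hu]
  rw [integral_boost_shear_div (h.symm_c u hu) (h.trace_c u hu) (h.symm_cb u hu)
    (h.trace_cb u hu) (h.symm_c u hu) (h.trace_c u hu) (h.symm_cb u hu) (h.trace_cb u hu),
    h.shear u hu, integral_X_mul_inner2_shearField (h.symm_c u hu) (h.symm_cb u hu)
    (h.trace_cb u hu) (h.symm_c u hu) (h.symm_cb u hu) (h.trace_cb u hu),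
    epsContract_swap (h.symm_cb u hu) (h.symm_c u hu), hP]
  ring

theorem hasDerivWithinAt_classicalAngularMomentum (hu : u ∈ I) (k : Fin 3) :
    HasDerivWithinAt (D.classicalAngularMomentum k)
      (16 * Real.pi / 5 * (epsContract (c u) (n u) k + epsContract (cb u) (nb u) k)) I u := by
  have h1 := h.hasDerivWithinAt_integral_aspect hu (V := fun x a => epsilon x a k)
    fun a => continuous_epsilon a k
  rw [integral_rotation_aspectRate (smooth_m D hu) (h.symm_c u hu) (h.trace_c u hu) (h.symm_cb u hu)
    (h.trace_cb u hu) (h.symm_n u hu) (h.trace_n u hu) (h.symm_nb u hu) (h.trace_nb u hu)] at h1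
  exact h1.congr_of_mem (fun t ht => h.classicalAngularMomentum_eq ht k) hu

/-- The boost moment of `∂_u N_A` is `P^k` plus exactly the derivative of the `ε`-contraction of `c`
and `c̲`; both cancel and only `-u ∂_u P^k` is left. -/
theorem hasDerivWithinAt_classicalCenterOfMass (hu : u ∈ I) (k : Fin 3) :
    HasDerivWithinAt (D.classicalCenterOfMass k)
      (32 * u * Real.pi / 15 * epsContract (n u) (nb u) k) I u := by
  have h1 := h.hasDerivWithinAt_integral_aspect hu (V := fun x a => sigma x a k)
    fun a => continuous_sigma a k
  rw [integral_boost_aspectRate (smooth_m D hu) (h.symm_c u hu) (h.trace_c u hu) (h.symm_cb u hu)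
    (h.trace_cb u hu) (h.symm_n u hu) (h.trace_n u hu) (h.symm_nb u hu) (h.trace_nb u hu)] at h1
  have h2 := (h1.sub ((hasDerivWithinAt_id u I).mul (h.hasDerivWithinAt_momentum hu k))).sub
    ((hasDerivWithinAt_epsContract (h.deriv_c u hu) (h.deriv_cb u hu) k).const_mul
      (16 * Real.pi / 5))
  refine (h2.congr_of_mem (fun t ht => h.classicalCenterOfMass_eq ht k) hu).congr_deriv ?_
  have hP : D.momentum k u = 2 * ∫ x, X k x * D.m u x ∂area := by
    rw [NullInfinityData.momentum, ← integral_const_mul]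
    congr 1 with x
    ring
  rw [hP, epsContract_swap (h.symm_cb u hu) (h.symm_n u hu)]
  simp only [id]
  ring

/-- The part `3c` of the `ℓ = 2` mode of `m` drops out, since `c` has zero `ε`-contraction with
itself. -/
theorem cwyAngularMomentum_eq (hmh : ∀ u ∈ I, IsModeTwoPart (D.modifiedMass u) (mh u))
    (hu : u ∈ I) (k : Fin 3) :
    D.cwyAngularMomentum (fun t => quadForm (c t)) k u = D.classicalAngularMomentum k u
      - 16 * Real.pi / 15 * epsContract (c u) (mh u) k := by
  have cm := continuous_grad_m D hu
  have cN := continuous_aspect D hu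
  have cd := h.continuous_shearDiv hu
  have cq := continuous_quadForm (c u)
  have hc := h.symm_c u hu
  simp only [NullInfinityData.cwyAngularMomentum, NullInfinityData.classicalAngularMomentum,
    rotation_eq]
  rw [integral_sum_mul_sub (fun a => continuous_epsilon a k) (fun a => by fun_prop)
    (fun a => by fun_prop), integral_rotation_quadForm_grad (smooth_m D hu) hc,
    h.integral_quadForm_mul_m hmh hu (rotateQuad_isSymm k _) (rotateQuad_trace hc k),
    sum_mul_rotateQuad (hmh u hu).1 hc, sum_mul_rotateQuad hc hc, epsContract_self hc]
  ring

/-- `ε` turns the boost field into minus the rotation field, so the correction has the shape of the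
one for angular momentum, with `c̲` for `c` and a factor `-2`. -/
theorem cwyCenterOfMass_eq_sub (hu : u ∈ I) (k : Fin 3) :
    D.cwyCenterOfMass (fun t => quadForm (cb t)) k u = D.classicalCenterOfMass k u
      - 2 * ∫ x, quadForm (rotateQuad k (cb u)) x * D.m u x ∂area := by
  have cm := continuous_grad_m D hu
  have ce := continuous_epsilon
  have cq := continuous_quadForm (cb u)
  have h1 : ∀ x, ∑ a, sigma x a k * (2 * quadForm (cb u) x *
      ∑ b, epsilon x a b * grad (D.m u) x b)
      = ∑ a, epsilon x a k * (-2 * (quadForm (cb u) x * grad (D.m u) x a)) := by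
    intro x
    have h2 := sum_sigma_mul_epsilon x k
    simp only [Fin.sum_univ_three] at *
    linear_combination 2 * quadForm (cb u) x * (grad (D.m u) x 0 * h2 0 + grad (D.m u) x 1 * h2 1
      + grad (D.m u) x 2 * h2 2)
  simp only [NullInfinityData.cwyCenterOfMass, NullInfinityData.classicalCenterOfMass, grad_X]
  rw [integral_sum_mul_sub (fun a => continuous_sigma a k) (h.continuous_centerForm hu)
    (fun a => by fun_prop)]
  simp only [h1]
  rw [integral_sum_mul_const, integral_rotation_quadForm_grad (smooth_m D hu) (h.symm_cb u hu)]
  ring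

theorem cwyCenterOfMass_eq (hmh : ∀ u ∈ I, IsModeTwoPart (D.modifiedMass u) (mh u))
    (hu : u ∈ I) (k : Fin 3) :
    D.cwyCenterOfMass (fun t => quadForm (cb t)) k u = D.classicalCenterOfMass k u
      + 32 * Real.pi / 15 * (epsContract (cb u) (mh u) k + 3 * epsContract (cb u) (c u) k) := by
  rw [h.cwyCenterOfMass_eq_sub hu, h.integral_quadForm_mul_m hmh hu (rotateQuad_isSymm k _)
    (rotateQuad_trace (h.symm_cb u hu) k), sum_mul_rotateQuad (hmh u hu).1 (h.symm_cb u hu),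
    sum_mul_rotateQuad (h.symm_c u hu) (h.symm_cb u hu)]
  ring

theorem hasDerivWithinAt_cwyAngularMomentum
    (hmh : ∀ u ∈ I, IsModeTwoPart (D.modifiedMass u) (mh u)) (hu : u ∈ I) (k : Fin 3) :
    HasDerivWithinAt (D.cwyAngularMomentum (fun t => quadForm (c t)) k)
      (16 * Real.pi / 15 * (3 * epsContract (c u) (n u) k + 3 * epsContract (cb u) (nb u) k
        - epsContract (n u) (mh u) k - epsContract (c u) (massModeRate (n u) (nb u)) k)) I u := by
  have h1 := (h.hasDerivWithinAt_classicalAngularMomentum hu k).sub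
    ((hasDerivWithinAt_epsContract (h.deriv_c u hu) (h.hasDerivWithinAt_modeTwo hmh hu)
      k).const_mul (16 * Real.pi / 15))
  refine (h1.congr_of_mem (fun t ht => h.cwyAngularMomentum_eq hmh ht k) hu).congr_deriv ?_
  ring

theorem hasDerivWithinAt_cwyCenterOfMass
    (hmh : ∀ u ∈ I, IsModeTwoPart (D.modifiedMass u) (mh u)) (hu : u ∈ I) (k : Fin 3) :
    HasDerivWithinAt (D.cwyCenterOfMass (fun t => quadForm (cb t)) k)
      (16 * Real.pi / 15 * (2 * epsContract (nb u) (mh u) k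
        + 2 * epsContract (cb u) (massModeRate (n u) (nb u)) k
        + 6 * epsContract (nb u) (c u) k + 6 * epsContract (cb u) (n u) k)
        + 32 * u * Real.pi / 15 * epsContract (n u) (nb u) k) I u := by
  have h1 := (h.hasDerivWithinAt_classicalCenterOfMass hu k).add
    (((hasDerivWithinAt_epsContract (h.deriv_cb u hu) (h.hasDerivWithinAt_modeTwo hmh hu) k).add
      ((hasDerivWithinAt_epsContract (h.deriv_cb u hu) (h.deriv_c u hu) k).const_mul
        3)).const_mul (32 * Real.pi / 15))
  refine (h1.congr_of_mem (fun t ht => h.cwyCenterOfMass_eq hmh ht k) hu).congr_deriv ?_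
  ring

/-- By parts, `-c ∇m` against the boost yields `∑ c_{kj} P^j - 4 ∫ X^k c m`, and `3 X^k c m` reduces
the `4` to `1`. The `c̲` terms of the two forms agree, and the quadratic term in the co-closed shear
is odd. -/
theorem cwyCenterOfMassGeneral_eq (hu : u ∈ I) (k : Fin 3) :
    D.cwyCenterOfMassGeneral (fun t => quadForm (c t)) (fun t => quadForm (cb t)) k u
      = D.cwyCenterOfMass (fun t => quadForm (cb t)) k u + ∑ j, c u k j * D.momentum j u
        - ∫ x, X k x * quadForm (c u) x * D.m u x ∂area := by
  have hb := h.symm_cb u hu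
  have cs := fun a => continuous_sigma a k
  have cF := h.continuous_centerForm hu
  have cg := continuous_grad_m D hu
  have cm := (smooth_m D hu).continuous
  have cq := continuous_quadForm
  have cX := continuous_X
  have cl := fun j => continuous_lin (c u j)
  have ce := continuous_epsilon
  have cb' := fun j => continuous_lin (cb u j)
  have hE : ∀ x, ∑ a, sigma x a k * (D.centerForm u x a - quadForm (c u) x * grad (D.m u) x a
      + 2 * (∑ b, epsilon x a b * grad (quadForm (cb u)) x b) * D.m u x)
      = ∑ a, sigma x a k * (D.centerForm u x a - quadForm (c u) x * grad (D.m u) x a)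
        - 2 * (quadForm (rotateQuad k (cb u)) x * D.m u x) := by
    intro x
    have h2 := sum_sigma_mul_epsilon x k
    have h3 := sum_X_mul_epsilon x k
    rw [(hasGrad_quadForm hb).grad_eq, quadForm_rotateQuad]
    simp only [Fin.sum_univ_three] at *
    linear_combination 4 * D.m u x * ((lin (cb u 0) x - quadForm (cb u) x * X 0 x) * h2 0
      + (lin (cb u 1) x - quadForm (cb u) x * X 1 x) * h2 1
      + (lin (cb u 2) x - quadForm (cb u) x * X 2 x) * h2 2 + quadForm (cb u) x * h3)
  have hodd : ∫ x, X k x * ∑ b, div2 (coclosedPart (quadForm (cb u))) x b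
      * div2 (coclosedPart (quadForm (cb u))) x b ∂area = 0 := by
    rw [coclosedPart_quadForm hb (h.trace_cb u hu)]
    refine integral_eq_zero_of_odd fun x => ?_
    simp only [div2_dualShear hb, X_neg, epsilon_neg, lin_neg, Fin.sum_univ_three]
    ring
  have cd : Continuous fun x => ∑ b, div2 (coclosedPart (quadForm (cb u))) x b
      * div2 (coclosedPart (quadForm (cb u))) x b := by
    rw [coclosedPart_quadForm hb (h.trace_cb u hu)]
    simp only [div2_dualShear hb]
    fun_prop
  have hP : ∑ j, c u k j * D.momentum j u = 2 * ∫ x, lin (c u k) x * D.m u x ∂area := by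
    simp only [NullInfinityData.momentum, ← integral_const_mul]
    rw [← integral_finsetSum _ fun j _ => integrable_of_continuous (by fun_prop)]
    congr 1 with x
    simp only [lin, Fin.sum_univ_three]
    ring
  have h1 : ∀ x, 3 * X k x * quadForm (c u) x * D.m u x - 1 / 4 * X k x *
      ∑ b, div2 (coclosedPart (quadForm (cb u))) x b * div2 (coclosedPart (quadForm (cb u))) x b
      = 3 * (X k x * quadForm (c u) x * D.m u x) - 1 / 4 * (X k x *
      ∑ b, div2 (coclosedPart (quadForm (cb u))) x b
        * div2 (coclosedPart (quadForm (cb u))) x b) := fun x => by ring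
  have h2 : ∫ x, D.m u x * (2 * lin (c u k) x - 4 * (X k x * quadForm (c u) x)) ∂area
      = 2 * (∫ x, lin (c u k) x * D.m u x ∂area)
        - 4 * ∫ x, X k x * quadForm (c u) x * D.m u x ∂area := by
    rw [← integral_const_mul, ← integral_const_mul,
      ← integral_sub (integrable_of_continuous (by fun_prop))
        (integrable_of_continuous (by fun_prop))]
    congr 1 with x
    ring
  rw [h.cwyCenterOfMass_eq_sub hu, hP]
  simp only [NullInfinityData.cwyCenterOfMassGeneral, NullInfinityData.classicalCenterOfMass,
    grad_X, hE, h1]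
  rw [integral_sub (integrable_of_continuous (by fun_prop))
    (integrable_of_continuous (by fun_prop)), integral_sub (integrable_of_continuous (by fun_prop))
    (integrable_of_continuous (by fun_prop)), integral_const_mul, integral_const_mul,
    integral_const_mul, hodd, integral_sum_mul_sub cs cF (fun a => by fun_prop),
    integral_boost_quadForm_grad (smooth_m D hu) (h.symm_c u hu), h2]
  ring

end HasQuadrupoleShear

end

end NullInfinity

end

theorem mainTheorem9 (I : Set ℝ) (hI : I.OrdConnected) (hI' : I.Nontrivial)
    (D : NullInfinity.NullInfinityData I)
    (c cb n nb mh : ℝ → Matrix (Fin 3) (Fin 3) ℝ)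
    (hc : ∀ u ∈ I, (c u).IsSymm ∧ (c u).trace = 0)
    (hcb : ∀ u ∈ I, (cb u).IsSymm ∧ (cb u).trace = 0)
    (hC : ∀ u ∈ I, ∀ x a b, D.shear u x a b =
      NullInfinity.closedPart (NullInfinity.quadForm (c u)) x a b
        + NullInfinity.coclosedPart (NullInfinity.quadForm (cb u)) x a b)
    (hn : ∀ u ∈ I, ∀ i j, HasDerivWithinAt (fun t => c t i j) (n u i j) I u)
    (hnb : ∀ u ∈ I, ∀ i j, HasDerivWithinAt (fun t => cb t i j) (nb u i j) I u)
    (hmh : ∀ u ∈ I, NullInfinity.IsModeTwoPart (D.modifiedMass u) (mh u)) :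
    ∀ u ∈ I,
      -- energy and linear momentum
      HasDerivWithinAt D.energy
        (-(8 * Real.pi / 5) * (NullInfinity.sqNorm (n u) + NullInfinity.sqNorm (nb u))) I u ∧
      (∀ k, HasDerivWithinAt (D.momentum k)
        (-(32 * Real.pi / 15) * NullInfinity.epsContract (n u) (nb u) k) I u) ∧
      -- classical angular momentum and center of mass
      (∀ k, HasDerivWithinAt (D.classicalAngularMomentum k)
        (16 * Real.pi / 5 * (NullInfinity.epsContract (c u) (n u) k
          + NullInfinity.epsContract (cb u) (nb u) k)) I u) ∧
      (∀ k, HasDerivWithinAt (D.classicalCenterOfMass k)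
        (32 * u * Real.pi / 15 * NullInfinity.epsContract (n u) (nb u) k) I u) ∧
      -- the mode-two part of the modified mass aspect
      (∀ k l, HasDerivWithinAt (fun t => mh t k l)
        (NullInfinity.massModeRate (n u) (nb u) k l) I u) ∧
      -- Chen-Wang-Yau angular momentum and center of mass
      (∀ k, HasDerivWithinAt
        (D.cwyAngularMomentum (fun t => NullInfinity.quadForm (c t)) k)
        (16 * Real.pi / 15 * (3 * NullInfinity.epsContract (c u) (n u) k
          + 3 * NullInfinity.epsContract (cb u) (nb u) k
          - NullInfinity.epsContract (n u) (mh u) k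
          - NullInfinity.epsContract (c u) (NullInfinity.massModeRate (n u) (nb u)) k)) I u) ∧
      (∀ k, HasDerivWithinAt
        (D.cwyCenterOfMass (fun t => NullInfinity.quadForm (cb t)) k)
        (16 * Real.pi / 15 * (2 * NullInfinity.epsContract (nb u) (mh u) k
          + 2 * NullInfinity.epsContract (cb u) (NullInfinity.massModeRate (n u) (nb u)) k
          + 6 * NullInfinity.epsContract (nb u) (c u) k
          + 6 * NullInfinity.epsContract (cb u) (n u) k)
          + 32 * u * Real.pi / 15 * NullInfinity.epsContract (n u) (nb u) k) I u) ∧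
      -- relation to the Chen-Wang-Yau center of mass for arbitrary potentials
      (∀ k, D.cwyCenterOfMassGeneral (fun t => NullInfinity.quadForm (c t))
          (fun t => NullInfinity.quadForm (cb t)) k u =
        D.cwyCenterOfMass (fun t => NullInfinity.quadForm (cb t)) k u
          + ∑ j, c u k j * D.momentum j u
          - ∫ x, NullInfinity.X k x * NullInfinity.quadForm (c u) x * D.m u x
              ∂NullInfinity.area) := by
  have h := NullInfinity.HasQuadrupoleShear.mk_of_potentials hI hI' hc hcb hC hn hnb
  exact fun u hu => ⟨h.hasDerivWithinAt_energy hu, h.hasDerivWithinAt_momentum hu,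
    h.hasDerivWithinAt_classicalAngularMomentum hu, h.hasDerivWithinAt_classicalCenterOfMass hu,
    h.hasDerivWithinAt_modeTwo hmh hu, h.hasDerivWithinAt_cwyAngularMomentum hmh hu,
    h.hasDerivWithinAt_cwyCenterOfMass hmh hu, h.cwyCenterOfMassGeneral_eq hu⟩
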